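/- Let $k\ge 1$ and $n\ge k+2$ be integers and let $V=\mathbb{C}^n$. Let $G(k,V)$ and $G(k+1,V)$ be the Grassmannians of $k$- and $(k+1)$-dimensional linear subspaces of $V$, each with its Plücker line bundle $\mathcal{O}(1)$, tautological subbundle $\mathcal{U}$ and tautological quotient bundle $\mathcal{Q}$. Let $F=F(k,k+1,V)$ be the variety of flags $V_k\subset V_{k+1}\subset V$, with projections $h_1:F\to G(k,V)$ and $h_2:F\to G(k+1,V)$, and let $\mathcal{O}(1,1)=h_1^*\mathcal{O}(1)\otimes h_2^*\mathcal{O}(1)$, so that $h_{1*}\mathcal{O}(1,1)=\mathcal{Q}^\vee(2)$ and $h_{2*}\mathcal{O}(1,1)=\mathcal{U}(2)$. For $S\in H^0(F,\mathcal{O}(1,1))$ let $Y_1\subset G(k,V)$ be the zero scheme of $h_{1*}S\in H^0(G(k,V),\mathcal{Q}^\vee(2))$ and let $Y_2\subset G(k+1,V)$ be the zero scheme of $h_{2*}S\in H^0(G(k+1,V),\mathcal{U}(2))$. **Lemma.** For general $S$ (that is, for all $S$ in a nonempty Zariski open subset of $H^0(F,\mathcal{O}(1,1))$), the following hold. 1.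 $Y_1$ is nonempty and smooth over $\mathbb{C}$, everywhere of dimension $d_1=kn-k^2-n+k$, and its canonical sheaf satisfies $\omega_{Y_1}\cong\mathcal{O}_{Y_1}(n-2k-1)$. 2. $Y_2$ is nonempty and smooth over $\mathbb{C}$, everywhere of dimension $d_2=kn+n-k^2-3k-2$, and its canonical sheaf satisfies $\omega_{Y_2}\cong\mathcal{O}_{Y_2}(-n+2k+1)$. Here $\mathcal{O}_{Y_i}(m)$ is the restriction to $Y_i$ of the $m$-th power of the Plücker line bundle, and $\omega_{Y_i}=\bigwedge^{d_i}\Omega_{Y_i/\mathbb{C}}$. -/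

import Mathlib

noncomputable section

namespace GrassmannPair

open AlgebraicGeometry CategoryTheory HomogeneousLocalization

/-! ### "General" elements of a complex vector space -/

/-- `P` holds for a general element of the complex vector space `W`: there is a nonzero polynomial
function `p` on `W` such that `P` holds on the Zariski open set `p ≠ 0`.  Polynomial functions are
the elements of the algebra generated by the linear functionals. -/
def ForGeneral {W : Type*} [AddCommGroup W] [Module ℂ W] (P : W → Prop) : Prop :=
  ∃ p ∈ Algebra.adjoin ℂ (Set.range fun (l : Module.Dual ℂ W) (w : W) => l w),
    p ≠ 0 ∧ ∀ w, p w ≠ 0 → P w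

/-! ### Differential forms and twists on `Proj` of a graded `ℂ`-algebra -/

section Proj

/-- The map `⋀ᵈ Ω_{R/ℂ} → ⋀ᵈ Ω_{S/ℂ}` induced by a homomorphism of `ℂ`-algebras `R → S`,
sending `r • dr₁ ∧ ⋯ ∧ dr_d` to `u r • d(u r₁) ∧ ⋯ ∧ d(u r_d)`. -/
def formsMap {R S : Type} [CommRing R] [CommRing S] [Algebra ℂ R] [Algebra ℂ S]
    (u : R →ₐ[ℂ] S) (d : ℕ) :
    ⋀[R]^d (Ω[R⁄ℂ]) →+ ⋀[S]^d (Ω[S⁄ℂ]) :=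
  letI : Algebra R S := u.toRingHom.toAlgebra
  haveI : IsScalarTower ℂ R S := IsScalarTower.of_algebraMap_eq fun r => (u.commutes r).symm
  (exteriorPower.alternatingMapLinearEquiv (R := R) (n := d)
    ({ ((exteriorPower.ιMulti S d (M := Ω[S⁄ℂ])).toMultilinearMap.restrictScalars R).compLinearMap
        (fun _ => KaehlerDifferential.map ℂ ℂ R S) with
      map_eq_zero_of_eq' := fun _ _ _ h hij =>
        (exteriorPower.ιMulti S d (M := Ω[S⁄ℂ])).map_eq_zero_of_eq _
          (congrArg (KaehlerDifferential.map ℂ ℂ R S) h) hij } :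
      (Ω[R⁄ℂ]) [⋀^Fin d]→ₗ[R] (⋀[S]^d (Ω[S⁄ℂ])))).toAddMonoidHom

theorem formsMap_ιMulti {R S : Type} [CommRing R] [CommRing S] [Algebra ℂ R] [Algebra ℂ S]
    (u : R →ₐ[ℂ] S) (d : ℕ) (r : R) (a : Fin d → R) :
    formsMap u d (r • exteriorPower.ιMulti R d fun i => KaehlerDifferential.D ℂ R (a i)) =
      u r • exteriorPower.ιMulti S d fun i => KaehlerDifferential.D ℂ S (u (a i)) := by
  let : Algebra R S := u.toRingHom.toAlgebra
  have : IsScalarTower ℂ R S := IsScalarTower.of_algebraMap_eq fun r => (u.commutes r).symm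
  unfold formsMap
  simp only [LinearMap.toAddMonoidHom_coe, map_smul]
  rw [exteriorPower.alternatingMapLinearEquiv_apply_ιMulti]
  refine (algebraMap_smul S r _).symm.trans (congrArg (fun z => u r • z) ?_)
  exact congrArg (exteriorPower.ιMulti S d)
    (funext fun i => KaehlerDifferential.map_D ℂ ℂ R S (a i))

variable {A : Type} [CommRing A] [Algebra ℂ A] (𝒜 : ℕ → Submodule ℂ A) [GradedAlgebra 𝒜]

/-- The `ℂ`-algebra structure on the degree zero part of a localization. -/
instance algebraHomogeneousLocalization (x : Submonoid A) :
    Algebra ℂ (HomogeneousLocalization 𝒜 x) where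
  algebraMap := (fromZeroRingHom 𝒜 x).comp (algebraMap ℂ (𝒜 0))
  commutes' _ _ := mul_comm _ _
  smul_def' c y := by
    apply val_injective
    rw [val_smul, val_mul, Algebra.smul_def]
    rfl

/-- The scheme `Proj A` over `Spec ℂ`. -/
def projToSpec : Proj 𝒜 ⟶ Spec (.of ℂ) :=
  Proj.toSpecZero 𝒜 ≫ Spec.map (CommRingCat.ofHom (algebraMap ℂ (𝒜 0)))

/-- The restriction `Γ(D₊(f), 𝒪) → Γ(D₊(fg), 𝒪)` as a map of `ℂ`-algebras. -/
def awayRes (f : A) {g : A} {e' : ℕ} (hg : g ∈ 𝒜 e') : Away 𝒜 f →ₐ[ℂ] Away 𝒜 (f * g) where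
  __ := awayMap 𝒜 hg rfl
  commutes' c := awayMap_fromZeroRingHom 𝒜 hg rfl (algebraMap ℂ (𝒜 0) c)

/-- The restriction `A_f → A_{fg}`. -/
def locRes (f g : A) : Localization.Away f →+* Localization.Away (f * g) :=
  Localization.awayLift (algebraMap A _) f
    (isUnit_of_dvd_unit (map_dvd _ ⟨g, rfl⟩) (IsLocalization.Away.algebraMap_isUnit (f * g)))

/-- The sections over `D₊(f)`, `f` homogeneous of degree `e > 0`, of Serre's twisting sheaf `𝒪(m)`
on `Proj A`: the degree `m` part of `A_f`, i.e. the module of all fractions `a / f ^ N` with `a`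
homogeneous of degree `N * e + m`. -/
def twist (f : A) (e : ℕ) (m : ℤ) : Submodule (Away 𝒜 f) (Localization.Away f) :=
  Submodule.span (Away 𝒜 f)
    {x | ∃ (N j : ℕ), ∃ a ∈ 𝒜 j, (j : ℤ) = N * e + m ∧
      x * algebraMap A (Localization.Away f) f ^ N = algebraMap A (Localization.Away f) a}

/-- `ω ≅ 𝒪(m)` on `Proj A`, where `ω = ⋀ᵈ Ω_{Proj A/ℂ}` is the sheaf of `d`-forms (this is the
canonical sheaf if `Proj A` is smooth of dimension `d`).  An isomorphism of these two quasi-coherent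
sheaves is given on the basis of the affine open sets `D₊(f)`, `f` homogeneous of positive degree:
it is a family of isomorphisms between `Γ(D₊(f), 𝒪(m)) = (A_f)_m` and
`Γ(D₊(f), ω) = ⋀ᵈ Ω_{A_(f)/ℂ}`, linear over `Γ(D₊(f), 𝒪) = A_(f)`, which is compatible with the
restrictions from `D₊(f)` to `D₊(fg) = D₊(f) ∩ D₊(g)`. -/
def CanonicalIsoTwist (d : ℕ) (m : ℤ) : Prop :=
  ∃ φ : ∀ (f : A) (e : ℕ), 0 < e → f ∈ 𝒜 e →
      (twist 𝒜 f e m ≃ₗ[Away 𝒜 f] ⋀[Away 𝒜 f]^d (Ω[Away 𝒜 f⁄ℂ])),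
    ∀ (f g : A) (e e' : ℕ) (he : 0 < e) (hf : f ∈ 𝒜 e) (hg : g ∈ 𝒜 e')
      (s : twist 𝒜 f e m) (t : twist 𝒜 (f * g) (e + e') m),
      (t : Localization.Away (f * g)) = locRes f g s →
        φ (f * g) (e + e') (Nat.add_pos_left he e') (SetLike.mul_mem_graded hf hg) t =
          formsMap (awayRes 𝒜 f hg) d (φ f e he hf s)

/-- The grading of the quotient of a graded algebra by an ideal. -/
def quotGrading (I : Ideal A) (m : ℕ) : Submodule ℂ (A ⧸ I) :=
  (𝒜 m).map (Ideal.Quotient.mkₐ ℂ I).toLinearMap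

instance quotGradedMonoid (I : Ideal A) : SetLike.GradedMonoid (quotGrading 𝒜 I) where
  one_mem := ⟨1, SetLike.one_mem_graded 𝒜, rfl⟩
  mul_mem := by
    rintro i j _ _ ⟨a, ha, rfl⟩ ⟨b, hb, rfl⟩
    exact ⟨a * b, SetLike.mul_mem_graded ha hb, map_mul (Ideal.Quotient.mkₐ ℂ I) a b⟩

/-- The map `A_m → (A/I)_m`. -/
def quotComponent (I : Ideal A) (m : ℕ) : 𝒜 m →ₗ[ℂ] quotGrading 𝒜 I m :=
  ((Ideal.Quotient.mkₐ ℂ I).toLinearMap.comp (𝒜 m).subtype).codRestrict (quotGrading 𝒜 I m)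
    fun a => ⟨a, a.2, rfl⟩

/-- The map `A → ⨁ₘ (A/I)ₘ`. -/
def quotDecomposeAux (I : Ideal A) : A →ₐ[ℂ] DirectSum ℕ fun m => quotGrading 𝒜 I m :=
  (DirectSum.toAlgebra ℂ (fun m => 𝒜 m)
    (fun m => (DirectSum.lof ℂ ℕ (fun m => quotGrading 𝒜 I m) m).comp (quotComponent 𝒜 I m))
    rfl
    (fun {i j} a b => by
      simp only [LinearMap.comp_apply, DirectSum.lof_eq_of, DirectSum.of_mul_of]
      rfl)).comp
    (DirectSum.decomposeAlgEquiv 𝒜 : A →ₐ[ℂ] DirectSum ℕ fun m => 𝒜 m)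

theorem quotDecomposeAux_of_mem (I : Ideal A) {m : ℕ} {a : A} (ha : a ∈ 𝒜 m) :
    quotDecomposeAux 𝒜 I a = DirectSum.of (fun m => quotGrading 𝒜 I m) m
      ⟨Ideal.Quotient.mk I a, ⟨a, ha, rfl⟩⟩ := by
  have h : (DirectSum.decomposeAlgEquiv 𝒜 : A →ₐ[ℂ] DirectSum ℕ fun m => 𝒜 m) a =
      DirectSum.of (fun m => 𝒜 m) m ⟨a, ha⟩ :=
    DirectSum.decompose_of_mem 𝒜 ha
  unfold quotDecomposeAux
  rw [AlgHom.comp_apply, h]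
  exact DirectSum.toAddMonoid_of _ m _

/-- The quotient of a graded algebra by a homogeneous ideal is graded. -/
@[reducible] def quotGradedAlgebra (I : Ideal A) (hI : I.IsHomogeneous 𝒜) : GradedAlgebra (quotGrading 𝒜 I) :=
  GradedAlgebra.ofAlgHom (quotGrading 𝒜 I)
    (Ideal.Quotient.liftₐ I (quotDecomposeAux 𝒜 I) (by
      classical
      intro a ha
      rw [← DirectSum.sum_support_decompose 𝒜 a, map_sum]
      refine Finset.sum_eq_zero fun i _ => ?_
      rw [quotDecomposeAux_of_mem 𝒜 I (SetLike.coe_mem _)]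
      have h0 : Ideal.Quotient.mk I (DirectSum.decompose 𝒜 a i : A) = 0 :=
        Ideal.Quotient.eq_zero_iff_mem.mpr (hI i ha)
      simp only [h0]
      exact map_zero _))
    (by
      classical
      refine Ideal.Quotient.algHom_ext ℂ (AlgHom.ext fun a => ?_)
      simp only [AlgHom.comp_apply, AlgHom.id_apply]
      conv_lhs => rw [← DirectSum.sum_support_decompose 𝒜 a]
      conv_rhs => rw [← DirectSum.sum_support_decompose 𝒜 a]
      simp only [map_sum]
      refine Finset.sum_congr rfl fun i _ => ?_
      erw [Ideal.Quotient.liftₐ_apply, Ideal.Quotient.lift_mk]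
      erw [quotDecomposeAux_of_mem 𝒜 I (SetLike.coe_mem _)]
      exact DirectSum.coeAlgHom_of _ _ _)
    (by
      rintro i ⟨_, a, ha, rfl⟩
      exact quotDecomposeAux_of_mem 𝒜 I ha)

end Proj

/-! ### Matrices, minors and the Plücker embedding

A point of `G(k, ℂⁿ)` is represented by a frame: an `n × k` matrix of rank `k` whose columns span
the subspace; two frames of the same subspace differ by an element of `GL_k`. -/

/-- The ring of polynomial functions on `n × k` matrices. -/
abbrev MatPoly (n k : ℕ) : Type := MvPolynomial (Fin n × Fin k) ℂ

/-- The value of a polynomial function at a matrix. -/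
def evalAt {n k : ℕ} (M : Matrix (Fin n) (Fin k) ℂ) (f : MatPoly n k) : ℂ :=
  MvPolynomial.eval (fun ij => M ij.1 ij.2) f

/-- The homogeneous coordinate ring of the projective space `ℙ(⋀ᵏ ℂⁿ)`; its variables, the Plücker
coordinates, are indexed by the `k`-element subsets of `{1, …, n}`. -/
abbrev PluckerPoly (n k : ℕ) : Type := MvPolynomial (Fin k ↪o Fin n) ℂ

/-- The Plücker embedding on frames: a Plücker coordinate goes to the corresponding maximal
minor. -/
def pluckerMap (n k : ℕ) : PluckerPoly n k →ₐ[ℂ] MatPoly n k :=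
  MvPolynomial.aeval fun I =>
    Matrix.det (Matrix.of fun (i : Fin k) (j : Fin k) =>
      (MvPolynomial.X (I i, j) : MatPoly n k))

/-- The homogeneous ideal of the closed subscheme of `G(k, ℂⁿ) ⊆ ℙ(⋀ᵏ ℂⁿ)` whose preimage in the
space of frames is defined by the equations `s`: it is generated by the forms which lie in the ideal
generated by `s` after substitution of the minors.  For `s = ∅` it is the ideal of the Plücker
relations. -/
def pluckerIdeal {n k : ℕ} (s : Set (MatPoly n k)) : Ideal (PluckerPoly n k) :=
  Ideal.span {F | (∃ m, F.IsHomogeneous m) ∧ pluckerMap n k F ∈ Ideal.span s}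

attribute [local instance] MvPolynomial.gradedAlgebra

theorem pluckerIdeal_isHomogeneous {n k : ℕ} (s : Set (MatPoly n k)) :
    (pluckerIdeal s).IsHomogeneous (MvPolynomial.homogeneousSubmodule (Fin k ↪o Fin n) ℂ) :=
  Ideal.homogeneous_span _ _ fun _ h => h.1

/-- The homogeneous coordinate ring of the closed subscheme of `G(k, ℂⁿ)` defined by `s`. -/
abbrev CoordRing {n k : ℕ} (s : Set (MatPoly n k)) : Type := PluckerPoly n k ⧸ pluckerIdeal s

/-- The grading of the homogeneous coordinate ring, with the Plücker coordinates in degree one. -/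
def coordGrading {n k : ℕ} (s : Set (MatPoly n k)) : ℕ → Submodule ℂ (CoordRing s) :=
  quotGrading (MvPolynomial.homogeneousSubmodule (Fin k ↪o Fin n) ℂ) (pluckerIdeal s)

instance coordGradedAlgebra {n k : ℕ} (s : Set (MatPoly n k)) : GradedAlgebra (coordGrading s) :=
  quotGradedAlgebra _ _ (pluckerIdeal_isHomogeneous s)

/-- The closed subscheme of the Grassmannian `G(k, ℂⁿ)` (in its Plücker embedding) whose preimage in
the space of frames is defined by the equations `s`. -/
def subscheme {n k : ℕ} (s : Set (MatPoly n k)) : Scheme := Proj (coordGrading s)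

/-- Its structure morphism. -/
def subschemeToSpec {n k : ℕ} (s : Set (MatPoly n k)) : subscheme s ⟶ Spec (.of ℂ) :=
  projToSpec (coordGrading s)

/-! ### Sections of `𝒪(1,1)` on the flag variety and their pushforwards -/

/-- `H⁰(F(k, k+1, ℂⁿ), 𝒪(1,1))`.  A point `V_k ⊂ V_{k+1}` of the flag variety is represented by an
`n × (k+1)` matrix of rank `k+1` whose columns span `V_{k+1}` and whose first `k` columns span
`V_k`; two such matrices differ by an element `b` of the parabolic subgroup of `GL_{k+1}` of matrices
whose last row vanishes except for its last entry.  Since `𝒪(1,1)` is the line bundle with fibre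
`(⋀ᵏ V_k)^∨ ⊗ (⋀ᵏ⁺¹ V_{k+1})^∨`, its sections are the functions `S` on such matrices with
`S(X b) = det(b') det(b) S(X)`, where `b'` is the upper left `k × k` block of `b`.  (For `k + 2 ≤ n`
the matrices of smaller rank have codimension at least two, so that regular functions on the matrices
of rank `k+1` are polynomials.) -/
def flagSections (n k : ℕ) : Submodule ℂ (MatPoly n (k + 1)) where
  carrier := {S | ∀ b : Matrix (Fin (k + 1)) (Fin (k + 1)) ℂ, IsUnit b.det →
    (∀ j : Fin k, b (Fin.last k) j.castSucc = 0) →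
    ∀ X : Matrix (Fin n) (Fin (k + 1)) ℂ,
      evalAt (X * b) S = (b.submatrix Fin.castSucc Fin.castSucc).det * b.det * evalAt X S}
  zero_mem' := by
    intro b _ _ X
    simp [evalAt]
  add_mem' := by
    intro S T hS hT b h h' X
    have h1 := hS b h h' X
    have h2 := hT b h h' X
    simp only [evalAt, map_add] at h1 h2 ⊢
    rw [h1, h2]
    ring
  smul_mem' := by
    intro c S hS b h h' X
    have h1 := hS b h h' X
    simp only [evalAt, MvPolynomial.smul_eval] at h1 ⊢
    rw [h1]
    ring

/-- The section `h_{1*} S` of `𝒬^∨(2) ⊆ (ℂⁿ)^∨ ⊗ 𝒪(2)` on `G(k, ℂⁿ)`: at the subspace with frame `A`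
it is the linear form `v ↦ S(A, v)` on `ℂⁿ`, where `(A, v)` is the matrix `A` with `v` appended as
its last column.  This is its `r`-th coordinate `S(A, e_r)`, as a function of the frame `A`. -/
def pushforward₁ {n k : ℕ} (S : MatPoly n (k + 1)) (r : Fin n) : MatPoly n k :=
  MvPolynomial.aeval (fun ij : Fin n × Fin (k + 1) =>
    (Fin.snoc (α := fun _ => MatPoly n k) (fun j => MvPolynomial.X (ij.1, j))
      (if ij.1 = r then 1 else 0) ij.2 : MatPoly n k)) S

/-- The section `h_{2*} S` of `𝒰(2) ⊆ ℂⁿ ⊗ 𝒪(2)` on `G(k+1, ℂⁿ)`.  For a subspace `W` with frame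
`X = (x_0, …, x_k)`, the restriction of `S` to the fibre `{V_k ⊂ W}` is a linear form `l` on `⋀ᵏ W`
with values in the line `(⋀ᵏ⁺¹ W)^∨`, and `S(w_1, …, w_k, w)` is the value of `l(w_1 ∧ ⋯ ∧ w_k)` on
`w_1 ∧ ⋯ ∧ w_k ∧ w`.  Under `(⋀ᵏ W)^∨ ≅ W ⊗ (⋀ᵏ⁺¹ W)^∨`, which identifies `u ⊗ θ` with the form
`ξ ↦ θ(ξ ∧ u)`, it becomes the vector `∑ⱼ S(x_0, …, x̂_j, …, x_k, x_j) x_j`, where `x̂_j` means that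
`x_j` is omitted.  This is the `r`-th coordinate of this vector, as a function of the frame `X`. -/
def pushforward₂ {n k : ℕ} (S : MatPoly n (k + 1)) (r : Fin n) : MatPoly n (k + 1) :=
  ∑ j : Fin (k + 1), MvPolynomial.X (r, j) *
    MvPolynomial.rename (fun ic : Fin n × Fin (k + 1) =>
      (ic.1, (Fin.snoc (α := fun _ => Fin (k + 1)) j.succAbove j ic.2 : Fin (k + 1)))) S

/-- The equations of `Y₁ = Z(h_{1*} S)` in `G(k, ℂⁿ)`. -/
def eqs₁ {n k : ℕ} (S : flagSections n k) : Set (MatPoly n k) :=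
  Set.range (pushforward₁ (S : MatPoly n (k + 1)))

/-- The equations of `Y₂ = Z(h_{2*} S)` in `G(k+1, ℂⁿ)`. -/
def eqs₂ {n k : ℕ} (S : flagSections n k) : Set (MatPoly n (k + 1)) :=
  Set.range (pushforward₂ (S : MatPoly n (k + 1)))

/-- The closed subscheme of a Grassmannian defined by `s` is smooth over `ℂ`, everywhere of
dimension `d`, its Krull dimension is `d` (so it is not empty), and its canonical sheaf is isomorphic
to the restriction of the `m`-th power of the Plücker line bundle. -/
def SmoothWithDimAndCanonical {n k : ℕ} (s : Set (MatPoly n k)) (d : ℕ) (m : ℤ) : Prop :=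
  SmoothOfRelativeDimension d (subschemeToSpec s) ∧
    topologicalKrullDim (subscheme s) = d ∧
    CanonicalIsoTwist (coordGrading s) d m

end GrassmannPair

end

/-! The argument is local on the affine charts of a Grassmannian `G(K, ℂⁿ)`: subspaces with a frame
`g (1; Y)`, where `g` is a basis of `ℂⁿ` and `Y` is a `C × K` matrix, `K + C = n`. There a section
of a bundle of rank `c` is a `c`-tuple of polynomials in the entries of `Y`. Both claims are
instances of one statement, `generalWith_smoothWithDimAndCanonical`, about a linear system of such
tuples: for `Y₁` the bundle is `𝒬^∨(2)` with `K = k`, `c = C = n - k`; for `Y₂` it is `𝒰(2)` with `K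
= c = k + 1`, `C = n - k - 1`.

Smoothness is a Bertini theorem in characteristic zero. On every chart the linear system contains
all constant vectors (products of minors give them). At a closed point `x` of the zero scheme of the
generic member `∑ aᵢ fᵢ`, the derivations `∂/∂aᵢ` extend to the residue field; applied to `∑ aᵢ
fᵢ(x) = 0` they show that a left kernel vector of the Jacobian matrix is orthogonal to every
`fᵢ(x)`, hence zero (`eq_zero_of_generic_left_kernel`). So the Jacobian matrix has a right inverse
on the generic zero scheme, and clearing denominators gives one for general parameters
(`exists_jacobian_criterion`). A right inverse yields smoothness by infinitesimal lifting
(`smooth_of_jacobian`), Krull dimension `CK - c` (`ringKrullDim_eq_of_jacobian`), and the relative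
dimension from the rank of the differentials.

Nonemptiness: some member has as its equations `c` distinct coordinates of the chart, which vanish
transversally at the origin. The incidence scheme is smooth, hence open, over the parameter space
near that point, so general members also have zeros (`exists_span_ne_top`).

The canonical sheaf is adjunction made explicit. A chart trivializes the top forms by the
determinant of `d` covectors stacked on the Jacobian matrix (`exists_exteriorPower_equiv`). Let `u`
be the change of frame between two charts. The coordinates contribute `det(u)^(-n)`, the cocycle of
`ω_G = 𝒪(-n)`. The equations contribute `det(u)^(2c-1)`, the cocycle of `det 𝒬^∨(2)` and of `det
𝒰(2)`. As `det u` is a quotient of Plücker coordinates, the total is `𝒪(2c - n - 1)`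
(`ChartEquations.canonicalIsoTwist`). Gluing over `D₊(f)` for all homogeneous `f` of positive degree
gives the required family of isomorphisms.

It remains to work out how the two pushforwards change with the frame: `h_{1*} S` is linear in the
appended column and vanishes on the subspace; the coefficient vector `w` of `h_{2*} S` satisfies `h
w(Xh) = det(h)² w(X)` (`mulVec_colCoeff`), which rests on the fact that sections of `𝒪(1)` on a line
are linear. -/

noncomputable section

namespace GrassmannPair

open AlgebraicGeometry CategoryTheory HomogeneousLocalization
open scoped Matrix

attribute [local instance] MvPolynomial.gradedAlgebra

set_option linter.unusedSectionVars false

/-! ### Top exterior power of a quotient of a free module by a free direct summand. -/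

section JacobianForms

variable {R : Type*} [CommRing R] {d c : ℕ} {σ : Type*}

/-- The square matrix with rows `v` followed by the rows `J`. -/
def stackMatrix (e : Fin d ⊕ Fin c ≃ σ) (J : Fin c → σ → R) (v : Fin d → σ → R) :
    Matrix (Fin d ⊕ Fin c) (Fin d ⊕ Fin c) R :=
  Matrix.of fun i j => Sum.elim v J i (e j)

/-- The determinant of the square matrix with rows `v` followed by the rows `J`. -/
def stackDet (e : Fin d ⊕ Fin c ≃ σ) (J : Fin c → σ → R) (v : Fin d → σ → R) : R :=
  (stackMatrix e J v).det

theorem stackMatrix_update (e : Fin d ⊕ Fin c ≃ σ) (J : Fin c → σ → R) (v : Fin d → σ → R)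
    (i : Fin d) (z : σ → R) :
    stackMatrix e J (Function.update v i z) =
      (stackMatrix e J v).updateRow (Sum.inl i) (z ∘ e) := by
  ext a b
  rcases a with a | a
  · by_cases ha : a = i
    · subst ha
      simp only [stackMatrix, Matrix.of_apply, Sum.elim_inl, Function.update_self,
        Matrix.updateRow_self, Function.comp_apply]
    · simp only [stackMatrix, Matrix.of_apply, Sum.elim_inl, Function.update_of_ne ha,
        Matrix.updateRow_apply, Sum.inl.injEq, ha, if_false]
  · simp only [stackMatrix, Matrix.of_apply, Sum.elim_inr, Matrix.updateRow_apply, reduceCtorEq,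
      if_false]

/-- `stackDet`, as an alternating map of the first rows. -/
def stackDetAlternating (e : Fin d ⊕ Fin c ≃ σ) (J : Fin c → σ → R) :
    (σ → R) [⋀^Fin d]→ₗ[R] R where
  toFun v := stackDet e J v
  map_update_add' {inst} v i x y := by
    obtain rfl : inst = instDecidableEqFin d := Subsingleton.elim _ _
    simp only [stackDet, stackMatrix_update]
    exact Matrix.det_updateRow_add _ _ _ _
  map_update_smul' {inst} v i r x := by
    obtain rfl : inst = instDecidableEqFin d := Subsingleton.elim _ _
    simp only [stackDet, stackMatrix_update]
    exact Matrix.det_updateRow_smul _ _ _ _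
  map_eq_zero_of_eq' v i j h hij := by
    refine Matrix.det_zero_of_row_eq (i := Sum.inl i) (j := Sum.inl j) (by simpa using hij) ?_
    ext b
    simpa [stackMatrix] using congrFun h (e b)

/-- Left multiplication by a unipotent block matrix. Consequently the determinant depends on `v`
only modulo the rows of `J`, that is, it descends to the quotient. -/
theorem stackDet_sub (e : Fin d ⊕ Fin c ≃ σ) (J : Fin c → σ → R) (v : Fin d → σ → R)
    (w : Fin d → Fin c → R) :
    stackDet e J (fun i => v i - ∑ r, w i r • J r) = stackDet e J v := by
  have : stackMatrix e J (fun i => v i - ∑ r, w i r • J r) =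
      Matrix.fromBlocks 1 (-Matrix.of w) 0 1 * stackMatrix e J v := by
    ext a b
    rcases a with a | a
    · simp [stackMatrix, Matrix.mul_apply, Matrix.one_apply, sub_eq_add_neg]
    · simp [stackMatrix, Matrix.mul_apply, Matrix.one_apply]
  unfold stackDet
  rw [this, Matrix.det_mul, Matrix.det_fromBlocks_zero₂₁]
  simp

/-- Take for `v` the standard vectors outside the columns `φ`: the stacked matrix becomes block
triangular, and the sign comes from comparing two orderings of `σ`. -/
theorem exists_stackDet_eq_minor [Fintype σ] (e : Fin d ⊕ Fin c ≃ σ) (J : Fin c → σ → R) (φ : Fin c ↪ σ) :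
    ∃ v : Fin d → σ → R, stackDet e J v = (Matrix.of fun r s => J r (φ s)).det ∨
      stackDet e J v = -(Matrix.of fun r s => J r (φ s)).det := by
  classical
  have hcard : Fintype.card (Fin d) = Fintype.card ((Set.range φ)ᶜ : Set σ) := by
    rw [Fintype.card_compl_set, ← Fintype.card_congr e]
    simp [Set.card_range_of_injective φ.injective]
  let e₁ : Fin d ≃ ((Set.range φ)ᶜ : Set σ) := Fintype.equivOfCardEq hcard
  let e' : Fin d ⊕ Fin c ≃ σ :=
    (Equiv.sumComm _ _).trans
      ((Equiv.sumCongr (Equiv.ofInjective φ φ.injective) e₁).trans (Equiv.Set.sumCompl _))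
  have her (r : Fin c) : e' (Sum.inr r) = φ r := by simp [e']
  let v : Fin d → σ → R := fun i => Pi.single (e' (Sum.inl i)) 1
  refine ⟨v, ?_⟩
  have h1 : stackDet e' J v = (Matrix.of fun r s => J r (φ s)).det := by
    have : stackMatrix e' J v =
        Matrix.fromBlocks 1 0 (Matrix.of fun r s => J r (e' (Sum.inl s)))
          (Matrix.of fun r s => J r (φ s)) := by
      ext a b
      rcases a with a | a <;> rcases b with b | b
      · simp [stackMatrix, v, Matrix.one_apply, Pi.single_apply, eq_comm]
      · simp [stackMatrix, v]
      · simp [stackMatrix]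
      · simp [stackMatrix, her]
    unfold stackDet
    rw [this, Matrix.det_fromBlocks_zero₁₂]
    simp
  have h2 : stackDet e J v = Equiv.Perm.sign (e.trans e'.symm) * stackDet e' J v := by
    unfold stackDet
    rw [← Matrix.det_permute']
    congr 1
    ext a b
    simp [stackMatrix]
  rw [h2, h1]
  rcases Int.units_eq_one_or (Equiv.Perm.sign (e.trans e'.symm)) with h | h <;> rw [h] <;> simp

/-- The Cauchy–Binet expansion before collecting terms: multilinearity in the columns of the
product. Summing over all maps `φ`, injective or not, avoids choosing an order on `σ`. -/
theorem det_mul_eq_sum [Fintype σ] (J : Fin c → σ → R) (B : Matrix σ (Fin c) R) :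
    (Matrix.of J * B).det =
      ∑ φ : Fin c → σ, (∏ r, B (φ r) r) * (Matrix.of fun r s => J r (φ s)).det := by
  classical
  have h : ∀ r : Fin c, (Matrix.of J * B).transpose r = ∑ l : σ, B l r • fun a => J a l := by
    intro r
    ext a
    simp [Matrix.mul_apply, mul_comm]
  rw [← Matrix.det_transpose]
  change Matrix.detRowAlternating (fun r => (Matrix.of J * B).transpose r) = _
  simp_rw [h]
  rw [← AlternatingMap.coe_multilinearMap, MultilinearMap.map_sum]
  refine Finset.sum_congr rfl fun φ _ => ?_
  rw [MultilinearMap.map_smul_univ, smul_eq_mul, ← Matrix.det_transpose]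
  rfl

theorem one_mem_of_minors_mem [Fintype σ] (J : Fin c → σ → R) (B : Matrix σ (Fin c) R)
    (hB : Matrix.of J * B = 1) (I : Ideal R)
    (hI : ∀ φ : Fin c ↪ σ, (Matrix.of fun r s => J r (φ s)).det ∈ I) : (1 : R) ∈ I := by
  have h := det_mul_eq_sum J B
  rw [hB, Matrix.det_one] at h
  rw [h]
  refine Ideal.sum_mem _ fun φ _ => Ideal.mul_mem_left _ _ ?_
  by_cases hφ : Function.Injective φ
  · exact hI ⟨φ, hφ⟩
  · rw [Function.not_injective_iff] at hφ
    obtain ⟨i, j, hij, hne⟩ := hφ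
    rw [Matrix.det_zero_of_column_eq hne (by intro a; simp [hij])]
    exact I.zero_mem

variable {Q : Type*} [AddCommGroup Q] [Module R Q]

-- Multiply the wedge `v ↦ π v₁ ∧ ⋯ ∧ π v_d` by the `c`-form `w ↦ det (w B)`. The result is an
-- alternating form in `d + c` variables on a free module of that rank, hence a multiple of the
-- determinant; `η` is its value on the basis. Substituting the rows of `J` for the last `c`
-- variables gives the formula.
set_option maxHeartbeats 400000 in
theorem exists_ιMulti_eq_smul [Fintype σ] (e : Fin d ⊕ Fin c ≃ σ) (J : Fin c → σ → R)
    (B : Matrix σ (Fin c) R) (hB : Matrix.of J * B = 1) (π : (σ → R) →ₗ[R] Q)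
    (hJ : ∀ r, π (J r) = 0) :
    ∃ η : ⋀[R]^d Q, ∀ v : Fin d → σ → R,
      exteriorPower.ιMulti R d (fun i => π (v i)) = stackDet e J v • η := by
  classical
  let a : (σ → R) [⋀^Fin d]→ₗ[R] ⋀[R]^d Q := (exteriorPower.ιMulti R d).compLinearMap π
  let b : (σ → R) [⋀^Fin c]→ₗ[R] R :=
    (Matrix.detRowAlternating (n := Fin c) (R := R)).compLinearMap B.vecMulLinear
  let F : (σ → R) [⋀^Fin d ⊕ Fin c]→ₗ[R] ⋀[R]^d Q :=
    (TensorProduct.rid R (⋀[R]^d Q)).toLinearMap.compAlternatingMap (a.domCoprod b)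
  let E := Pi.basisFun R σ
  let D : (σ → R) [⋀^Fin d ⊕ Fin c]→ₗ[R] R :=
    (Matrix.detRowAlternating (n := Fin d ⊕ Fin c) (R := R)).compLinearMap
      (LinearMap.funLeft R R e)
  have hF : ∀ w, F w = D w • F (fun i => E (e i)) := by
    have : F = (LinearMap.toSpanSingleton R _ (F (fun i => E (e i)))).compAlternatingMap D := by
      refine Module.Basis.ext_alternating (E.reindex e.symm) fun v hv => ?_
      let τ : Equiv.Perm (Fin d ⊕ Fin c) := Equiv.ofBijective v (Finite.injective_iff_bijective.1 hv)
      have h1 : (fun i => E.reindex e.symm (v i)) = (fun i => E (e i)) ∘ τ := by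
        ext i; simp [τ]
      rw [h1, AlternatingMap.map_perm, AlternatingMap.map_perm]
      congr 1
      have : D (fun i => E (e i)) = 1 := by
        have : (fun i => LinearMap.funLeft R R e (E (e i))) = (1 : Matrix _ _ R) := by
          ext i j
          simp [LinearMap.funLeft_apply, E, Pi.single_apply, Matrix.one_apply, eq_comm]
        change Matrix.det _ = 1
        rw [this, Matrix.det_one]
      simp [this]
    intro w
    conv_lhs => rw [this]
    rfl
  refine ⟨F (fun i => E (e i)), fun v => ?_⟩
  have hbJ : b J = 1 := by
    have : (fun r => B.vecMulLinear (J r)) = (1 : Matrix _ _ R) := by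
      rw [← hB]; rfl
    change Matrix.det _ = 1
    rw [this, Matrix.det_one]
  -- Only the identity shuffle survives: every other one puts some row of `J` into a slot of the
  -- first factor, where `π` kills it.
  have h1 : (a.domCoprod b) (Sum.elim v J) = a v ⊗ₜ[R] b J := by
    rw [AlternatingMap.domCoprod_apply, _root_.sum_apply]
    refine (Finset.sum_eq_single
      (Quotient.mk'' 1 : Equiv.Perm.ModSumCongr (Fin d) (Fin c)) ?_ ?_).trans ?_
    rotate_left 2
    · rw [AlternatingMap.domCoprod.summand_mk'']
      simp
    · intro τ _ hτ
      induction τ using Quotient.inductionOn' with | _ τ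
      rw [AlternatingMap.domCoprod.summand_mk'']
      have : ∃ i : Fin d, ∃ r : Fin c, τ (Sum.inl i) = Sum.inr r := by
        by_contra! hcon
        apply hτ
        have hmaps : Set.MapsTo τ (Set.range Sum.inl) (Set.range Sum.inl) := by
          rintro _ ⟨i, rfl⟩
          rcases h : τ (Sum.inl i) with j | j
          · exact ⟨j, rfl⟩
          · exact absurd h (hcon i j)
        refine Quotient.sound' ?_
        rw [QuotientGroup.leftRel_apply]
        have := Equiv.Perm.mem_sumCongrHom_range_of_perm_mapsTo_inl hmaps
        simpa using this
      obtain ⟨i, r, hir⟩ := this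
      have h0 : a (fun i => Sum.elim v J (τ (Sum.inl i))) = 0 := by
        change exteriorPower.ιMulti R d (fun i => π (Sum.elim v J (τ (Sum.inl i)))) = 0
        refine (exteriorPower.ιMulti R d).map_coord_zero i ?_
        rw [hir]
        exact hJ r
      have h0' : (MultilinearMap.domCoprod a.toMultilinearMap b.toMultilinearMap).domDomCongr τ (Sum.elim v J) = 0 := by
        rw [MultilinearMap.domDomCongr_apply, MultilinearMap.domCoprod_apply]
        exact (congrArg (fun z => z ⊗ₜ[R] _) h0).trans (TensorProduct.zero_tmul _ _)
      rw [_root_.smul_apply, h0', smul_zero]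
    · simp
  have key : F (Sum.elim v J) = exteriorPower.ιMulti R d (fun i => π (v i)) := by
    change TensorProduct.rid R _ ((a.domCoprod b) (Sum.elim v J)) = _
    rw [h1, hbJ, TensorProduct.rid_tmul, one_smul]
    rfl
  rw [← key, hF]
  congr 1

/-- If `Q` is the quotient of a free module of rank `d + c` by a free direct summand with basis
`J₁, …, J_c`, then `⋀ᵈ Q` is free of rank one: `v₁ ∧ ⋯ ∧ v_d ↦ det (v₁, …, v_d, J₁, …, J_c)`. -/
theorem exists_exteriorPower_equiv [Fintype σ] (e : Fin d ⊕ Fin c ≃ σ) (J : Fin c → σ → R)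
    (B : Matrix σ (Fin c) R) (hB : Matrix.of J * B = 1) (π : (σ → R) →ₗ[R] Q)
    (hπ : Function.Surjective π) (hker : LinearMap.ker π = Submodule.span R (Set.range J)) :
    ∃ ψ : ⋀[R]^d Q ≃ₗ[R] R, ∀ v : Fin d → σ → R,
      ψ (exteriorPower.ιMulti R d fun i => π (v i)) = stackDet e J v := by
  have hJ r : π (J r) = 0 := by
    rw [← LinearMap.mem_ker, hker]
    exact Submodule.subset_span ⟨r, rfl⟩
  -- The projection along the span of `J` provided by the right inverse `B`. It kills the rows of
  -- `J`, so it descends to a section of `π`.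
  let p : (σ → R) →ₗ[R] (σ → R) :=
    LinearMap.id - (Fintype.linearCombination R J).comp B.vecMulLinear
  have hp (v : σ → R) : p v = v - ∑ r, (v ᵥ* B) r • J r := rfl
  have hpJ r : p (J r) = 0 := by
    have : (J r) ᵥ* B = Pi.single r 1 := by
      have := congrFun hB r
      ext s
      simpa [Matrix.mul_apply, Matrix.vecMul, dotProduct, Matrix.one_apply, Pi.single_apply,
        eq_comm] using congrFun this s
    rw [hp, this]
    simp [Pi.single_apply]
  have hkerp : LinearMap.ker π ≤ LinearMap.ker p := by
    rw [hker, Submodule.span_le]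
    rintro _ ⟨r, rfl⟩
    exact hpJ r
  let s : Q →ₗ[R] (σ → R) := ((LinearMap.ker π).liftQ p hkerp).comp
    (π.quotKerEquivOfSurjective hπ).symm.toLinearMap
  have hs v : s (π v) = p v := by
    have : (π.quotKerEquivOfSurjective hπ).symm (π v) = Submodule.Quotient.mk v := by
      rw [LinearEquiv.symm_apply_eq]; rfl
    simp only [s, LinearMap.comp_apply, LinearEquiv.coe_coe, this]
    rfl
  let ψ₀ : ⋀[R]^d Q →ₗ[R] R :=
    exteriorPower.alternatingMapLinearEquiv ((stackDetAlternating e J).compLinearMap s)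
  have hψ (v : Fin d → σ → R) :
      ψ₀ (exteriorPower.ιMulti R d fun i => π (v i)) = stackDet e J v := by
    simp only [ψ₀]
    rw [exteriorPower.alternatingMapLinearEquiv_apply_ιMulti]
    change stackDet e J (fun i => s (π (v i))) = _
    simp only [hs, hp]
    exact stackDet_sub e J v fun i => v i ᵥ* B
  obtain ⟨η, hη⟩ := exists_ιMulti_eq_smul e J B hB π hJ
  have hinv : (LinearMap.toSpanSingleton R _ η).comp ψ₀ = LinearMap.id := by
    refine exteriorPower.linearMap_ext (AlternatingMap.ext fun q => ?_)
    choose v hv using fun i => hπ (q i)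
    obtain rfl : (fun i => π (v i)) = q := funext hv
    simp only [LinearMap.compAlternatingMap_apply, LinearMap.comp_apply,
      LinearMap.toSpanSingleton_apply, LinearMap.id_apply]
    rw [hψ, hη]
  -- The range is an ideal containing every maximal minor of `J` up to sign, and these generate the
  -- unit ideal because `J B = 1`.
  have hsurj : LinearMap.range ψ₀ = ⊤ := by
    rw [Ideal.eq_top_iff_one]
    refine one_mem_of_minors_mem J B hB _ fun φ => ?_
    obtain ⟨v, hv | hv⟩ := exists_stackDet_eq_minor e J φ
    · exact ⟨_, (hψ v).trans hv⟩
    · exact ⟨-exteriorPower.ιMulti R d fun i => π (v i), by rw [map_neg, hψ, hv, neg_neg]⟩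
  refine ⟨LinearEquiv.ofBijective ψ₀ ⟨?_, LinearMap.range_eq_top.1 hsurj⟩, hψ⟩
  exact Function.LeftInverse.injective (g := LinearMap.toSpanSingleton R _ η)
    fun x => LinearMap.congr_fun hinv x

/-- This is where the cocycle of the canonical sheaf comes from: the determinant of a change of
equations times that of a change of coordinates. -/
theorem stackDet_mul [Fintype σ] (e : Fin d ⊕ Fin c ≃ σ) (T : Matrix (Fin c) (Fin c) R)
    (J : Fin c → σ → R) (v : Fin d → σ → R) (D : Matrix σ σ R) [DecidableEq σ] :
    stackDet e (fun r => (T * Matrix.of J * D) r) (fun i => v i ᵥ* D) =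
      T.det * stackDet e J v * D.det := by
  have : stackMatrix e (fun r => (T * Matrix.of J * D) r) (fun i => v i ᵥ* D) =
      Matrix.fromBlocks 1 0 0 T * stackMatrix e J v * D.submatrix e e := by
    ext a b
    have h (x : Fin d ⊕ Fin c → R) (y : σ → R) : ∑ j, x j * y (e j) = ∑ l, x (e.symm l) * y l :=
      Fintype.sum_equiv e _ _ (by simp)
    rw [Matrix.mul_apply]
    simp only [Matrix.submatrix_apply]
    rw [h _ fun l => D l (e b)]
    rcases a with a | a
    · simp [stackMatrix, Matrix.mul_apply, Matrix.one_apply, Matrix.vecMul, dotProduct]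
    · simp [stackMatrix, Matrix.mul_apply]
  unfold stackDet
  rw [this, Matrix.det_mul, Matrix.det_mul, Matrix.det_fromBlocks_zero₂₁, Matrix.det_one, one_mul,
    Matrix.det_submatrix_equiv_self]

theorem map_stackDet {S : Type*} [CommRing S] (f : R →+* S) (e : Fin d ⊕ Fin c ≃ σ)
    (J : Fin c → σ → R) (v : Fin d → σ → R) :
    f (stackDet e J v) = stackDet e (fun r l => f (J r l)) (fun i l => f (v i l)) := by
  unfold stackDet
  rw [RingHom.map_det]
  congr 1
  ext a b
  rcases a with a | a <;> simp [stackMatrix]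

end JacobianForms

/-! ### Gluing elements and isomorphisms of modules along a cover by localizations. -/

section Gluing

/-- The additive map `l : N → N'`, semilinear over `u : R → R'`, is the localization of the
`R`-module `N` at the powers of `r`. -/
structure IsLocMap {R R' N N' : Type*} [CommRing R] [CommRing R'] [AddCommGroup N] [Module R N]
    [AddCommGroup N'] [Module R' N'] (u : R →+* R') (r : R) (l : N →+ N') : Prop where
  map_smul : ∀ a x, l (a • x) = u a • l x
  isUnit : IsUnit (u r)
  surj : ∀ y, ∃ k : ℕ, ∃ x, u r ^ k • y = l x
  exists_of_eq_zero : ∀ x, l x = 0 → ∃ k : ℕ, r ^ k • x = 0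

theorem exists_forall_of_monotone {ι : Type*} [Finite ι] {P : ι → ℕ → Prop}
    (hP : ∀ i k l, k ≤ l → P i k → P i l) (h : ∀ i, ∃ k, P i k) : ∃ k, ∀ i, P i k := by
  choose k hk using h
  cases nonempty_fintype ι
  exact ⟨∑ i, k i, fun i => hP i _ _ (Finset.single_le_sum (fun _ _ => Nat.zero_le _)
    (Finset.mem_univ i)) (hk i)⟩

namespace IsLocMap

variable {R : Type*} [CommRing R] {N M : Type*} [AddCommGroup N] [Module R N] [AddCommGroup M]
  [Module R M] {ι : Type*} [Fintype ι] {Rᵢ Nᵢ Mᵢ : ι → Type*} [∀ i, CommRing (Rᵢ i)]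
  [∀ i, AddCommGroup (Nᵢ i)] [∀ i, Module (Rᵢ i) (Nᵢ i)]
  [∀ i, AddCommGroup (Mᵢ i)] [∀ i, Module (Rᵢ i) (Mᵢ i)]
  {u : ∀ i, R →+* Rᵢ i} {r : ι → R} {lN : ∀ i, N →+ Nᵢ i} {lM : ∀ i, M →+ Mᵢ i}

theorem exists_partition (hr : Ideal.span (Set.range r) = ⊤) (k : ℕ) :
    ∃ a : ι → R, ∑ i, a i * r i ^ k = 1 := by
  have h := Ideal.span_pow_eq_top (Set.range r) hr k
  rw [← Set.range_comp, Ideal.eq_top_iff_one, Ideal.mem_span_range_iff_exists_fun] at h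
  exact h

theorem eq_zero (hr : Ideal.span (Set.range r) = ⊤) (h : ∀ i, IsLocMap (u i) (r i) (lM i))
    (x : M) (hx : ∀ i, lM i x = 0) : x = 0 := by
  obtain ⟨k, hk⟩ := exists_forall_of_monotone (P := fun i k => r i ^ k • x = 0)
    (fun i k l hkl hk => by
      rw [← Nat.sub_add_cancel hkl, pow_add, mul_smul, hk, smul_zero])
    (fun i => (h i).exists_of_eq_zero x (hx i))
  obtain ⟨a, ha⟩ := exists_partition hr k
  rw [← one_smul R x, ← ha, Finset.sum_smul]
  exact Finset.sum_eq_zero fun i _ => by rw [mul_smul, hk, smul_zero]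

theorem mem_of_forall (hr : Ideal.span (Set.range r) = ⊤) (S : Submodule R M) (x : M)
    (hx : ∀ i, ∃ k : ℕ, r i ^ k • x ∈ S) : x ∈ S := by
  obtain ⟨k, hk⟩ := exists_forall_of_monotone (P := fun i k => r i ^ k • x ∈ S)
    (fun i k l hkl hk => by
      rw [← Nat.sub_add_cancel hkl, pow_add, mul_smul]
      exact S.smul_mem _ hk) hx
  obtain ⟨a, ha⟩ := exists_partition hr k
  rw [← one_smul R x, ← ha, Finset.sum_smul]
  exact Submodule.sum_mem _ fun i _ => by rw [mul_smul]; exact S.smul_mem _ (hk i)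

/-- Gluing of elements of a module from localizations that cover. -/
theorem exists_glue (hr : Ideal.span (Set.range r) = ⊤) (h : ∀ i, IsLocMap (u i) (r i) (lM i))
    (y : ∀ i, Mᵢ i)
    (hy : ∀ i j (a b : M) (k : ℕ), u i (r i) ^ k • y i = lM i a → u j (r j) ^ k • y j = lM j b →
      ∃ K : ℕ, (r i * r j) ^ K • (r j ^ k • a - r i ^ k • b) = 0) :
    ∃ m : M, ∀ i, lM i m = y i := by
  obtain ⟨k, hk⟩ := exists_forall_of_monotone (P := fun i k => ∃ x, u i (r i) ^ k • y i = lM i x)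
    (fun i k l hkl ⟨x, hx⟩ => ⟨r i ^ (l - k) • x, by
      rw [(h i).map_smul, ← hx, smul_smul, map_pow, ← pow_add, Nat.sub_add_cancel hkl]⟩)
    (fun i => (h i).surj (y i))
  choose m hm using hk
  obtain ⟨K, hK⟩ := exists_forall_of_monotone (ι := ι × ι)
    (P := fun ij K => (r ij.1 * r ij.2) ^ K • (r ij.2 ^ k • m ij.1 - r ij.1 ^ k • m ij.2) = 0)
    (fun i k l hkl hk => by
      rw [← Nat.sub_add_cancel hkl, pow_add, mul_smul, hk, smul_zero])
    (fun ij => hy ij.1 ij.2 _ _ k (hm _) (hm _))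
  -- The exponent `k` clears the denominators of all `y i`, and a further `K` kills the
  -- discrepancies between the numerators on the overlaps.
  obtain ⟨a, ha⟩ := exists_partition hr (k + K)
  have key (i j) : r j ^ (k + K) • r i ^ K • m i = r i ^ (k + K) • r j ^ K • m j := by
    have := hK (i, j)
    rw [smul_sub, sub_eq_zero, smul_smul, smul_smul] at this
    rw [smul_smul, smul_smul]
    convert this using 2 <;> ring
  refine ⟨∑ i, a i • r i ^ K • m i, fun j => ?_⟩
  have h1 : r j ^ (k + K) • ∑ i, a i • r i ^ K • m i = r j ^ K • m j := by
    rw [Finset.smul_sum]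
    have : ∀ i, r j ^ (k + K) • a i • r i ^ K • m i = (a i * r i ^ (k + K)) • r j ^ K • m j := by
      intro i
      rw [smul_comm, key, mul_smul]
    simp_rw [this]
    rw [← Finset.sum_smul, ha, one_smul]
  have h2 : u j (r j) ^ (k + K) • lM j (∑ i, a i • r i ^ K • m i) = u j (r j) ^ (k + K) • y j := by
    rw [← map_pow, ← (h j).map_smul, h1, (h j).map_smul, ← hm j, smul_smul, map_pow, ← pow_add,
      add_comm, map_pow]
  exact (((h j).isUnit.pow (k + K)).smul_left_cancel).1 h2

/-- Gluing of isomorphisms of modules. -/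
theorem exists_glue_equiv (hr : Ideal.span (Set.range r) = ⊤)
    (hN : ∀ i, IsLocMap (u i) (r i) (lN i)) (hM : ∀ i, IsLocMap (u i) (r i) (lM i))
    (φ : ∀ i, Nᵢ i ≃ₗ[Rᵢ i] Mᵢ i)
    {Rᵢⱼ Mᵢⱼ : ι → ι → Type*} [∀ i j, CommRing (Rᵢⱼ i j)] [∀ i j, AddCommGroup (Mᵢⱼ i j)]
    [∀ i j, Module (Rᵢⱼ i j) (Mᵢⱼ i j)] (v : ∀ i j, Rᵢ i →+* Rᵢⱼ i j)
    (s' : ∀ i j, Mᵢ i →+ Mᵢⱼ i j) (t' : ∀ i j, Mᵢ j →+ Mᵢⱼ i j)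
    (hs : ∀ i j a y, s' i j (a • y) = v i j a • s' i j y)
    (hs' : ∀ i j y, s' i j y = 0 → ∃ k : ℕ, u i (r j) ^ k • y = 0)
    (ht : ∀ i j (a : R) y, t' i j (u j a • y) = v i j (u i a) • t' i j y)
    (hst : ∀ i j x, s' i j (lM i x) = t' i j (lM j x))
    (hφ : ∀ i j n, s' i j (φ i (lN i n)) = t' i j (φ j (lN j n))) :
    ∃ ψ : N ≃ₗ[R] M, ∀ i n, lM i (ψ n) = φ i (lN i n) := by
  have hex (n : N) : ∃ m : M, ∀ i, lM i m = φ i (lN i n) := by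
    refine exists_glue hr hM _ fun i j a b k ha hb => ?_
    -- On the overlap both numerators represent the same section. The kernel of `s' i j` is torsion
    -- for `r j`, which gives `K`; returning from the `i`-th localization to `M` costs a power `L`
    -- of `r i`.
    have h0 : s' i j (lM i (r j ^ k • a - r i ^ k • b)) = 0 := by
      rw [map_sub, map_sub, sub_eq_zero, (hM i).map_smul, ← ha, hst, (hM j).map_smul, ← hb,
        hs, ht, ← map_pow, ← map_pow, ht, hs, hφ]
      rw [smul_comm]
    obtain ⟨K, hK⟩ := hs' i j _ h0
    rw [← map_pow, ← (hM i).map_smul] at hK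
    obtain ⟨L, hL⟩ := (hM i).exists_of_eq_zero _ hK
    refine ⟨K + L, ?_⟩
    have : (r i * r j) ^ (K + L) = (r i ^ K * r j ^ L) * (r i ^ L * r j ^ K) := by ring
    rw [this, mul_smul, mul_smul (r i ^ L), hL, smul_zero]
  have huniq {x y : M} (hxy : ∀ i, lM i x = lM i y) : x = y :=
    sub_eq_zero.1 <| eq_zero hr hM _ fun i => by rw [map_sub, hxy, sub_self]
  choose ψ hψ using hex
  let ψ₀ : N →ₗ[R] M :=
    { toFun := ψ
      map_add' := fun x y => huniq fun i => by simp only [map_add, hψ]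
      map_smul' := fun a x => huniq fun i => by
        simp only [(hM i).map_smul, hψ, (hN i).map_smul, _root_.map_smul, RingHom.id_apply] }
  have hinj : Function.Injective ψ₀ := by
    rw [injective_iff_map_eq_zero]
    intro n hn
    refine eq_zero hr hN _ fun i => (φ i).map_eq_zero_iff.1 ?_
    rw [← hψ]
    exact (congrArg (lM i) hn).trans (map_zero _)
  have hsurj : Function.Surjective ψ₀ := by
    intro m
    refine mem_of_forall hr (LinearMap.range ψ₀) m fun i => ?_
    obtain ⟨k, n, hn⟩ := (hN i).surj ((φ i).symm (lM i m))
    have : lM i (ψ n - r i ^ k • m) = 0 := by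
      rw [map_sub, hψ, ← hn, _root_.map_smul, LinearEquiv.apply_symm_apply, (hM i).map_smul, map_pow,
        sub_self]
    obtain ⟨K, hK⟩ := (hM i).exists_of_eq_zero _ this
    refine ⟨K + k, r i ^ K • n, ?_⟩
    rw [smul_sub, sub_eq_zero] at hK
    rw [_root_.map_smul, pow_add, mul_smul]
    exact hK
  exact ⟨LinearEquiv.ofBijective ψ₀ ⟨hinj, hsurj⟩, fun i n => hψ n i⟩

end IsLocMap

end Gluing

/-! ### Extending alternating maps to a localization. -/

section ExteriorLocalization

variable {R R' : Type*} [CommRing R] [CommRing R'] [Algebra R R']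
  {M M' N : Type*} [AddCommGroup M] [Module R M] [AddCommGroup M'] [Module R M']
  [Module R' M'] [IsScalarTower R R' M'] (l : M →ₗ[R] M')
  [AddCommMonoid N] [Module R N] [Module R' N] [IsScalarTower R R' N]
  {d : ℕ}

/-- Multiplying the `i`-th arguments by some `t i ∈ S` makes them equal, and the product of the `t
i` acts invertibly on `N`. -/
theorem map_localization_eq (S : Submonoid R) [IsLocalization S R']
    [IsLocalizedModule S l] (α : M [⋀^Fin d]→ₗ[R] N) (x x' : Fin d → M)
    (h : ∀ i, l (x i) = l (x' i)) : α x = α x' := by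
  choose t ht using fun i => (IsLocalizedModule.eq_iff_exists S l).1 (h i)
  have h1 := α.toMultilinearMap.map_smul_univ (fun i => (t i : R)) x
  have h2 := α.toMultilinearMap.map_smul_univ (fun i => (t i : R)) x'
  have h3 : (fun i => (t i : R) • x i) = fun i => (t i : R) • x' i := funext ht
  rw [h3, h2] at h1
  have hu : IsUnit (algebraMap R R' (∏ i, (t i : R))) := by
    simpa using IsLocalization.map_units R' (∏ i, t i)
  have h4 : (∏ i, (t i : R)) • α x' = (∏ i, (t i : R)) • α x := h1
  rw [← algebraMap_smul R' _ (α x), ← algebraMap_smul R' _ (α x')] at h4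
  exact (hu.smul_left_cancel.1 h4).symm

theorem map_localization_smul (S : Submonoid R) [IsLocalization S R']
    [IsLocalizedModule S l] (α : M [⋀^Fin d]→ₗ[R] N) (y : Fin d → M') (x x' : Fin d → M)
    (s s' : Fin d → R) (h : ∀ i, s i • y i = l (x i)) (h' : ∀ i, s' i • y i = l (x' i)) :
    (∏ i, s' i) • α x = (∏ i, s i) • α x' := by
  rw [← AlternatingMap.coe_multilinearMap, ← MultilinearMap.map_smul_univ,
    ← MultilinearMap.map_smul_univ]
  refine map_localization_eq (R' := R') l S α _ _ fun i => ?_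
  rw [map_smul, map_smul, ← h, ← h', smul_comm]

/-- The extension of an alternating map with values in an `S⁻¹R`-module to the localization. -/
theorem exists_alternating_extension (S : Submonoid R) [IsLocalization S R']
    [IsLocalizedModule S l] (α : M [⋀^Fin d]→ₗ[R] N) :
    ∃ β : M' [⋀^Fin d]→ₗ[R'] N, ∀ x : Fin d → M, β (fun i => l (x i)) = α x := by
  have hsurj (y : M') : ∃ (s : S) (x : M), (s : R) • y = l x := by
    obtain ⟨⟨x, s⟩, h⟩ := IsLocalizedModule.surj S l y
    exact ⟨s, x, h⟩
  choose s x hx using hsurj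
  have hu (t : Fin d → S) : IsUnit (algebraMap R R' (∏ i, (t i : R))) := by
    simpa using IsLocalization.map_units R' (∏ i, t i)
  let F (y : Fin d → M') : N := (↑(hu fun i => s (y i)).unit⁻¹ : R') • α fun i => x (y i)
  have hF (y : Fin d → M') (t : Fin d → S) (z : Fin d → M) (h : ∀ i, (t i : R) • y i = l (z i)) :
      (∏ i, (t i : R)) • F y = α z := by
    have h1 := map_localization_smul (R' := R') l S α y _ z (fun i => (s (y i) : R))
      (fun i => (t i : R)) (fun i => hx (y i)) h
    refine (hu fun i => s (y i)).smul_left_cancel.1 ?_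
    rw [smul_comm, algebraMap_smul, algebraMap_smul, ← h1]
    congr 1
    rw [← algebraMap_smul R']
    exact smul_inv_smul (hu fun i => s (y i)).unit _
  -- The value of `F` may be computed from any choice of denominators and numerators. Each axiom
  -- below then amounts to exhibiting suitable ones.
  have hF' (y : Fin d → M') (t : Fin d → S) (z : Fin d → M) (n : N)
      (h : ∀ i, (t i : R) • y i = l (z i)) (h' : (∏ i, (t i : R)) • n = α z) : F y = n := by
    have := (hF y t z h).trans h'.symm
    rw [← algebraMap_smul R', ← algebraMap_smul R' _ n] at this
    exact (hu t).smul_left_cancel.1 this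
  clear_value F
  refine ⟨{ toFun := F, map_update_add' := ?_, map_update_smul' := ?_,
            map_eq_zero_of_eq' := ?_ }, ?_⟩
  · intro inst y i a b
    obtain rfl : inst = instDecidableEqFin d := Subsingleton.elim _ _
    refine hF' _ (Function.update (fun j => s (y j)) i (s a * s b))
      (Function.update (fun j => x (y j)) i ((s b : R) • x a + (s a : R) • x b)) _ ?_ ?_
    · intro j
      by_cases hj : j = i
      · subst hj
        simp only [Function.update_self, map_add, map_smul, ← hx, Submonoid.coe_mul, smul_add,
          smul_smul]
        rw [mul_comm]
      · simp only [Function.update_of_ne hj, hx]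
    · rw [smul_add, α.map_update_add, α.map_update_smul, α.map_update_smul]
      have hprod (t : S) : ∏ j, ((Function.update (fun j => s (y j)) i t j : S) : R) =
          t * ∏ j ∈ Finset.univ \ {i}, (s (y j) : R) := by
        have : (fun j => ((Function.update (fun j => s (y j)) i t j : S) : R)) =
            Function.update (fun j => (s (y j) : R)) i t := by
          ext j
          by_cases hj : j = i
          · subst hj; simp
          · simp [hj]
        rw [this, Finset.prod_update_of_mem (Finset.mem_univ i)]
      have h1 (c : M') := hF (Function.update y i c) (Function.update (fun j => s (y j)) i (s c))
        (Function.update (fun j => x (y j)) i (x c)) (by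
          intro j
          by_cases hj : j = i
          · subst hj; simp [hx]
          · simp only [Function.update_of_ne hj, hx])
      rw [← h1 a, ← h1 b, hprod, hprod, hprod, smul_smul, smul_smul, Submonoid.coe_mul]
      congr 2 <;> ring
  · intro inst y i c a
    obtain rfl : inst = instDecidableEqFin d := Subsingleton.elim _ _
    obtain ⟨c, t, rfl⟩ := IsLocalization.exists_mk'_eq S c
    refine hF' _ (Function.update (fun j => s (y j)) i (s a * t))
      (Function.update (fun j => x (y j)) i (c • x a)) _ ?_ ?_
    · intro j
      by_cases hj : j = i
      · subst hj
        simp only [Function.update_self, map_smul, ← hx, Submonoid.coe_mul]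
        rw [← algebraMap_smul R', ← algebraMap_smul R' c, ← algebraMap_smul R' (s a : R), smul_smul,
          smul_smul]
        congr 1
        rw [map_mul, mul_assoc, mul_comm (algebraMap R R' t), IsLocalization.mk'_spec, mul_comm]
      · simp only [Function.update_of_ne hj, hx]
    · rw [α.map_update_smul]
      have hprod (t : S) : ∏ j, ((Function.update (fun j => s (y j)) i t j : S) : R) =
          t * ∏ j ∈ Finset.univ \ {i}, (s (y j) : R) := by
        have : (fun j => ((Function.update (fun j => s (y j)) i t j : S) : R)) =
            Function.update (fun j => (s (y j) : R)) i t := by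
          ext j
          by_cases hj : j = i
          · subst hj; simp
          · simp [hj]
        rw [this, Finset.prod_update_of_mem (Finset.mem_univ i)]
      have h1 (c : M') := hF (Function.update y i c) (Function.update (fun j => s (y j)) i (s c))
        (Function.update (fun j => x (y j)) i (x c)) (by
          intro j
          by_cases hj : j = i
          · subst hj; simp [hx]
          · simp only [Function.update_of_ne hj, hx])
      rw [← h1 a, hprod, hprod, smul_smul, Submonoid.coe_mul, ← algebraMap_smul R',
        ← algebraMap_smul R' (c * (_ * _)), smul_smul]
      congr 1
      simp only [map_mul]
      rw [← IsLocalization.mk'_spec R' c t]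
      ring
  · intro y i j hij hne
    refine hF' _ (fun i => s (y i)) (fun i => x (y i)) _ (fun i => hx _) ?_
    rw [smul_zero, α.map_eq_zero_of_eq _ (congrArg x hij) hne]
  · intro z
    exact hF' _ (fun _ => 1) z _ (fun i => by simp) (by simp)

end ExteriorLocalization

/-! ### Differential forms commute with localization. -/

section FormsLocalization

variable {R S : Type} [CommRing R] [CommRing S] [Algebra ℂ R] [Algebra ℂ S]

theorem formsMap_ιMulti_map (u : R →ₐ[ℂ] S) (d : ℕ) (x : Fin d → Ω[R⁄ℂ]) :
    letI : Algebra R S := u.toRingHom.toAlgebra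
    haveI : IsScalarTower ℂ R S := IsScalarTower.of_algebraMap_eq fun r => (u.commutes r).symm
    formsMap u d (exteriorPower.ιMulti R d x) =
      exteriorPower.ιMulti S d fun i => KaehlerDifferential.map ℂ ℂ R S (x i) := by
  let : Algebra R S := u.toRingHom.toAlgebra
  have : IsScalarTower ℂ R S := IsScalarTower.of_algebraMap_eq fun r => (u.commutes r).symm
  unfold formsMap
  simp only [LinearMap.toAddMonoidHom_coe]
  rw [exteriorPower.alternatingMapLinearEquiv_apply_ιMulti]
  rfl

theorem formsMap_smul (u : R →ₐ[ℂ] S) (d : ℕ) (a : R) (x : ⋀[R]^d (Ω[R⁄ℂ])) :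
    formsMap u d (a • x) = u a • formsMap u d x := by
  let : Algebra R S := u.toRingHom.toAlgebra
  have : IsScalarTower ℂ R S := IsScalarTower.of_algebraMap_eq fun r => (u.commutes r).symm
  unfold formsMap
  simp only [LinearMap.toAddMonoidHom_coe, map_smul]
  exact (algebraMap_smul S a _).symm

theorem forms_induction (d : ℕ) {P : ⋀[R]^d (Ω[R⁄ℂ]) → Prop} (x : ⋀[R]^d (Ω[R⁄ℂ]))
    (h0 : P 0) (hadd : ∀ x y, P x → P y → P (x + y)) (hsmul : ∀ (a : R) x, P x → P (a • x))
    (hι : ∀ x, P (exteriorPower.ιMulti R d x)) : P x := by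
  have hx : x ∈ Submodule.span R (Set.range (exteriorPower.ιMulti R d (M := Ω[R⁄ℂ]))) := by
    rw [exteriorPower.ιMulti_span]; trivial
  induction hx using Submodule.span_induction with
  | mem x hx => obtain ⟨y, rfl⟩ := hx; exact hι y
  | zero => exact h0
  | add x y _ _ h1 h2 => exact hadd _ _ h1 h2
  | smul a x _ h => exact hsmul _ _ h

/-- For the surjectivity clause, denominators are cleared in each factor of a wedge product. For the
kernel, the universal form with values in `S ⊗ ⋀ᵈ Ω_R` extends to `⋀ᵈ Ω_S`, so that anything killed
by `formsMap` dies in the localization of `⋀ᵈ Ω_R`. -/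
theorem formsMap_isLocMap (u : R →ₐ[ℂ] S) (r : R)
    (h : letI : Algebra R S := u.toRingHom.toAlgebra; IsLocalization.Away r S) (d : ℕ) :
    IsLocMap u.toRingHom r (formsMap u d) := by
  let : Algebra R S := u.toRingHom.toAlgebra
  have : IsScalarTower ℂ R S := IsScalarTower.of_algebraMap_eq fun r => (u.commutes r).symm
  have hloc : IsLocalization (Submonoid.powers r) S := h
  have hur : IsUnit (u r) := IsLocalization.Away.algebraMap_isUnit (S := S) r
  let l : Ω[R⁄ℂ] →ₗ[R] Ω[S⁄ℂ] := KaehlerDifferential.map ℂ ℂ R S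
  have hl : IsLocalizedModule (Submonoid.powers r) l := inferInstance
  refine ⟨formsMap_smul u d, hur, fun y => ?_, fun x hx => ?_⟩
  · change ∃ k : ℕ, ∃ x, u r ^ k • y = formsMap u d x
    induction y using forms_induction with
    | h0 => exact ⟨0, 0, by simp⟩
    | hadd x y hx hy =>
      obtain ⟨k, x', hx⟩ := hx
      obtain ⟨l, y', hy⟩ := hy
      refine ⟨k + l, r ^ l • x' + r ^ k • y', ?_⟩
      rw [map_add, formsMap_smul, formsMap_smul, ← hx, ← hy, smul_add, smul_smul, smul_smul,
        map_pow, map_pow]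
      congr 2 <;> ring
    | hsmul a x hx =>
      obtain ⟨k, x', hx⟩ := hx
      obtain ⟨n, b, hb⟩ := IsLocalization.Away.surj r a
      refine ⟨k + n, b • x', ?_⟩
      rw [formsMap_smul, ← hx, smul_smul, smul_smul]
      congr 1
      change _ = algebraMap R S b * _
      rw [← hb]
      change _ = a * u r ^ n * _
      ring
    | hι y =>
      have h1 (i) : ∃ k : ℕ, ∃ x, r ^ k • y i = l x := by
        obtain ⟨⟨x, ⟨_, k, rfl⟩⟩, h⟩ := IsLocalizedModule.surj (Submonoid.powers r) l (y i)
        exact ⟨k, x, h⟩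
      choose k x hx using h1
      refine ⟨∑ i, k i, exteriorPower.ιMulti R d x, ?_⟩
      rw [formsMap_ιMulti_map]
      have h2 (i) : KaehlerDifferential.map ℂ ℂ R S (x i) = (u r ^ k i) • y i := by
        refine (hx i).symm.trans ?_
        rw [← algebraMap_smul S, map_pow]
        rfl
      simp_rw [h2]
      rw [← AlternatingMap.coe_multilinearMap, MultilinearMap.map_smul_univ, Finset.prod_pow_eq_pow_sum]
  · let m : ⋀[R]^d (Ω[R⁄ℂ]) →ₗ[R] TensorProduct R S (⋀[R]^d (Ω[R⁄ℂ])) := TensorProduct.mk R S _ 1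
    have hm : IsLocalizedModule (Submonoid.powers r) m :=
      (isLocalizedModule_iff_isBaseChange _ S _).2 (TensorProduct.isBaseChange R _ S)
    obtain ⟨β, hβ⟩ := exists_alternating_extension (R' := S) l (Submonoid.powers r)
      (m.compAlternatingMap (exteriorPower.ιMulti R d))
    let β' := exteriorPower.alternatingMapLinearEquiv β
    have key (x) : β' (formsMap u d x) = m x := by
      induction x using forms_induction with
      | h0 => simp
      | hadd x y hx hy => rw [map_add, map_add, map_add, hx, hy]
      | hsmul a x hx =>
        rw [formsMap_smul, map_smul, map_smul, hx]
        exact algebraMap_smul S a (m x)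
      | hι x =>
        rw [formsMap_ιMulti_map, exteriorPower.alternatingMapLinearEquiv_apply_ιMulti]
        exact hβ x
    have h0 : m x = 0 := by rw [← key, hx, map_zero]
    obtain ⟨⟨_, k, rfl⟩, hk⟩ := (IsLocalizedModule.eq_zero_iff (Submonoid.powers r) m).1 h0
    exact ⟨k, hk⟩

end FormsLocalization

/-! ### Sections of `𝒪(m)` on standard opens of `Proj`, their restrictions and trivializations. -/

section Twist

variable {A : Type} [CommRing A] [Algebra ℂ A] (𝒜 : ℕ → Submodule ℂ A) [GradedAlgebra 𝒜]

/-- The restriction `A_x → A_y` for `x ∣ y`. -/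
def resLoc {x y : A} (h : x ∣ y) : Localization.Away x →+* Localization.Away y :=
  Localization.awayLift (algebraMap A _) x
    (isUnit_of_dvd_unit (map_dvd _ h) (IsLocalization.Away.algebraMap_isUnit y))

@[simp]
theorem resLoc_algebraMap {x y : A} (h : x ∣ y) (a : A) :
    resLoc h (algebraMap A _ a) = algebraMap A _ a :=
  IsLocalization.Away.lift_eq x (isUnit_of_dvd_unit (map_dvd _ h)
    (IsLocalization.Away.algebraMap_isUnit y)) a

theorem resLoc_resLoc {x y z : A} (h : x ∣ y) (h' : y ∣ z) (a : Localization.Away x) :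
    resLoc h' (resLoc h a) = resLoc (h.trans h') a := by
  have : (resLoc h').comp (resLoc h) = resLoc (h.trans h') := by
    refine IsLocalization.ringHom_ext (Submonoid.powers x) (RingHom.ext fun a => ?_)
    simp
  exact RingHom.congr_fun this a

theorem resLoc_eq_zero {x y : A} (h : x ∣ y) (a : A) (N : ℕ) (z : Localization.Away x)
    (hz : z * algebraMap A _ x ^ N = algebraMap A _ a) (h0 : resLoc h z = 0) :
    ∃ k : ℕ, y ^ k * a = 0 := by
  have h1 := congrArg (resLoc h) hz
  rw [map_mul, h0, zero_mul, resLoc_algebraMap] at h1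
  obtain ⟨⟨_, k, rfl⟩, hk⟩ := (IsLocalization.map_eq_zero_iff (Submonoid.powers y) _ a).1 h1.symm
  exact ⟨k, hk⟩

/-- The restriction `A_(f) → A_(x)` for `x = f * g`. -/
def awayResEq {f g x : A} {e' : ℕ} (hg : g ∈ 𝒜 e') (hx : x = f * g) : Away 𝒜 f →ₐ[ℂ] Away 𝒜 x where
  __ := awayMap 𝒜 hg hx
  commutes' c := awayMap_fromZeroRingHom 𝒜 hg hx (algebraMap ℂ (𝒜 0) c)

theorem val_awayResEq {f g x : A} {e' : ℕ} (hg : g ∈ 𝒜 e') (hx : x = f * g) (a : Away 𝒜 f) :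
    (awayResEq 𝒜 hg hx a).val = resLoc ⟨g, hx⟩ a.val :=
  val_awayMap 𝒜 hg hx a

theorem awayResEq_comp {f g h x y : A} {i j l : ℕ} (hg : g ∈ 𝒜 i) (hh : h ∈ 𝒜 j) {k : A}
    (hk : k ∈ 𝒜 l) (hx : x = f * g) (hy : y = x * h) (hy' : y = f * k) :
    (awayResEq 𝒜 hh hy).comp (awayResEq 𝒜 hg hx) = awayResEq 𝒜 hk hy' := by
  refine AlgHom.ext fun a => val_injective _ ?_
  rw [AlgHom.comp_apply, val_awayResEq, val_awayResEq, val_awayResEq, resLoc_resLoc]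

theorem val_mk_mul_pow {f : A} {e : ℕ} (hf : f ∈ 𝒜 e) (n : ℕ) (b : A) (hb : b ∈ 𝒜 (n • e)) :
    (Away.mk 𝒜 hf n b hb).val * algebraMap A (Localization.Away f) f ^ n =
      algebraMap A _ b := by
  rw [Away.val_mk, ← map_pow, Localization.mk_eq_mk']
  exact IsLocalization.mk'_spec _ b ⟨f ^ n, _⟩

theorem val_smul_loc {f : A} (a : Away 𝒜 f) (z : Localization.Away f) : a • z = a.val * z := rfl

theorem mem_twist_iff {f : A} {e : ℕ} (he : 0 < e) (hf : f ∈ 𝒜 e) (m : ℤ)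
    (z : Localization.Away f) :
    z ∈ twist 𝒜 f e m ↔ ∃ (N j : ℕ), ∃ a ∈ 𝒜 j, (j : ℤ) = N * e + m ∧
      z * algebraMap A (Localization.Away f) f ^ N = algebraMap A (Localization.Away f) a := by
  refine ⟨fun h => ?_, fun h => Submodule.subset_span h⟩
  induction h using Submodule.span_induction with
  | mem x hx => exact hx
  | zero =>
    -- Zero needs an exponent `N` with `N * e + m ≥ 0`; since `e > 0`, `N = |m|` suffices.
    refine ⟨m.natAbs, (m.natAbs * e + m : ℤ).toNat, 0, zero_mem _, Int.toNat_of_nonneg ?_, by simp⟩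
    have h1 : (m.natAbs : ℤ) ≤ m.natAbs * e := by
      exact_mod_cast Nat.le_mul_of_pos_right _ he
    omega
  | add x y _ _ hx hy =>
    obtain ⟨N, j, a, ha, hj, hxa⟩ := hx
    obtain ⟨N', j', a', ha', hj', hxa'⟩ := hy
    refine ⟨N + N', j + N' * e, a * f ^ N' + a' * f ^ N, ?_, ?_, ?_⟩
    · refine add_mem (SetLike.mul_mem_graded ha (SetLike.pow_mem_graded N' hf)) ?_
      have : j + N' * e = j' + N * e := by
        zify; rw [hj, hj']; ring
      rw [this]
      exact SetLike.mul_mem_graded ha' (SetLike.pow_mem_graded N hf)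
    · push_cast; rw [hj]; ring
    · rw [map_add, map_mul, map_mul, ← hxa, ← hxa', map_pow, map_pow]; ring
  | smul c x _ hx =>
    obtain ⟨N, j, a, ha, hj, hxa⟩ := hx
    obtain ⟨n, b, hb, rfl⟩ := Away.mk_surjective 𝒜 hf c
    refine ⟨n + N, n • e + j, b * a, SetLike.mul_mem_graded hb ha, ?_, ?_⟩
    · push_cast; rw [hj, nsmul_eq_mul]; push_cast; ring
    · rw [map_mul, ← hxa, ← val_mk_mul_pow 𝒜 hf n b hb, val_smul_loc]
      ring

theorem mul_mem_twist {f : A} {e : ℕ} (he : 0 < e) (hf : f ∈ 𝒜 e) {m m' : ℤ}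
    {z z' : Localization.Away f} (hz : z ∈ twist 𝒜 f e m) (hz' : z' ∈ twist 𝒜 f e m') :
    z * z' ∈ twist 𝒜 f e (m + m') := by
  rw [mem_twist_iff 𝒜 he hf] at hz hz' ⊢
  obtain ⟨N, j, a, ha, hj, hxa⟩ := hz
  obtain ⟨N', j', a', ha', hj', hxa'⟩ := hz'
  refine ⟨N + N', j + j', a * a', SetLike.mul_mem_graded ha ha', ?_, ?_⟩
  · push_cast; rw [hj, hj']; ring
  · rw [map_mul, ← hxa, ← hxa']; ring

theorem exists_val_eq_of_mem_twist_zero {f : A} {e : ℕ} (he : 0 < e) (hf : f ∈ 𝒜 e)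
    {z : Localization.Away f} (hz : z ∈ twist 𝒜 f e 0) : ∃ a : Away 𝒜 f, a.val = z := by
  rw [mem_twist_iff 𝒜 he hf] at hz
  obtain ⟨N, j, a, ha, hj, hxa⟩ := hz
  have hj' : j = N • e := by zify; rw [hj]; simp
  subst hj'
  refine ⟨Away.mk 𝒜 hf N a ha, ?_⟩
  refine ((IsLocalization.Away.algebraMap_isUnit f).pow N).mul_left_injective ?_
  change _ * algebraMap A (Localization.Away f) f ^ N = z * algebraMap A (Localization.Away f) f ^ N
  rw [val_mk_mul_pow, hxa]

/-- A divisor of `x` as a unit of `A_x`. -/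
def unitOfDvd {p x : A} (h : p ∣ x) : (Localization.Away x)ˣ :=
  (isUnit_of_dvd_unit (map_dvd (algebraMap A (Localization.Away x)) h)
    (IsLocalization.Away.algebraMap_isUnit x)).unit

@[simp]
theorem val_unitOfDvd {p x : A} (h : p ∣ x) :
    (unitOfDvd h : Localization.Away x) = algebraMap A _ p := rfl

theorem resLoc_zpow_unitOfDvd {p x y : A} (h : p ∣ x) (h' : x ∣ y) (m : ℤ) :
    resLoc h' ((unitOfDvd h ^ m : (Localization.Away x)ˣ) : Localization.Away x) =
      ((unitOfDvd (h.trans h') ^ m : (Localization.Away y)ˣ) : Localization.Away y) := by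
  have h1 : Units.map (resLoc h' : _ →* _) (unitOfDvd h) = unitOfDvd (h.trans h') :=
    Units.ext (resLoc_algebraMap h' p)
  rw [← h1, ← map_zpow]
  rfl

theorem zpow_unitOfDvd_mem_twist {f p x : A} {e : ℕ} (hf : f ∈ 𝒜 e) (hp : p ∈ 𝒜 1)
    (hx : x = f * p) (m : ℤ) :
    ((unitOfDvd (Dvd.intro_left f hx.symm) ^ m : (Localization.Away x)ˣ) : Localization.Away x) ∈
      twist 𝒜 x (e + 1) m := by
  refine Submodule.subset_span ?_
  obtain ⟨k, rfl | rfl⟩ := m.eq_nat_or_neg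
  · refine ⟨0, k, p ^ k, by simpa using SetLike.pow_mem_graded k hp, by simp, by simp⟩
  -- For negative exponents, `p ^ (-k) = f ^ k / x ^ k` because `x = f * p`.
  · refine ⟨k, k * e, f ^ k, SetLike.pow_mem_graded k hf, by push_cast; ring, ?_⟩
    have h1 : algebraMap A (Localization.Away x) x = algebraMap A _ f * algebraMap A _ p := by
      rw [← map_mul, ← hx]
    rw [zpow_neg, zpow_natCast, Units.inv_mul_eq_iff_eq_mul, h1]
    simp [mul_pow, mul_comm]

/-- The trivialization of `𝒪(m)` on `D₊(x)`, `x = f p`, by the `m`-th power of `p`. -/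
def trivTwist {f p x : A} {e : ℕ} (hf : f ∈ 𝒜 e) (hp : p ∈ 𝒜 1) (hx : x = f * p) (m : ℤ) :
    Away 𝒜 x ≃ₗ[Away 𝒜 x] twist 𝒜 x (e + 1) m :=
  LinearEquiv.ofBijective
    (LinearMap.toSpanSingleton (Away 𝒜 x) (twist 𝒜 x (e + 1) m)
      ⟨_, zpow_unitOfDvd_mem_twist 𝒜 hf hp hx m⟩) (by
    constructor
    · rw [← LinearMap.ker_eq_bot, LinearMap.ker_eq_bot']
      intro a ha
      have h1 := congrArg Subtype.val ha
      rw [LinearMap.toSpanSingleton_apply, Submodule.coe_smul, val_smul_loc] at h1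
      refine val_injective _ (((Units.isUnit _).mul_left_eq_zero.1 h1).trans ?_)
      exact val_zero.symm
    · rintro ⟨z, hz⟩
      have hx' : x ∈ 𝒜 (e + 1) := hx ▸ SetLike.mul_mem_graded hf hp
      have h1 := mul_mem_twist 𝒜 e.succ_pos hx' hz (zpow_unitOfDvd_mem_twist 𝒜 hf hp hx (-m))
      rw [add_neg_cancel] at h1
      obtain ⟨a, ha⟩ := exists_val_eq_of_mem_twist_zero 𝒜 e.succ_pos hx' h1
      refine ⟨a, Subtype.ext ?_⟩
      rw [LinearMap.toSpanSingleton_apply, Submodule.coe_smul, val_smul_loc, ha, mul_assoc,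
        ← Units.val_mul, ← zpow_add]
      simp)

theorem resLoc_mem_twist {f g x : A} {e e' e'' : ℕ} (he : 0 < e) (hf : f ∈ 𝒜 e) (hg : g ∈ 𝒜 e')
    (hx : x = f * g) (he'' : e'' = e + e') (m : ℤ) {z : Localization.Away f}
    (hz : z ∈ twist 𝒜 f e m) : resLoc ⟨g, hx⟩ z ∈ twist 𝒜 x e'' m := by
  obtain ⟨N, j, a, ha, hj, hxa⟩ := (mem_twist_iff 𝒜 he hf m z).1 hz
  refine Submodule.subset_span ⟨N, j + N * e', a * g ^ N,
    SetLike.mul_mem_graded ha (SetLike.pow_mem_graded N hg), ?_, ?_⟩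
  · rw [he'']; push_cast; rw [hj]; ring
  · rw [map_mul, ← resLoc_algebraMap ⟨g, hx⟩ a, ← hxa]
    have h1 : algebraMap A (Localization.Away x) x = algebraMap A _ f * algebraMap A _ g := by
      rw [← map_mul, ← hx]
    simp only [map_mul, map_pow, resLoc_algebraMap]
    rw [h1, mul_pow, mul_assoc]

/-- The restriction of sections of `𝒪(m)` from `D₊(f)` to `D₊(f g)`. -/
def twistRes {f g x : A} {e e' e'' : ℕ} (he : 0 < e) (hf : f ∈ 𝒜 e) (hg : g ∈ 𝒜 e')
    (hx : x = f * g) (he'' : e'' = e + e') (m : ℤ) : twist 𝒜 f e m →+ twist 𝒜 x e'' m where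
  toFun z := ⟨resLoc ⟨g, hx⟩ z, resLoc_mem_twist 𝒜 he hf hg hx he'' m z.2⟩
  map_zero' := Subtype.ext (map_zero _)
  map_add' _ _ := Subtype.ext (map_add _ _ _)

theorem coe_twistRes {f g x : A} {e e' e'' : ℕ} (he : 0 < e) (hf : f ∈ 𝒜 e) (hg : g ∈ 𝒜 e')
    (hx : x = f * g) (he'' : e'' = e + e') (m : ℤ) (z : twist 𝒜 f e m) :
    (twistRes 𝒜 he hf hg hx he'' m z : Localization.Away x) = resLoc ⟨g, hx⟩ z := rfl

theorem twistRes_smul {f g x : A} {e e' e'' : ℕ} (he : 0 < e) (hf : f ∈ 𝒜 e) (hg : g ∈ 𝒜 e')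
    (hx : x = f * g) (he'' : e'' = e + e') (m : ℤ) (a : Away 𝒜 f) (z : twist 𝒜 f e m) :
    twistRes 𝒜 he hf hg hx he'' m (a • z) =
      awayResEq 𝒜 hg hx a • twistRes 𝒜 he hf hg hx he'' m z := by
  refine Subtype.ext ?_
  rw [Submodule.coe_smul, coe_twistRes, coe_twistRes, val_smul_loc, val_awayResEq,
    Submodule.coe_smul, val_smul_loc, map_mul]

theorem awayResEq_isLocalization {f g x : A} {e e' : ℕ} (he : 0 < e) (hf : f ∈ 𝒜 e)
    (hg : g ∈ 𝒜 e') (hx : x = f * g) :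
    letI := (awayResEq 𝒜 hg hx).toRingHom.toAlgebra
    IsLocalization.Away (Away.isLocalizationElem hf hg) (Away 𝒜 x) :=
  Away.isLocalization_mul hf hg hx he.ne'

theorem val_isLocalizationElem_pow_mul {f g : A} {e e' : ℕ} (hf : f ∈ 𝒜 e) (hg : g ∈ 𝒜 e')
    (k : ℕ) :
    (Away.isLocalizationElem hf hg).val ^ k * algebraMap A (Localization.Away f) f ^ (e' * k) =
      algebraMap A _ g ^ (e * k) := by
  rw [pow_mul, pow_mul, ← mul_pow, val_mk_mul_pow, map_pow]

theorem twistRes_isLocMap {f g x : A} {e e' e'' : ℕ} (he : 0 < e) (hf : f ∈ 𝒜 e) (hg : g ∈ 𝒜 e')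
    (hx : x = f * g) (he'' : e'' = e + e') (m : ℤ) :
    IsLocMap (awayResEq 𝒜 hg hx).toRingHom (Away.isLocalizationElem hf hg)
      (twistRes 𝒜 he hf hg hx he'' m) where
  map_smul := twistRes_smul 𝒜 he hf hg hx he'' m
  isUnit := by
    let := (awayResEq 𝒜 hg hx).toRingHom.toAlgebra
    have := awayResEq_isLocalization 𝒜 he hf hg hx
    exact IsLocalization.Away.algebraMap_isUnit (S := Away 𝒜 x) (Away.isLocalizationElem hf hg)
  surj := by
    rintro ⟨y, hy⟩
    obtain ⟨N, j, a, ha, hj, hya⟩ := (mem_twist_iff 𝒜 (by omega)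
      (by rw [hx, he'']; exact SetLike.mul_mem_graded hf hg) m y).1 hy
    -- If `y = a / x ^ N`, then `(g ^ e / f ^ e') ^ N * y = g ^ ((e - 1) * N) * a / f ^ ((e' + 1) *
    -- N)`, which is defined on `D₊(f)`. Writing `e` as a successor avoids the subtraction.
    obtain ⟨e, rfl⟩ : ∃ c, e = c + 1 := ⟨e - 1, by omega⟩
    let fu := unitOfDvd (dvd_refl f)
    have hz : algebraMap A (Localization.Away f) (g ^ (e * N) * a) *
        (((fu ^ ((e' + 1) * N))⁻¹ : (Localization.Away f)ˣ) : Localization.Away f) ∈ twist 𝒜 f (e + 1) m := by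
      refine Submodule.subset_span ⟨(e' + 1) * N, e * N * e' + j, g ^ (e * N) * a,
        SetLike.mul_mem_graded (SetLike.pow_mem_graded _ hg) ha, ?_, ?_⟩
      · push_cast; rw [hj, he'']; push_cast; ring
      · have h2 : (fu ^ ((e' + 1) * N) : (Localization.Away f)ˣ) =
          algebraMap A (Localization.Away f) f ^ ((e' + 1) * N) := by simp [fu]
        rw [mul_assoc, ← h2, Units.inv_mul, mul_one]
    refine ⟨N, ⟨_, hz⟩, Subtype.ext ?_⟩
    have hfx : IsUnit (algebraMap A (Localization.Away x) f ^ ((e' + 1) * N)) :=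
      (unitOfDvd ⟨g, hx⟩ ^ ((e' + 1) * N)).isUnit
    refine hfx.mul_left_injective ?_
    change _ * _ = _ * _
    have h1 := congrArg (resLoc ⟨g, hx⟩) (val_isLocalizationElem_pow_mul 𝒜 hf hg N)
    have h2 : (fu ^ ((e' + 1) * N) : (Localization.Away f)ˣ) =
      algebraMap A (Localization.Away f) f ^ ((e' + 1) * N) := by simp [fu]
    have h5 : algebraMap A (Localization.Away x) x = algebraMap A _ f * algebraMap A _ g := by
      rw [← map_mul, ← hx]
    have h3 : resLoc ⟨g, hx⟩ ((fu ^ ((e' + 1) * N))⁻¹ : (Localization.Away f)ˣ) *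
        algebraMap A (Localization.Away x) f ^ ((e' + 1) * N) = 1 := by
      rw [← resLoc_algebraMap ⟨g, hx⟩, ← map_pow, ← h2, ← map_mul, Units.inv_mul, map_one]
    rw [coe_twistRes, map_mul, mul_assoc, h3, mul_one, resLoc_algebraMap, map_mul, ← hya, h5]
    simp only [map_mul, map_pow, resLoc_algebraMap] at h1 ⊢
    rw [Submodule.coe_smul, val_smul_loc, val_pow]
    change (awayResEq 𝒜 hg hx _).val ^ N * y * _ = _
    rw [val_awayResEq]
    linear_combination (exp := 1) y * algebraMap A (Localization.Away x) f ^ N * h1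
  exists_of_eq_zero := by
    rintro ⟨z, hz⟩ h0
    obtain ⟨N, j, a, ha, hj, hza⟩ := (mem_twist_iff 𝒜 he hf m z).1 hz
    obtain ⟨k, hk⟩ := resLoc_eq_zero _ a N z hza (congrArg Subtype.val h0)
    refine ⟨k, Subtype.ext ?_⟩
    obtain ⟨e, rfl⟩ : ∃ c, e = c + 1 := ⟨e - 1, by omega⟩
    rw [Submodule.coe_smul, val_smul_loc, val_pow]
    have hfx : IsUnit (algebraMap A (Localization.Away f) f ^ (N + e' * k + k)) :=
      (unitOfDvd (dvd_refl f) ^ (N + e' * k + k)).isUnit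
    refine hfx.mul_left_eq_zero.1 ?_
    have h1 := congrArg (algebraMap A (Localization.Away f)) hk
    rw [hx] at h1
    simp only [map_mul, map_pow, map_zero, ← hza] at h1
    have h2 := val_isLocalizationElem_pow_mul 𝒜 hf hg k
    change _ * z * _ = 0
    linear_combination (exp := 1) algebraMap A (Localization.Away f) g ^ (e * k) * h1 +
      z * algebraMap A (Localization.Away f) f ^ (N + k) * h2

/-- The opens `D₊(f * p i)` cover `D₊(f)`. A power of `f` is a combination of the `p i ^ e`; taking
homogeneous parts of the coefficients and dividing by that power of `f` gives a partition of unity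
in degree zero. -/
theorem span_isLocalizationElem_eq_top {ι : Type*} [Finite ι] {p : ι → A} {e' : ℕ}
    (hp : ∀ i, p i ∈ 𝒜 e') {f : A} {e : ℕ} (hf : f ∈ 𝒜 e) (hfp : f ∈ (Ideal.span (Set.range p)).radical) :
    Ideal.span (Set.range fun i => Away.isLocalizationElem hf (hp i)) = ⊤ := by
  cases nonempty_fintype ι
  have h1 : Ideal.span (Set.range p) ≤ (Ideal.span (Set.range fun i => p i ^ e)).radical := by
    rw [Ideal.span_le]
    rintro _ ⟨i, rfl⟩
    exact ⟨e, Ideal.subset_span ⟨i, rfl⟩⟩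
  obtain ⟨M, hM⟩ := Ideal.radical_le_radical_iff.2 h1 hfp
  have hM' := Ideal.mul_mem_left _ (f ^ e') hM
  rw [← pow_add] at hM'
  obtain ⟨a, ha⟩ := Ideal.mem_span_range_iff_exists_fun.1 hM'
  have h2 : f ^ (e' + M) = ∑ i, (DirectSum.decompose 𝒜 (a i) (M * e) : A) * p i ^ e := by
    have h3 : f ^ (e' + M) ∈ 𝒜 ((e' + M) * e) := SetLike.pow_mem_graded _ hf
    rw [← DirectSum.decompose_of_mem_same 𝒜 h3, ← ha, DirectSum.decompose_sum,
      DFinsupp.finsetSum_apply, AddSubmonoidClass.coe_finsetSum]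
    refine Finset.sum_congr rfl fun i _ => ?_
    rw [DirectSum.coe_decompose_mul_of_right_mem_of_le 𝒜
      (SetLike.pow_mem_graded (e) (hp i)) (by ring_nf; simp)]
    have h5 : (e' + M) * e - e • e' = M * e := by
      rw [add_mul, smul_eq_mul, mul_comm e' e, Nat.add_sub_cancel_left]
    rw [h5]
  rw [Ideal.eq_top_iff_one, Ideal.mem_span_range_iff_exists_fun]
  refine ⟨fun i => Away.mk 𝒜 hf M _ (SetLike.coe_mem (DirectSum.decompose 𝒜 (a i) (M * e))), ?_⟩
  refine val_injective _ ?_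
  refine ((IsLocalization.Away.algebraMap_isUnit f).pow (e' + M)).mul_left_injective ?_
  have h4 := congrArg (algebraMap A (Localization.Away f)) h2
  rw [map_pow, map_sum] at h4
  beta_reduce
  rw [val_one, one_mul]
  change algebraMap (Away 𝒜 f) (Localization.Away f) _ * algebraMap A (Localization.Away f) f ^ _ =
    algebraMap A (Localization.Away f) f ^ _
  rw [map_sum, Finset.sum_mul]
  refine Eq.trans (Finset.sum_congr rfl fun i _ => ?_) h4.symm
  have h5 : p i ^ e ∈ 𝒜 (e' • e) := by
    rw [smul_eq_mul, mul_comm, ← smul_eq_mul]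
    exact SetLike.pow_mem_graded e (hp i)
  have h6 (b : A) (hb : b ∈ 𝒜 (M • e)) : (Away.mk 𝒜 hf M b hb * Away.isLocalizationElem hf (hp i)).val *
      algebraMap A (Localization.Away f) f ^ (e' + M) = algebraMap A _ (b * p i ^ e) := by
    rw [val_mul, map_mul, ← val_mk_mul_pow 𝒜 hf M b hb, ← val_mk_mul_pow 𝒜 hf e' (p i ^ e) h5]
    ring
  exact h6 _ _

end Twist

/-! ### Coordinates and Jacobian matrices, and the trivializations of top forms that they define. -/

section Kaehler

variable {R S T : Type} [CommRing R] [CommRing S] [CommRing T] [Algebra ℂ R] [Algebra ℂ S]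
  [Algebra ℂ T]

/-- The map `Ω_{R/ℂ} → Ω_{S/ℂ}` induced by a homomorphism of `ℂ`-algebras `R → S`. -/
def kaehlerMap (u : R →ₐ[ℂ] S) : Ω[R⁄ℂ] →+ Ω[S⁄ℂ] :=
  letI : Algebra R S := u.toRingHom.toAlgebra
  haveI : IsScalarTower ℂ R S := IsScalarTower.of_algebraMap_eq fun r => (u.commutes r).symm
  (KaehlerDifferential.map ℂ ℂ R S).toAddMonoidHom

theorem kaehlerMap_D (u : R →ₐ[ℂ] S) (a : R) :
    kaehlerMap u (KaehlerDifferential.D ℂ R a) = KaehlerDifferential.D ℂ S (u a) := by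
  let : Algebra R S := u.toRingHom.toAlgebra
  have : IsScalarTower ℂ R S := IsScalarTower.of_algebraMap_eq fun r => (u.commutes r).symm
  exact KaehlerDifferential.map_D ℂ ℂ R S a

theorem kaehlerMap_smul (u : R →ₐ[ℂ] S) (a : R) (x : Ω[R⁄ℂ]) :
    kaehlerMap u (a • x) = u a • kaehlerMap u x := by
  let : Algebra R S := u.toRingHom.toAlgebra
  have : IsScalarTower ℂ R S := IsScalarTower.of_algebraMap_eq fun r => (u.commutes r).symm
  exact ((KaehlerDifferential.map ℂ ℂ R S).map_smul a x).trans (algebraMap_smul S a _).symm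

theorem kaehlerMap_sum {σ : Type*} [Fintype σ] (u : R →ₐ[ℂ] S) (v y : σ → R) :
    kaehlerMap u (∑ l, v l • KaehlerDifferential.D ℂ R (y l)) =
      ∑ l, u (v l) • KaehlerDifferential.D ℂ S (u (y l)) := by
  rw [map_sum]
  exact Finset.sum_congr rfl fun l _ => by rw [kaehlerMap_smul, kaehlerMap_D]

theorem formsMap_ιMulti_kaehlerMap (u : R →ₐ[ℂ] S) (d : ℕ) (x : Fin d → Ω[R⁄ℂ]) :
    formsMap u d (exteriorPower.ιMulti R d x) =
      exteriorPower.ιMulti S d fun i => kaehlerMap u (x i) :=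
  formsMap_ιMulti_map u d x

theorem kaehlerMap_comp (u : R →ₐ[ℂ] S) (v : S →ₐ[ℂ] T) (x : Ω[R⁄ℂ]) :
    kaehlerMap v (kaehlerMap u x) = kaehlerMap (v.comp u) x := by
  have hx : x ∈ Submodule.span R (Set.range (KaehlerDifferential.D ℂ R)) := by
    rw [KaehlerDifferential.span_range_derivation]; trivial
  induction hx using Submodule.span_induction with
  | mem x hx => obtain ⟨y, rfl⟩ := hx; simp [kaehlerMap_D]
  | zero => simp
  | add x y _ _ h1 h2 => simp only [map_add, h1, h2]
  | smul a x _ h => simp only [kaehlerMap_smul, h, AlgHom.comp_apply]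

theorem formsMap_comp (u : R →ₐ[ℂ] S) (v : S →ₐ[ℂ] T) (d : ℕ) (x : ⋀[R]^d (Ω[R⁄ℂ])) :
    formsMap v d (formsMap u d x) = formsMap (v.comp u) d x := by
  induction x using forms_induction with
  | h0 => simp
  | hadd x y hx hy => simp only [map_add, hx, hy]
  | hsmul a x hx => simp only [formsMap_smul, hx, AlgHom.comp_apply]
  | hι x => simp only [formsMap_ιMulti_kaehlerMap, kaehlerMap_comp]

/-- `R` is, étale locally, the complete intersection in affine space with coordinates `y` whose
Jacobian matrix is `J`: the differentials `dy_l` generate `Ω_{R/ℂ}`, the rows of `J` generate their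
relations, and `J` has a right inverse. -/
structure IsCoord {σ : Type*} [Fintype σ] {c : ℕ} (y : σ → R) (J : Fin c → σ → R) : Prop where
  span_eq : Submodule.span R (Set.range fun l => KaehlerDifferential.D ℂ R (y l)) = ⊤
  rel : ∀ v : σ → R, ∑ l, v l • KaehlerDifferential.D ℂ R (y l) = 0 ↔
    v ∈ Submodule.span R (Set.range J)
  right_inv : ∃ B : Matrix σ (Fin c) R, Matrix.of J * B = 1

namespace IsCoord

variable {σ : Type*} [Fintype σ] {c d : ℕ} {y : σ → R} {J : Fin c → σ → R}

theorem exists_sum (h : IsCoord y J) (x : Ω[R⁄ℂ]) :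
    ∃ v : σ → R, x = ∑ l, v l • KaehlerDifferential.D ℂ R (y l) := by
  have hx : x ∈ Submodule.span R (Set.range fun l => KaehlerDifferential.D ℂ R (y l)) := by
    rw [h.span_eq]; trivial
  obtain ⟨v, hv⟩ := (Submodule.mem_span_range_iff_exists_fun R).1 hx
  exact ⟨v, hv.symm⟩

theorem exists_equiv (h : IsCoord y J) (e : Fin d ⊕ Fin c ≃ σ) :
    ∃ ψ : ⋀[R]^d (Ω[R⁄ℂ]) ≃ₗ[R] R, ∀ v : Fin d → σ → R,
      ψ (exteriorPower.ιMulti R d fun i => ∑ l, v i l • KaehlerDifferential.D ℂ R (y l)) =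
        stackDet e J v := by
  obtain ⟨B, hB⟩ := h.right_inv
  obtain ⟨ψ, hψ⟩ := exists_exteriorPower_equiv e J B hB
    (Fintype.linearCombination R fun l => KaehlerDifferential.D ℂ R (y l))
    (by rw [← LinearMap.range_eq_top, Fintype.range_linearCombination, h.span_eq])
    (by ext v; rw [LinearMap.mem_ker, Fintype.linearCombination_apply, h.rel])
  exact ⟨ψ, hψ⟩

/-- The trivialization of the top forms given by coordinates and equations. -/
def equiv (h : IsCoord y J) (e : Fin d ⊕ Fin c ≃ σ) : ⋀[R]^d (Ω[R⁄ℂ]) ≃ₗ[R] R :=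
  (h.exists_equiv e).choose

theorem equiv_ιMulti (h : IsCoord y J) (e : Fin d ⊕ Fin c ≃ σ) (v : Fin d → σ → R) :
    h.equiv e (exteriorPower.ιMulti R d fun i => ∑ l, v i l • KaehlerDifferential.D ℂ R (y l)) =
      stackDet e J v :=
  (h.exists_equiv e).choose_spec v

theorem equiv_formsMap (h : IsCoord y J) (e : Fin d ⊕ Fin c ≃ σ) (u : R →ₐ[ℂ] S)
    (h' : IsCoord (fun l => u (y l)) fun r l => u (J r l)) (x : ⋀[R]^d (Ω[R⁄ℂ])) :
    h'.equiv e (formsMap u d x) = u (h.equiv e x) := by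
  induction x using forms_induction with
  | h0 => simp
  | hadd x y hx hy => simp only [map_add, hx, hy]
  | hsmul a x hx => simp only [formsMap_smul, map_smul, hx, smul_eq_mul, map_mul]
  | hι x =>
    choose v hv using fun i => h.exists_sum (x i)
    obtain rfl : x = fun i => ∑ l, v i l • KaehlerDifferential.D ℂ R (y l) := funext hv
    simp only [formsMap_ιMulti_kaehlerMap, kaehlerMap_sum]
    rw [h.equiv_ιMulti, h'.equiv_ιMulti]
    exact (map_stackDet u.toRingHom e J v).symm

/-- The transition function between two trivializations of the top forms; by linearity it suffices
to compare wedges of differentials, where it is `stackDet_mul`. -/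
theorem equiv_eq_mul [DecidableEq σ] (h : IsCoord y J) (e : Fin d ⊕ Fin c ≃ σ) {y' : σ → R}
    {J' : Fin c → σ → R} (h' : IsCoord y' J') (T : Matrix (Fin c) (Fin c) R) (D : Matrix σ σ R)
    (hT : Matrix.of J = T * Matrix.of J' * D)
    (hD : ∀ l, KaehlerDifferential.D ℂ R (y' l) = ∑ m, D l m • KaehlerDifferential.D ℂ R (y m))
    (x : ⋀[R]^d (Ω[R⁄ℂ])) : h.equiv e x = T.det * D.det * h'.equiv e x := by
  induction x using forms_induction with
  | h0 => simp
  | hadd x y hx hy => simp only [map_add, hx, hy, mul_add]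
  | hsmul a x hx => simp only [map_smul, hx, smul_eq_mul]; ring
  | hι x =>
    choose v hv using fun i => h'.exists_sum (x i)
    obtain rfl : x = fun i => ∑ l, v i l • KaehlerDifferential.D ℂ R (y' l) := funext hv
    rw [h'.equiv_ιMulti]
    have h1 : (fun i => ∑ l, v i l • KaehlerDifferential.D ℂ R (y' l)) =
        fun i => ∑ m, (v i ᵥ* D) m • KaehlerDifferential.D ℂ R (y m) := by
      funext i
      simp only [hD, Matrix.vecMul, dotProduct, Finset.smul_sum, Finset.sum_smul, smul_smul]
      exact Finset.sum_comm
    rw [h1, h.equiv_ιMulti]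
    have h2 : J = fun r => (T * Matrix.of J' * D) r := by
      rw [← hT]; rfl
    rw [h2, stackDet_mul]
    ring

theorem map (h : IsCoord y J) (u : R →ₐ[ℂ] S) (r : R)
    (hu : letI : Algebra R S := u.toRingHom.toAlgebra; IsLocalization.Away r S) :
    IsCoord (fun l => u (y l)) fun i l => u (J i l) := by
  let : Algebra R S := u.toRingHom.toAlgebra
  have : IsScalarTower ℂ R S := IsScalarTower.of_algebraMap_eq fun r => (u.commutes r).symm
  have hloc : IsLocalization (Submonoid.powers r) S := hu
  have hur : IsUnit (u r) := IsLocalization.Away.algebraMap_isUnit (S := S) r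
  let l : Ω[R⁄ℂ] →ₗ[R] Ω[S⁄ℂ] := KaehlerDifferential.map ℂ ℂ R S
  have hl : IsLocalizedModule (Submonoid.powers r) l := inferInstance
  have hlk (x) : l x = kaehlerMap u x := rfl
  refine ⟨?_, fun v => ⟨fun hv => ?_, fun hv => ?_⟩, ?_⟩
  · rw [eq_top_iff]
    rintro x -
    obtain ⟨⟨z, ⟨_, k, rfl⟩⟩, hz⟩ := IsLocalizedModule.surj (Submonoid.powers r) l x
    obtain ⟨v, rfl⟩ := h.exists_sum z
    have h1 : u r ^ k • x = kaehlerMap u (∑ l, v l • KaehlerDifferential.D ℂ R (y l)) := by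
      rw [← hlk, ← hz, ← map_pow]
      exact algebraMap_smul S (r ^ k) x
    have h2 : u r ^ k • x ∈
        Submodule.span S (Set.range fun l => KaehlerDifferential.D ℂ S (u (y l))) := by
      rw [h1, kaehlerMap_sum]
      exact Submodule.sum_mem _ fun l _ => Submodule.smul_mem _ _ (Submodule.subset_span ⟨l, rfl⟩)
    exact (Submodule.smul_mem_iff_of_isUnit _ (hur.pow k)).1 h2
  -- A relation over the localization, multiplied by powers of `r`, comes from a relation over `R`,
  -- to which `h.rel` applies.
  · obtain ⟨⟨_, k, rfl⟩, hk⟩ := IsLocalization.exist_integer_multiples (Submonoid.powers r)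
      Finset.univ v
    choose w hw using fun l => hk l (Finset.mem_univ l)
    have hw' (l) : u (w l) = u r ^ k * v l := by
      refine (hw l).trans ?_
      rw [Algebra.smul_def]
      exact congrArg (· * v l) (map_pow u r k)
    have h0 : l (∑ l, w l • KaehlerDifferential.D ℂ R (y l)) = 0 := by
      rw [hlk, kaehlerMap_sum]
      simp only [hw', mul_smul, ← Finset.smul_sum, hv, smul_zero]
    obtain ⟨⟨_, m, rfl⟩, hm⟩ := (IsLocalizedModule.eq_zero_iff (Submonoid.powers r) l).1 h0
    have h1 : ∑ l, (r ^ m • w) l • KaehlerDifferential.D ℂ R (y l) = 0 := by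
      refine Eq.trans ?_ hm
      change _ = r ^ m • (∑ l, w l • KaehlerDifferential.D ℂ R (y l))
      simp only [Finset.smul_sum, Pi.smul_apply, smul_eq_mul, mul_smul]
    rw [h.rel] at h1
    obtain ⟨a, ha⟩ := (Submodule.mem_span_range_iff_exists_fun R).1 h1
    have h2 : u r ^ (m + k) • v = ∑ i, u (a i) • fun l => u (J i l) := by
      funext l
      have := congrArg u (congrFun ha l)
      simp only [Finset.sum_apply, Pi.smul_apply, smul_eq_mul, map_sum, map_mul, hw', map_pow]
        at this ⊢
      rw [this, pow_add]; ring
    have h3 : u r ^ (m + k) • v ∈ Submodule.span S (Set.range fun i l => u (J i l)) := by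
      rw [h2]
      exact Submodule.sum_mem _ fun i _ => Submodule.smul_mem _ _ (Submodule.subset_span ⟨i, rfl⟩)
    exact (Submodule.smul_mem_iff_of_isUnit _ (hur.pow _)).1 h3
  · induction hv using Submodule.span_induction with
    | mem x hx =>
      obtain ⟨i, rfl⟩ := hx
      rw [← kaehlerMap_sum, (h.rel _).2 (Submodule.subset_span ⟨i, rfl⟩), map_zero]
    | zero => simp
    | add x y _ _ h1 h2 => simp only [Pi.add_apply, add_smul, Finset.sum_add_distrib, h1, h2, add_zero]
    | smul a x _ h => simp only [Pi.smul_apply, smul_eq_mul, mul_smul, ← Finset.smul_sum, h, smul_zero]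
  · obtain ⟨B, hB⟩ := h.right_inv
    refine ⟨B.map u, ?_⟩
    have h1 := congrArg (fun M => M.map u.toRingHom) hB
    simp only [Matrix.map_mul] at h1
    refine h1.trans ?_
    exact Matrix.map_one _ (map_zero _) (map_one _)

end IsCoord
end Kaehler

/-! ### From a compatible family of charts to an isomorphism of the canonical sheaf with a twist. -/

section Glue

variable {A : Type} [CommRing A] [Algebra ℂ A] (𝒜 : ℕ → Submodule ℂ A) [GradedAlgebra 𝒜]

/-- Inside `D₊(f p)` the open `D₊(f p q)` is cut out both by `q ^ e / f` and by `q ^ (e + 1) / (f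
p)`. This identity converts torsion for the second into torsion for the first. -/
theorem pow_isLocalizationElem_mul {f p q : A} {e : ℕ} (hf : f ∈ 𝒜 e) (hp : p ∈ 𝒜 1)
    (hq : q ∈ 𝒜 1) :
    awayResEq 𝒜 hp rfl (Away.isLocalizationElem hf hq) ^ (e + 1) =
      Away.isLocalizationElem (SetLike.mul_mem_graded hf hp) hq ^ e *
        awayResEq 𝒜 hp rfl (Away.isLocalizationElem hf hp) := by
  refine val_injective _ ?_
  rw [val_mul, val_pow, val_pow, val_awayResEq, val_awayResEq]
  have h1 := congrArg (resLoc ⟨p, rfl⟩) (val_isLocalizationElem_pow_mul 𝒜 hf hq 1)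
  have h2 := congrArg (resLoc ⟨p, rfl⟩) (val_isLocalizationElem_pow_mul 𝒜 hf hp 1)
  have h3 := val_isLocalizationElem_pow_mul 𝒜 (SetLike.mul_mem_graded hf hp) hq e
  simp only [map_mul, map_pow, resLoc_algebraMap, pow_one, mul_one, one_mul] at h1 h2 h3
  have hu : IsUnit (algebraMap A (Localization.Away (f * p)) f ^ (e + 1) * algebraMap A _ p ^ e) :=
    (unitOfDvd ⟨p, rfl⟩ ^ (e + 1) * unitOfDvd (Dvd.intro_left f rfl) ^ e).isUnit
  refine hu.mul_left_injective ?_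
  change _ * _ = _ * _
  calc _ = (resLoc ⟨p, rfl⟩ (Away.isLocalizationElem hf hq).val * algebraMap A _ f) ^ (e + 1) *
        algebraMap A _ p ^ e := by ring
    _ = ((Away.isLocalizationElem (SetLike.mul_mem_graded hf hp) hq).val ^ e *
          (algebraMap A _ f * algebraMap A _ p) ^ e) *
        (resLoc ⟨p, rfl⟩ (Away.isLocalizationElem hf hp).val * algebraMap A _ f) := by
      rw [h1, h2, h3]; ring
    _ = _ := by ring

variable {ι σ : Type} [Fintype σ] {c d : ℕ} {p : ι → A}
  {y : ∀ i, σ → Away 𝒜 (p i)} {J : ∀ i, Fin c → σ → Away 𝒜 (p i)}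

theorem isCoord_restrict (hp : ∀ i, p i ∈ 𝒜 1) (hJ : ∀ i, IsCoord (y i) (J i)) (i : ι) {z x : A} {l : ℕ} (hz : z ∈ 𝒜 l)
    (hx : x = p i * z) :
    IsCoord (fun s => awayResEq 𝒜 hz hx (y i s)) fun r s => awayResEq 𝒜 hz hx (J i r s) :=
  (hJ i).map _ (Away.isLocalizationElem (hp i) hz)
    (awayResEq_isLocalization 𝒜 Nat.one_pos (hp i) hz hx)

variable (hp : ∀ i, p i ∈ 𝒜 1) (hJ : ∀ i, IsCoord (y i) (J i)) (e : Fin d ⊕ Fin c ≃ σ) (m : ℤ)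

/-- The isomorphism of the top forms on `D₊(x)` with the sections of `𝒪(m)` given by the `i`-th
chart. -/
def chartTriv (i : ι) {z x : A} {l : ℕ} (hz : z ∈ 𝒜 l) (hx : x = z * p i) :
    ⋀[Away 𝒜 x]^d (Ω[Away 𝒜 x⁄ℂ]) ≃ₗ[Away 𝒜 x] twist 𝒜 x (l + 1) m :=
  (isCoord_restrict 𝒜 hp hJ i hz (hx.trans (mul_comm _ _))).equiv e ≪≫ₗ trivTwist 𝒜 hz (hp i) hx m

theorem chartTriv_apply (i : ι) {z x : A} {l : ℕ} (hz : z ∈ 𝒜 l) (hx : x = z * p i)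
    (η : ⋀[Away 𝒜 x]^d (Ω[Away 𝒜 x⁄ℂ])) :
    (chartTriv 𝒜 hp hJ e m i hz hx η : Localization.Away x) =
      ((isCoord_restrict 𝒜 hp hJ i hz (hx.trans (mul_comm _ _))).equiv e η).val *
        ((unitOfDvd (Dvd.intro_left z hx.symm) ^ m : (Localization.Away x)ˣ) :
        Localization.Away x) := rfl

theorem resLoc_chartTriv (i : ι) {z x z' x' h : A} {l l' k : ℕ} (hz : z ∈ 𝒜 l) (hx : x = z * p i)
    (hz' : z' ∈ 𝒜 l') (hx' : x' = z' * p i) (hh : h ∈ 𝒜 k) (hxx : x' = x * h)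
    (η : ⋀[Away 𝒜 x]^d (Ω[Away 𝒜 x⁄ℂ])) :
    resLoc ⟨h, hxx⟩ (chartTriv 𝒜 hp hJ e m i hz hx η) =
      chartTriv 𝒜 hp hJ e m i hz' hx' (formsMap (awayResEq 𝒜 hh hxx) d η) := by
  rw [chartTriv_apply, chartTriv_apply, map_mul, resLoc_zpow_unitOfDvd, ← val_awayResEq 𝒜 hh hxx]
  congr 2
  have h1 := isCoord_restrict 𝒜 hp hJ i hz (hx.trans (mul_comm _ _))
  have hc := awayResEq_comp 𝒜 hz hh hz' (hx.trans (mul_comm _ _)) hxx (hx'.trans (mul_comm _ _))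
  have h2 : IsCoord (fun s => awayResEq 𝒜 hh hxx (awayResEq 𝒜 hz (hx.trans (mul_comm _ _)) (y i s)))
      fun r s => awayResEq 𝒜 hh hxx (awayResEq 𝒜 hz (hx.trans (mul_comm _ _)) (J i r s)) := by
    simp only [← AlgHom.comp_apply, hc]
    exact isCoord_restrict 𝒜 hp hJ i hz' (hx'.trans (mul_comm _ _))
  rw [← h1.equiv_formsMap e _ h2]
  congr 1
  simp only [← AlgHom.comp_apply, hc]

variable [DecidableEq σ]

/-- The hypothesis `hT` says that the transition function of the top forms is `(p j / p i) ^ m`.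
This is exactly what separates the generators `p i ^ m` and `p j ^ m` of `𝒪(m)`, so the two charts
define the same isomorphism. -/
theorem chartTriv_eq
    (hT : ∀ i j, ∃ (T : Matrix (Fin c) (Fin c) (Away 𝒜 (p i * p j)))
      (D : Matrix σ σ (Away 𝒜 (p i * p j))),
      (Matrix.of fun r l => awayResEq 𝒜 (hp j) rfl (J i r l)) =
        T * (Matrix.of fun r l => awayResEq 𝒜 (hp i) (mul_comm _ _) (J j r l)) * D ∧
      (∀ l, KaehlerDifferential.D ℂ (Away 𝒜 (p i * p j))
        (awayResEq 𝒜 (hp i) (mul_comm _ _) (y j l)) =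
        ∑ s, D l s • KaehlerDifferential.D ℂ _ (awayResEq 𝒜 (hp j) rfl (y i s))) ∧
      (T.det * D.det).val * ((unitOfDvd ⟨p j, rfl⟩ ^ m : (Localization.Away (p i * p j))ˣ) :
        Localization.Away (p i * p j)) =
        ((unitOfDvd (Dvd.intro_left (p i) rfl) ^ m : (Localization.Away (p i * p j))ˣ) :
        Localization.Away (p i * p j)))
    (i j : ι) {z z' x h : A} {l l' k : ℕ} (hz : z ∈ 𝒜 l) (hx : x = z * p i)
    (hz' : z' ∈ 𝒜 l') (hx' : x = z' * p j) (hh : h ∈ 𝒜 k) (hxx : x = p i * p j * h)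
    (η : ⋀[Away 𝒜 x]^d (Ω[Away 𝒜 x⁄ℂ])) :
    (chartTriv 𝒜 hp hJ e m i hz hx η : Localization.Away x) =
      chartTriv 𝒜 hp hJ e m j hz' hx' η := by
  obtain ⟨T, D, h1, h2, h3⟩ := hT i j
  let w := awayResEq 𝒜 hh hxx
  have hci := awayResEq_comp 𝒜 (hp j) hh hz rfl hxx (hx.trans (mul_comm _ _))
  have hcj := awayResEq_comp 𝒜 (hp i) hh hz' (mul_comm (p i) (p j)) hxx (hx'.trans (mul_comm _ _))
  rw [chartTriv_apply, chartTriv_apply,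
    (isCoord_restrict 𝒜 hp hJ i hz (hx.trans (mul_comm _ _))).equiv_eq_mul e
      (isCoord_restrict 𝒜 hp hJ j hz' (hx'.trans (mul_comm _ _))) (T.map w) (D.map w)]
  · rw [val_mul, mul_right_comm, mul_comm]
    congr 1
    have h4 := congrArg (resLoc ⟨h, hxx⟩) h3
    rw [map_mul, resLoc_zpow_unitOfDvd, resLoc_zpow_unitOfDvd, ← val_awayResEq 𝒜 hh hxx, map_mul] at h4
    rw [← h4]
    have h5 := AlgHom.map_det w T
    have h6 := AlgHom.map_det w D
    change w T.det = (T.map w).det at h5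
    change w D.det = (D.map w).det at h6
    rw [← h5, ← h6]
  · have h4 := congrArg (fun M => M.map w.toRingHom) h1
    simp only [Matrix.map_mul] at h4
    rw [← hci, ← hcj]
    exact h4
  · intro s
    have h4 := congrArg (kaehlerMap w) (h2 s)
    rw [kaehlerMap_sum, kaehlerMap_D] at h4
    rw [← hci, ← hcj]
    exact h4

theorem resLoc_chartTriv_comm
    (hT : ∀ i j, ∃ (T : Matrix (Fin c) (Fin c) (Away 𝒜 (p i * p j)))
      (D : Matrix σ σ (Away 𝒜 (p i * p j))),
      (Matrix.of fun r l => awayResEq 𝒜 (hp j) rfl (J i r l)) =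
        T * (Matrix.of fun r l => awayResEq 𝒜 (hp i) (mul_comm _ _) (J j r l)) * D ∧
      (∀ l, KaehlerDifferential.D ℂ (Away 𝒜 (p i * p j))
        (awayResEq 𝒜 (hp i) (mul_comm _ _) (y j l)) =
        ∑ s, D l s • KaehlerDifferential.D ℂ _ (awayResEq 𝒜 (hp j) rfl (y i s))) ∧
      (T.det * D.det).val * ((unitOfDvd ⟨p j, rfl⟩ ^ m : (Localization.Away (p i * p j))ˣ) :
        Localization.Away (p i * p j)) =
        ((unitOfDvd (Dvd.intro_left (p i) rfl) ^ m : (Localization.Away (p i * p j))ˣ) :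
        Localization.Away (p i * p j)))
    (i j : ι) {f : A} {l : ℕ} (hf : f ∈ 𝒜 l) (n : ⋀[Away 𝒜 f]^d (Ω[Away 𝒜 f⁄ℂ])) :
    resLoc ⟨p j, rfl⟩ (chartTriv 𝒜 hp hJ e m i hf rfl
      (formsMap (awayResEq 𝒜 (hp i) (rfl : f * p i = f * p i)) d n) : Localization.Away (f * p i)) =
      resLoc ⟨p i, mul_right_comm f (p i) (p j)⟩ (chartTriv 𝒜 hp hJ e m j hf rfl
        (formsMap (awayResEq 𝒜 (hp j) (rfl : f * p j = f * p j)) d n) :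
          Localization.Away (f * p j)) := by
  have hx1 : f * p i * p j = f * p j * p i := mul_right_comm _ _ _
  have hx2 : f * p i * p j = p i * p j * f := by rw [mul_assoc, mul_comm]
  have hf1 := SetLike.mul_mem_graded hf (hp i)
  have hf2 := SetLike.mul_mem_graded hf (hp j)
  have hc1 := awayResEq_comp 𝒜 (hp i) (hp j) (SetLike.mul_mem_graded (hp i) (hp j))
    (rfl : f * p i = f * p i) rfl (mul_assoc f (p i) (p j))
  have hc2 := awayResEq_comp 𝒜 (hp j) (hp i) (SetLike.mul_mem_graded (hp i) (hp j))
    (rfl : f * p j = f * p j) hx1 (mul_assoc f (p i) (p j))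
  have h1 := resLoc_chartTriv 𝒜 hp hJ e m i hf rfl hf2 hx1 (hp j) rfl
    (formsMap (awayResEq 𝒜 (hp i) rfl) d n)
  have h2 := resLoc_chartTriv 𝒜 hp hJ e m j hf rfl hf1 rfl (hp i) hx1
    (formsMap (awayResEq 𝒜 (hp j) rfl) d n)
  rw [formsMap_comp, hc1] at h1
  rw [formsMap_comp, hc2] at h2
  exact h1.trans ((chartTriv_eq 𝒜 hp hJ e m hT i j hf2 hx1 hf1 rfl hf hx2 _).trans h2.symm)

/-- On `D₊(f)` no single chart need be available; the chart isomorphisms live on the opens `D₊(f * p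
i)`, which cover it, and are glued from there. -/
theorem exists_glued_triv [Finite ι]
    (hspan : ∀ f : A, ∀ e : ℕ, 0 < e → f ∈ 𝒜 e → f ∈ (Ideal.span (Set.range p)).radical)
    (hT : ∀ i j, ∃ (T : Matrix (Fin c) (Fin c) (Away 𝒜 (p i * p j)))
      (D : Matrix σ σ (Away 𝒜 (p i * p j))),
      (Matrix.of fun r l => awayResEq 𝒜 (hp j) rfl (J i r l)) =
        T * (Matrix.of fun r l => awayResEq 𝒜 (hp i) (mul_comm _ _) (J j r l)) * D ∧
      (∀ l, KaehlerDifferential.D ℂ (Away 𝒜 (p i * p j))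
        (awayResEq 𝒜 (hp i) (mul_comm _ _) (y j l)) =
        ∑ s, D l s • KaehlerDifferential.D ℂ _ (awayResEq 𝒜 (hp j) rfl (y i s))) ∧
      (T.det * D.det).val * ((unitOfDvd ⟨p j, rfl⟩ ^ m : (Localization.Away (p i * p j))ˣ) :
        Localization.Away (p i * p j)) =
        ((unitOfDvd (Dvd.intro_left (p i) rfl) ^ m : (Localization.Away (p i * p j))ˣ) :
        Localization.Away (p i * p j)))
    (f : A) (l : ℕ) (hl : 0 < l) (hf : f ∈ 𝒜 l) :
    ∃ ψ : ⋀[Away 𝒜 f]^d (Ω[Away 𝒜 f⁄ℂ]) ≃ₗ[Away 𝒜 f] twist 𝒜 f l m, ∀ i n,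
      twistRes 𝒜 hl hf (hp i) rfl rfl m (ψ n) = chartTriv 𝒜 hp hJ e m i hf rfl
        (formsMap (awayResEq 𝒜 (hp i) rfl) d n) := by
  cases nonempty_fintype ι
  refine IsLocMap.exists_glue_equiv
    (u := fun i => (awayResEq 𝒜 (hp i) (rfl : f * p i = f * p i)).toRingHom)
    (r := fun i => Away.isLocalizationElem hf (hp i))
    (lN := fun i => formsMap (awayResEq 𝒜 (hp i) rfl) d)
    (lM := fun i => twistRes 𝒜 hl hf (hp i) rfl rfl m)
    (span_isLocalizationElem_eq_top 𝒜 hp hf (hspan f l hl hf))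
    (fun i => formsMap_isLocMap _ _ (awayResEq_isLocalization 𝒜 hl hf (hp i) rfl) d)
    (fun i => twistRes_isLocMap 𝒜 hl hf (hp i) rfl rfl m) _
    (Rᵢⱼ := fun i j => Away 𝒜 (f * p i * p j))
    (Mᵢⱼ := fun i j => twist 𝒜 (f * p i * p j) (l + 1 + 1) m)
    (fun i j => (awayResEq 𝒜 (hp j) rfl).toRingHom)
    (fun i j => twistRes 𝒜 l.succ_pos (SetLike.mul_mem_graded hf (hp i)) (hp j) rfl rfl m)
    (fun i j => twistRes 𝒜 l.succ_pos (SetLike.mul_mem_graded hf (hp j)) (hp i)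
      (mul_right_comm _ _ _) rfl m) ?_ ?_ ?_ ?_ ?_
  · exact fun i j a z => twistRes_smul 𝒜 _ _ _ _ _ m a z
  · intro i j z hz
    obtain ⟨k, hk⟩ := (twistRes_isLocMap 𝒜 l.succ_pos (SetLike.mul_mem_graded hf (hp i)) (hp j)
      rfl rfl m).exists_of_eq_zero z hz
    refine ⟨(l + 1) * k, ?_⟩
    have h1 := pow_isLocalizationElem_mul 𝒜 hf (hp i) (hp j)
    obtain ⟨l, rfl⟩ : ∃ t, l = t + 1 := ⟨l - 1, by omega⟩
    rw [pow_mul]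
    change (awayResEq 𝒜 (hp i) rfl (Away.isLocalizationElem hf (hp j)) ^ _) ^ k • z = 0
    rw [h1, pow_succ, mul_right_comm, mul_pow]
    have h2 (a b : Away 𝒜 (f * p i)) (h : b • z = 0) : (a * b) • z = 0 := by
      have h3 := congrArg Subtype.val h
      rw [Submodule.coe_smul, val_smul_loc] at h3
      refine Subtype.ext ?_
      rw [Submodule.coe_smul, val_smul_loc, val_mul, mul_assoc, h3]
      exact mul_zero _
    exact h2 _ _ hk
  · intro i j a z
    rw [show (awayResEq 𝒜 (hp j) (rfl : f * p j = f * p j)).toRingHom a =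
      awayResEq 𝒜 (hp j) rfl a from rfl, twistRes_smul]
    congr 1
    refine val_injective _ ?_
    change (awayResEq 𝒜 _ _ (awayResEq 𝒜 _ _ a)).val = (awayResEq 𝒜 _ _ (awayResEq 𝒜 _ _ a)).val
    simp only [val_awayResEq, resLoc_resLoc]
  · intro i j z
    refine Subtype.ext ?_
    simp only [coe_twistRes, resLoc_resLoc]
  · exact fun i j n => Subtype.ext (resLoc_chartTriv_comm 𝒜 hp hJ e m hT i j hf n)

-- Compatibility with restriction from `D₊(f)` to `D₊(f g)` may be tested on each `D₊(f g p i)`,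
-- where both sides are the isomorphism of the `i`-th chart.
set_option maxHeartbeats 800000 in
theorem canonicalIsoTwist_of_charts [Finite ι] (hJ : ∀ i, IsCoord (y i) (J i))
    (e : Fin d ⊕ Fin c ≃ σ)
    (hspan : ∀ f : A, ∀ e : ℕ, 0 < e → f ∈ 𝒜 e → f ∈ (Ideal.span (Set.range p)).radical)
    (hT : ∀ i j, ∃ (T : Matrix (Fin c) (Fin c) (Away 𝒜 (p i * p j)))
      (D : Matrix σ σ (Away 𝒜 (p i * p j))),
      (Matrix.of fun r l => awayResEq 𝒜 (hp j) rfl (J i r l)) =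
        T * (Matrix.of fun r l => awayResEq 𝒜 (hp i) (mul_comm _ _) (J j r l)) * D ∧
      (∀ l, KaehlerDifferential.D ℂ (Away 𝒜 (p i * p j))
        (awayResEq 𝒜 (hp i) (mul_comm _ _) (y j l)) =
        ∑ s, D l s • KaehlerDifferential.D ℂ _ (awayResEq 𝒜 (hp j) rfl (y i s))) ∧
      (T.det * D.det).val * ((unitOfDvd ⟨p j, rfl⟩ ^ m : (Localization.Away (p i * p j))ˣ) :
        Localization.Away (p i * p j)) =
        ((unitOfDvd (Dvd.intro_left (p i) rfl) ^ m : (Localization.Away (p i * p j))ˣ) :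
        Localization.Away (p i * p j))) :
    CanonicalIsoTwist 𝒜 d m := by
  have hM (f : A) (l : ℕ) (hl : 0 < l) (hf : f ∈ 𝒜 l) (i : ι) :=
    twistRes_isLocMap 𝒜 hl hf (hp i) (rfl : f * p i = f * p i) rfl m
  have hex := exists_glued_triv 𝒜 hp hJ e m hspan hT
  cases nonempty_fintype ι
  choose ψ hψ using hex
  refine ⟨fun f l hl hf => (ψ f l hl hf).symm, fun f g l l' hl hf hg s t hst => ?_⟩
  have hfg := SetLike.mul_mem_graded hf hg
  have hl' : 0 < l + l' := Nat.add_pos_left hl l'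
  obtain ⟨n, rfl⟩ := (ψ f l hl hf).surjective s
  rw [LinearEquiv.symm_apply_apply, LinearEquiv.symm_apply_eq, ← sub_eq_zero]
  refine IsLocMap.eq_zero (span_isLocalizationElem_eq_top 𝒜 hp hfg (hspan _ _ hl' hfg))
    (hM (f * g) _ hl' hfg) _ fun i => ?_
  rw [map_sub, sub_eq_zero, hψ]
  refine Subtype.ext ?_
  have hst' : (t : Localization.Away (f * g)) = resLoc ⟨g, rfl⟩ (ψ f l hl hf n) := hst
  have h1 := congrArg Subtype.val (hψ f l hl hf i n)
  rw [coe_twistRes] at h1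
  have hx2 : f * g * p i = f * p i * g := mul_right_comm _ _ _
  have h2 := congrArg (resLoc ⟨g, hx2⟩) h1
  rw [resLoc_resLoc, resLoc_chartTriv 𝒜 hp hJ e m i hf rfl hfg rfl hg hx2, formsMap_comp,
    awayResEq_comp 𝒜 (hp i) hg (SetLike.mul_mem_graded hg (hp i)) rfl hx2 (mul_assoc _ _ _)] at h2
  rw [coe_twistRes, hst', resLoc_resLoc, h2]
  congr 2
  have h3 : formsMap (awayRes 𝒜 f hg) d n = formsMap (awayResEq 𝒜 hg rfl) d n := rfl
  rw [h3, formsMap_comp,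
    awayResEq_comp 𝒜 hg (hp i) (SetLike.mul_mem_graded hg (hp i)) rfl rfl (mul_assoc _ _ _)]

end Glue

/-! ### Values of Plücker coordinates and of linear forms in them on frames. -/

section PluckerForms

variable {n K : ℕ} {B : Type*} [CommRing B] [Algebra ℂ B]

/-- The value of a polynomial function on matrices at a matrix over a `ℂ`-algebra. -/
def evMat (X : Matrix (Fin n) (Fin K) B) : MatPoly n K →ₐ[ℂ] B :=
  MvPolynomial.aeval fun ij => X ij.1 ij.2

/-- The generic matrix. -/
def genMat (n K : ℕ) : Matrix (Fin n) (Fin K) (MatPoly n K) := Matrix.of fun i j => MvPolynomial.X (i, j)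

@[simp]
theorem evMat_X (X : Matrix (Fin n) (Fin K) B) (ij : Fin n × Fin K) :
    evMat X (MvPolynomial.X ij) = X ij.1 ij.2 := by simp [evMat]

theorem algHom_evMat {B' : Type*} [CommRing B'] [Algebra ℂ B'] (f : B →ₐ[ℂ] B')
    (X : Matrix (Fin n) (Fin K) B) (s : MatPoly n K) : f (evMat X s) = evMat (X.map f) s := by
  have : f.comp (evMat X) = evMat (X.map f) := MvPolynomial.algHom_ext fun ij => by simp
  exact DFunLike.congr_fun this s

theorem evMat_genMat (s : MatPoly n K) : evMat (genMat n K) s = s := by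
  have : evMat (genMat n K) = AlgHom.id ℂ _ := MvPolynomial.algHom_ext fun ij => by simp [genMat]
  exact DFunLike.congr_fun this s

theorem evMat_pluckerMap_X (X : Matrix (Fin n) (Fin K) B) (I : Fin K ↪o Fin n) :
    evMat X (pluckerMap n K (MvPolynomial.X I)) = (X.submatrix I id).det := by
  rw [pluckerMap, MvPolynomial.aeval_X, AlgHom.map_det]
  congr 1
  ext i j
  simp

theorem aeval_mul_of_isHomogeneous {τ : Type*} [Fintype τ] {F : MvPolynomial τ ℂ} {N : ℕ}
    (hF : F.IsHomogeneous N) (c : B) (x : τ → B) :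
    MvPolynomial.aeval (fun i => c * x i) F = c ^ N * MvPolynomial.aeval x F := by
  rw [MvPolynomial.aeval_def, MvPolynomial.aeval_def, MvPolynomial.eval₂_eq', MvPolynomial.eval₂_eq',
    Finset.mul_sum]
  refine Finset.sum_congr rfl fun d hd => ?_
  have h : ∑ i, d i = N := by
    rw [hF.degree_eq_sum_deg_support hd]
    exact (Finset.sum_subset (Finset.subset_univ _) fun i _ hi => by simpa using hi).symm
  simp only [mul_pow, Finset.prod_mul_distrib, Finset.prod_pow_eq_pow_sum, h]
  ring

theorem evMat_mul_pluckerMap {F : PluckerPoly n K} {N : ℕ} (hF : F.IsHomogeneous N)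
    (X : Matrix (Fin n) (Fin K) B) (u : Matrix (Fin K) (Fin K) B) :
    evMat (X * u) (pluckerMap n K F) = u.det ^ N * evMat X (pluckerMap n K F) := by
  have h (X : Matrix (Fin n) (Fin K) B) : (evMat X).comp (pluckerMap n K) =
      MvPolynomial.aeval fun I : Fin K ↪o Fin n => (X.submatrix I id).det :=
    MvPolynomial.algHom_ext fun I => by
      rw [AlgHom.comp_apply, evMat_pluckerMap_X, MvPolynomial.aeval_X]
  have h1 := DFunLike.congr_fun (h X) F
  have h2 := DFunLike.congr_fun (h (X * u)) F
  rw [AlgHom.comp_apply] at h1 h2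
  rw [h1, h2, ← aeval_mul_of_isHomogeneous hF]
  congr 2
  funext I
  rw [mul_comm, ← Matrix.det_mul]
  congr 1

/-- By Cauchy–Binet the determinant is a linear combination of minors: those with repeated rows
vanish, and sorting the rows of the others changes only a sign. The identity is proved for the
generic matrix and then specialized, so one `l` serves all algebras. -/
theorem exists_linearForm (h : Matrix (Fin K) (Fin n) ℂ) :
    ∃ l : PluckerPoly n K, l.IsHomogeneous 1 ∧ ∀ (B : Type) [CommRing B] [Algebra ℂ B]
      (X : Matrix (Fin n) (Fin K) B),
      evMat X (pluckerMap n K l) = (h.map (algebraMap ℂ B) * X).det := by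
  let V := (MvPolynomial.homogeneousSubmodule (Fin K ↪o Fin n) ℂ 1).map (pluckerMap n K).toLinearMap
  have hφ (φ : Fin K → Fin n) :
      (Matrix.of fun r s => (genMat n K)ᵀ r (φ s)).det ∈ V := by
    by_cases hinj : Function.Injective φ
    · let τ := Tuple.sort φ
      have hmono : StrictMono (φ ∘ τ) :=
        (Tuple.monotone_sort φ).strictMono_of_injective (hinj.comp τ.injective)
      let I : Fin K ↪o Fin n := OrderEmbedding.ofStrictMono _ hmono
      have h1 := Matrix.det_permute' τ (Matrix.of fun r s => (genMat n K)ᵀ r (φ s))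
      have h2 : ((Matrix.of fun r s => (genMat n K)ᵀ r (φ s)).submatrix id τ).det =
          pluckerMap n K (MvPolynomial.X I) := by
        rw [← evMat_genMat (pluckerMap n K (MvPolynomial.X I)), evMat_pluckerMap_X,
          ← Matrix.det_transpose]
        rfl
      have h3 : (Matrix.of fun r s => (genMat n K)ᵀ r (φ s)).det ∈ V := by
        have h4 : pluckerMap n K (MvPolynomial.X I) ∈ V :=
          ⟨_, MvPolynomial.isHomogeneous_X _ _, rfl⟩
        rw [← h2, h1] at h4
        rcases Int.units_eq_one_or (Equiv.Perm.sign τ) with h | h <;> rw [h] at h4 <;>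
          simpa using h4
      exact h3
    · rw [Function.not_injective_iff] at hinj
      obtain ⟨i, j, hij, hne⟩ := hinj
      rw [Matrix.det_zero_of_column_eq hne (by intro a; simp [hij])]
      exact V.zero_mem
  have hV : ((h.map (algebraMap ℂ (MatPoly n K))) * genMat n K).det ∈ V := by
    rw [← Matrix.det_transpose, Matrix.transpose_mul]
    have h1 := det_mul_eq_sum (genMat n K)ᵀ (h.map (algebraMap ℂ (MatPoly n K)))ᵀ
    have h2 : Matrix.of (genMat n K)ᵀ = (genMat n K)ᵀ := rfl
    rw [h2] at h1
    rw [h1]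
    refine Submodule.sum_mem _ fun φ _ => ?_
    simp only [Matrix.transpose_apply, Matrix.map_apply]
    rw [← map_prod, ← Algebra.smul_def]
    exact V.smul_mem _ (hφ φ)
  obtain ⟨l, hl, hl'⟩ := hV
  refine ⟨l, hl, fun B _ _ X => ?_⟩
  have h3 : pluckerMap n K l = _ := hl'
  rw [h3, AlgHom.map_det, AlgHom.mapMatrix_apply, Matrix.map_mul, Matrix.map_map]
  congr 2
  · ext i j; simp
  · ext i j; simp [genMat]

end PluckerForms

/-! ### Affine charts of a subscheme of the Grassmannian as standard opens of `Proj`. -/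

section Charts

variable {n K C : ℕ}

/-- A basis of `ℂⁿ`, given by the columns of `g`, together with its inverse matrix. -/
structure Frame (n K C : ℕ) where
  g : Matrix (Fin n) (Fin K ⊕ Fin C) ℂ
  ginv : Matrix (Fin K ⊕ Fin C) (Fin n) ℂ
  mul_inv : g * ginv = 1
  inv_mul : ginv * g = 1

variable {B : Type*} [CommRing B] [Algebra ℂ B]

/-- The matrix with an identity block on top of `Y`. -/
def oneRows (Y : Matrix (Fin C) (Fin K) B) : Matrix (Fin K ⊕ Fin C) (Fin K) B :=
  Matrix.fromRows 1 Y

/-- The frame `g (1, Y)`. -/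
def Frame.chart (g : Frame n K C) (Y : Matrix (Fin C) (Fin K) B) : Matrix (Fin n) (Fin K) B :=
  g.g.map (algebraMap ℂ B) * oneRows Y

theorem Frame.map_inv_mul (g : Frame n K C) :
    g.ginv.map (algebraMap ℂ B) * g.g.map (algebraMap ℂ B) = 1 := by
  rw [← Matrix.map_mul, g.inv_mul, Matrix.map_one _ (map_zero _) (map_one _)]

theorem Frame.map_mul_inv (g : Frame n K C) :
    g.g.map (algebraMap ℂ B) * g.ginv.map (algebraMap ℂ B) = 1 := by
  rw [← Matrix.map_mul, g.mul_inv, Matrix.map_one _ (map_zero _) (map_one _)]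

theorem Frame.inv_mul_chart (g : Frame n K C) (Y : Matrix (Fin C) (Fin K) B) :
    g.ginv.map (algebraMap ℂ B) * g.chart Y = oneRows Y := by
  rw [Frame.chart, ← Matrix.mul_assoc, g.map_inv_mul, Matrix.one_mul]

theorem Frame.map_chart {B' : Type*} [CommRing B'] [Algebra ℂ B'] (f : B →ₐ[ℂ] B')
    (g : Frame n K C) (Y : Matrix (Fin C) (Fin K) B) : (g.chart Y).map f = g.chart (Y.map f) := by
  rw [Frame.chart, Frame.chart, Matrix.map_mul, Matrix.map_map]
  congr 1
  · ext i j; simp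
  · ext i j
    rcases i with i | i
    · simp [oneRows, Matrix.one_apply, apply_ite f]
    · simp [oneRows]

/-- The coordinate ring of an affine chart of the Grassmannian. -/
abbrev ChartPoly (K C : ℕ) : Type := MvPolynomial (Fin C × Fin K) ℂ

/-- The generic point of an affine chart. -/
def genChart (K C : ℕ) : Matrix (Fin C) (Fin K) (ChartPoly K C) :=
  Matrix.of fun i j => MvPolynomial.X (i, j)

/-- Evaluation at a point of an affine chart. -/
def evChart (Y : Matrix (Fin C) (Fin K) B) : ChartPoly K C →ₐ[ℂ] B :=
  MvPolynomial.aeval fun ij => Y ij.1 ij.2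

theorem evChart_genChart (Y : Matrix (Fin C) (Fin K) B) : (genChart K C).map (evChart Y) = Y := by
  ext i j; simp [genChart, evChart]

/-- The ideal of an affine chart of the subscheme defined by `s`. -/
def chartIdeal (g : Frame n K C) (s : Set (MatPoly n K)) : Ideal (ChartPoly K C) :=
  (Ideal.span s).map (evMat (g.chart (genChart K C)))

/-- The coordinate ring of an affine chart of the subscheme defined by `s`. -/
abbrev ChartRing (g : Frame n K C) (s : Set (MatPoly n K)) : Type :=
  ChartPoly K C ⧸ chartIdeal g s

/-- The rows of the inverse of the basis corresponding to the frame are those of the coordinates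
`I`. -/
def Frame.IsAt (g : Frame n K C) (I : Fin K ↪o Fin n) : Prop :=
  ∀ a r, g.ginv (Sum.inl a) r = if r = I a then 1 else 0

theorem Frame.IsAt.submatrix {g : Frame n K C} {I : Fin K ↪o Fin n} (h : g.IsAt I)
    (X : Matrix (Fin n) (Fin K) B) :
    X.submatrix I id = (g.ginv.map (algebraMap ℂ B) * X).submatrix Sum.inl id := by
  ext a b
  simp [Matrix.mul_apply, h a, apply_ite (algebraMap ℂ B)]

theorem Frame.IsAt.chart {g : Frame n K C} {I : Fin K ↪o Fin n} (h : g.IsAt I)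
    (Y : Matrix (Fin C) (Fin K) B) : (g.chart Y).submatrix I id = 1 := by
  rw [h.submatrix, g.inv_mul_chart]
  rfl

/-- The class of a Plücker coordinate. -/
def pluckerCoord (s : Set (MatPoly n K)) (I : Fin K ↪o Fin n) : CoordRing s :=
  Ideal.Quotient.mk _ (MvPolynomial.X I)

theorem pluckerCoord_mem (s : Set (MatPoly n K)) (I : Fin K ↪o Fin n) :
    pluckerCoord s I ∈ coordGrading s 1 :=
  ⟨_, MvPolynomial.isHomogeneous_X _ _, rfl⟩

theorem mk_mem_coordGrading (s : Set (MatPoly n K)) {F : PluckerPoly n K} {N : ℕ}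
    (hF : F.IsHomogeneous N) : (Ideal.Quotient.mk _ F : CoordRing s) ∈ coordGrading s N :=
  ⟨F, hF, rfl⟩

theorem pluckerMap_mem_span {s : Set (MatPoly n K)} {F : PluckerPoly n K} (hF : F ∈ pluckerIdeal s) :
    pluckerMap n K F ∈ Ideal.span s := by
  have : pluckerIdeal s ≤ (Ideal.span s).comap (pluckerMap n K) := by
    rw [pluckerIdeal, Ideal.span_le]
    exact fun F hF => hF.2
  exact this hF

/-- Evaluation of forms at the points of an affine chart. -/
def coordToChart (g : Frame n K C) (s : Set (MatPoly n K)) : CoordRing s →ₐ[ℂ] ChartRing g s :=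
  Ideal.Quotient.liftₐ (pluckerIdeal s)
    ((Ideal.Quotient.mkₐ ℂ (chartIdeal g s)).comp
      ((evMat (g.chart (genChart K C))).comp (pluckerMap n K)))
    fun _ hF => Ideal.Quotient.eq_zero_iff_mem.2 (Ideal.mem_map_of_mem _ (pluckerMap_mem_span hF))

theorem coordToChart_mk (g : Frame n K C) (s : Set (MatPoly n K)) (F : PluckerPoly n K) :
    coordToChart g s (Ideal.Quotient.mk _ F) =
      Ideal.Quotient.mk _ (evMat (g.chart (genChart K C)) (pluckerMap n K F)) := rfl

variable {g : Frame n K C} {I : Fin K ↪o Fin n} (hg : g.IsAt I) (s : Set (MatPoly n K))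

theorem coordToChart_pluckerCoord (hg : g.IsAt I) : coordToChart g s (pluckerCoord s I) = 1 := by
  rw [pluckerCoord, coordToChart_mk, evMat_pluckerMap_X, hg.chart, Matrix.det_one, map_one]

theorem isUnit_coordToChart (hg : g.IsAt I) :
    IsUnit ((coordToChart g s).toRingHom (pluckerCoord s I)) := by
  change IsUnit (coordToChart g s (pluckerCoord s I))
  rw [coordToChart_pluckerCoord s hg]
  exact isUnit_one

/-- The restriction of functions to an affine chart, as a ring homomorphism. -/
def awayToChartHom : Away (coordGrading s) (pluckerCoord s I) →+* ChartRing g s :=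
  (IsLocalization.Away.lift (S := Localization.Away (pluckerCoord s I)) (pluckerCoord s I)
    (isUnit_coordToChart s hg)).comp
    (algebraMap (Away (coordGrading s) (pluckerCoord s I)) _)

theorem awayToChartHom_eq (x : Away (coordGrading s) (pluckerCoord s I)) (N : ℕ) (a : CoordRing s)
    (h : x.val * algebraMap _ (Localization.Away (pluckerCoord s I)) (pluckerCoord s I) ^ N =
      algebraMap _ _ a) : awayToChartHom hg s x = coordToChart g s a := by
  have h1 := congrArg (IsLocalization.Away.lift (S := Localization.Away (pluckerCoord s I))
    (pluckerCoord s I) (isUnit_coordToChart s hg)) h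
  rw [map_mul, map_pow, IsLocalization.Away.lift_eq, IsLocalization.Away.lift_eq] at h1
  change _ * coordToChart g s _ ^ N = coordToChart g s a at h1
  rw [coordToChart_pluckerCoord s hg, one_pow, mul_one] at h1
  exact h1

/-- The restriction of functions to an affine chart. -/
def awayToChart : Away (coordGrading s) (pluckerCoord s I) →ₐ[ℂ] ChartRing g s where
  __ := awayToChartHom hg s
  commutes' c := by
    refine (awayToChartHom_eq hg s _ 0 (algebraMap ℂ (CoordRing s) c) ?_).trans
      ((coordToChart g s).commutes c)
    rw [pow_zero, mul_one]
    rfl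

theorem awayToChart_eq (x : Away (coordGrading s) (pluckerCoord s I)) (N : ℕ) (a : CoordRing s)
    (h : x.val * algebraMap _ (Localization.Away (pluckerCoord s I)) (pluckerCoord s I) ^ N =
      algebraMap _ _ a) : awayToChart hg s x = coordToChart g s a :=
  awayToChartHom_eq hg s x N a h

theorem awayToChart_mk (N : ℕ) (a : CoordRing s) (ha : a ∈ coordGrading s (N • 1)) :
    awayToChart hg s (Away.mk _ (pluckerCoord_mem s I) N a ha) = coordToChart g s a :=
  awayToChart_eq hg s _ N a (val_mk_mul_pow _ _ _ _ _)

/-- The equations `s` transform by the square of the determinant under a change of frame. -/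
def SemiInvariant (s : Set (MatPoly n K)) : Prop :=
  ∀ f ∈ s, ∀ (B : Type) [CommRing B] [Algebra ℂ B] (X : Matrix (Fin n) (Fin K) B)
    (u : Matrix (Fin K) (Fin K) B), evMat (X * u) f = u.det ^ 2 * evMat X f

theorem exists_chart_eq {L : Type} [CommRing L] [Algebra ℂ L] (g : Frame n K C)
    (X : Matrix (Fin n) (Fin K) L)
    (hu : IsUnit ((g.ginv.map (algebraMap ℂ L) * X).submatrix Sum.inl id).det) :
    ∃ Y : Matrix (Fin C) (Fin K) L,
      X = g.chart Y * (g.ginv.map (algebraMap ℂ L) * X).submatrix Sum.inl id := by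
  let u := (g.ginv.map (algebraMap ℂ L) * X).submatrix Sum.inl id
  let w := (g.ginv.map (algebraMap ℂ L) * X).submatrix Sum.inr id
  refine ⟨w * u⁻¹, ?_⟩
  have h : oneRows (w * u⁻¹) * u = g.ginv.map (algebraMap ℂ L) * X := by
    rw [oneRows, Matrix.fromRows_mul, Matrix.one_mul, Matrix.mul_assoc, Matrix.nonsing_inv_mul _ hu,
      Matrix.mul_one]
    ext i j
    rcases i with i | i <;> rfl
  change X = g.g.map _ * oneRows (w * u⁻¹) * u
  rw [Matrix.mul_assoc, h, ← Matrix.mul_assoc, g.map_mul_inv, Matrix.one_mul]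

/-- After inverting the minor `I`, the generic matrix is `g.chart Y * u` with `det u` a unit.
Semi-invariance makes the equations at `g.chart Y` and at the generic matrix generate the same
ideal, so the form lies in the localized ideal. Clearing denominators costs a power of the minor,
which is itself a Plücker coordinate. -/
theorem exists_pow_mul_mem_span (hs : SemiInvariant s) (hg : g.IsAt I) {F : PluckerPoly n K} {N : ℕ}
    (hF : F.IsHomogeneous N)
    (h : evMat (g.chart (genChart K C)) (pluckerMap n K F) ∈ chartIdeal g s) :
    ∃ M : ℕ, F * MvPolynomial.X I ^ M ∈ pluckerIdeal s := by
  let δ := pluckerMap n K (MvPolynomial.X I)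
  let L := Localization.Away δ
  let α : MatPoly n K →ₐ[ℂ] L := IsScalarTower.toAlgHom ℂ (MatPoly n K) L
  let X := (genMat n K).map α
  have hX (f : MatPoly n K) : evMat X f = α f := by rw [← algHom_evMat, evMat_genMat]
  let u := (g.ginv.map (algebraMap ℂ L) * X).submatrix Sum.inl id
  have hud : u.det = α δ := by
    rw [← hX, evMat_pluckerMap_X, hg.submatrix]
  have hu : IsUnit u.det := by
    rw [hud]
    exact IsLocalization.Away.algebraMap_isUnit δ
  obtain ⟨Y, hY⟩ := exists_chart_eq g X hu
  change X = g.chart Y * u at hY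
  have hch (f : MatPoly n K) : evChart Y (evMat (g.chart (genChart K C)) f) = evMat (g.chart Y) f := by
    rw [algHom_evMat, g.map_chart, evChart_genChart]
  have h1 : evMat (g.chart Y) (pluckerMap n K F) ∈ (Ideal.span s).map (algebraMap _ L) := by
    rw [← hch]
    have h2 : (chartIdeal g s).map (evChart Y) ≤ (Ideal.span s).map (algebraMap _ L) := by
      rw [chartIdeal, Ideal.map_le_iff_le_comap, Ideal.map_le_iff_le_comap, Ideal.span_le]
      intro f hf
      have h3 := hs f hf L (g.chart Y) u
      rw [← hY, hX] at h3
      have h4 : α f ∈ (Ideal.span s).map (algebraMap _ L) :=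
        Ideal.mem_map_of_mem _ (Ideal.subset_span hf)
      rw [h3] at h4
      rw [SetLike.mem_coe, Ideal.mem_comap, Ideal.mem_comap]
      refine ((Ideal.unit_mul_mem_iff_mem _ (hu.pow 2)).1 ?_)
      convert h4 using 2
      exact hch f
    exact h2 (Ideal.mem_map_of_mem _ h)
  have h2 : α (pluckerMap n K F) ∈ (Ideal.span s).map (algebraMap _ L) := by
    rw [← hX, hY, evMat_mul_pluckerMap hF]
    exact Ideal.mul_mem_left _ _ h1
  obtain ⟨⟨⟨a, ha⟩, ⟨_, k, rfl⟩⟩, hk⟩ := (IsLocalization.mem_map_algebraMap_iff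
    (Submonoid.powers δ) L).1 h2
  change algebraMap _ L _ * _ = algebraMap _ L a at hk
  rw [← map_mul] at hk
  obtain ⟨⟨_, l, rfl⟩, hl⟩ := (IsLocalization.eq_iff_exists (Submonoid.powers δ) L).1 hk
  refine ⟨k + l, Ideal.subset_span ⟨⟨_, hF.mul ((MvPolynomial.isHomogeneous_X _ I).pow _)⟩, ?_⟩⟩
  rw [map_mul, map_pow]
  change pluckerMap n K F * δ ^ (k + l) ∈ _
  have h3 : pluckerMap n K F * δ ^ (k + l) = δ ^ l * (pluckerMap n K F * δ ^ k) := by ring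
  rw [h3]
  change δ ^ l * (pluckerMap n K F * δ ^ k) = δ ^ l * a at hl
  rw [hl]
  exact Ideal.mul_mem_left _ _ ha

theorem awayToChart_injective (hs : SemiInvariant s) : Function.Injective (awayToChart hg s) := by
  rw [injective_iff_map_eq_zero]
  intro x hx
  obtain ⟨N, a, ha, rfl⟩ := Away.mk_surjective _ (pluckerCoord_mem s I) x
  rw [awayToChart_mk] at hx
  obtain ⟨F, hF, hFa⟩ := id ha
  change (Ideal.Quotient.mk _ F : CoordRing s) = a at hFa
  rw [← hFa, coordToChart_mk] at hx
  obtain ⟨M, hM⟩ := exists_pow_mul_mem_span s hs hg hF (Ideal.Quotient.eq_zero_iff_mem.1 hx)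
  refine val_injective _ ?_
  have hu := IsLocalization.Away.algebraMap_isUnit (S := Localization.Away (pluckerCoord s I))
    (pluckerCoord s I)
  refine ((hu.pow (N + M)).mul_left_eq_zero.1 ?_).trans val_zero.symm
  rw [pow_add, ← mul_assoc, val_mk_mul_pow, ← map_pow, ← map_mul]
  have h2 : a * pluckerCoord s I ^ M = 0 := by
    have h3 := Ideal.Quotient.eq_zero_iff_mem.2 hM
    rw [map_mul, map_pow, hFa] at h3
    exact h3
  rw [h2, map_zero]

/-- The value of a linear form divided by a Plücker coordinate. -/
def linQuot (s : Set (MatPoly n K)) (I : Fin K ↪o Fin n) (h : Matrix (Fin K) (Fin n) ℂ) :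
    Away (coordGrading s) (pluckerCoord s I) :=
  Away.mk _ (pluckerCoord_mem s I) 1 (Ideal.Quotient.mk _ (exists_linearForm h).choose)
    (mk_mem_coordGrading s (exists_linearForm h).choose_spec.1)

theorem awayToChart_linQuot (h : Matrix (Fin K) (Fin n) ℂ) :
    awayToChart hg s (linQuot s I h) = Ideal.Quotient.mk _
      (h.map (algebraMap ℂ (ChartPoly K C)) * g.chart (genChart K C)).det := by
  rw [linQuot, awayToChart_mk, coordToChart_mk, (exists_linearForm h).choose_spec.2]

/-- The affine coordinate is thereby a linear form in the Plücker coordinates whose value is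
normalized by the minor at `I` being `1`. This gives surjectivity of the restriction to a chart, and
test sections with prescribed equations. -/
theorem det_updateRow_mul_chart (g : Frame n K C) (Y : Matrix (Fin C) (Fin K) B) (c : Fin C)
    (a : Fin K) :
    (((g.ginv.submatrix Sum.inl id).updateRow a (g.ginv (Sum.inr c))).map (algebraMap ℂ B) *
      g.chart Y).det = Y c a := by
  have h : ((g.ginv.submatrix Sum.inl id).updateRow a (g.ginv (Sum.inr c))).map (algebraMap ℂ B) *
      g.chart Y = (1 : Matrix (Fin K) (Fin K) B).updateRow a (Y c) := by
    have h1 := g.inv_mul_chart Y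
    ext i j
    by_cases hi : i = a
    · subst hi
      have h2 := congrFun (congrFun h1 (Sum.inr c)) j
      simp only [Matrix.mul_apply, Matrix.map_apply, Matrix.updateRow_self] at h2 ⊢
      exact h2
    · have h2 := congrFun (congrFun h1 (Sum.inl i)) j
      simp only [Matrix.mul_apply, Matrix.map_apply, Matrix.updateRow_ne hi] at h2 ⊢
      exact h2
  rw [h]
  rw [← Matrix.cramer_transpose_apply, Matrix.transpose_one, Matrix.cramer_one]
  rfl

theorem awayToChart_surjective : Function.Surjective (awayToChart hg s) := by
  rw [← AlgHom.range_eq_top]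
  have h : (Ideal.Quotient.mkₐ ℂ (chartIdeal g s)).range ≤ (awayToChart hg s).range := by
    rw [← Algebra.map_top, ← MvPolynomial.adjoin_range_X, AlgHom.map_adjoin, Algebra.adjoin_le_iff]
    rintro _ ⟨_, ⟨⟨c, a⟩, rfl⟩, rfl⟩
    refine ⟨linQuot s I ((g.ginv.submatrix Sum.inl id).updateRow a (g.ginv (Sum.inr c))), ?_⟩
    change awayToChart hg s _ = _
    rw [awayToChart_linQuot, det_updateRow_mul_chart]
    rfl
  rw [← top_le_iff]
  refine le_trans ?_ h
  rintro x -
  exact Ideal.Quotient.mk_surjective x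

/-- The affine chart as a standard open subset of `Proj`. -/
def chartEquiv (hs : SemiInvariant s) :
    Away (coordGrading s) (pluckerCoord s I) ≃ₐ[ℂ] ChartRing g s :=
  AlgEquiv.ofBijective (awayToChart hg s) ⟨awayToChart_injective hg s hs, awayToChart_surjective hg s⟩

end Charts

/-! ### First order deformations and the Jacobian matrix of a change of charts. -/

section Infinitesimal

variable {K C : ℕ} {R : Type} [CommRing R] [Algebra ℂ R]

/-- First order infinitesimal deformations in all coordinate directions. -/
abbrev Jet (K C : ℕ) (R : Type) : Type := TrivSqZeroExt R (Fin C × Fin K → R)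

/-- The first order Taylor formula. The square-zero ideal has one copy of `R` for each coordinate,
so all directional derivatives are carried along simultaneously. -/
theorem evChart_add_inr (Y : Matrix (Fin C) (Fin K) R) (V : Fin C × Fin K → Fin C × Fin K → R)
    (Y' : Matrix (Fin C) (Fin K) (Jet K C R))
    (hY : ∀ c a, Y' c a = TrivSqZeroExt.inl (Y c a) + TrivSqZeroExt.inr (V (c, a)))
    (G : ChartPoly K C) :
    evChart Y' G = TrivSqZeroExt.inl (evChart Y G) +
      TrivSqZeroExt.inr (∑ l, evChart Y (MvPolynomial.pderiv l G) • V l) := by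
  induction G using MvPolynomial.induction_on with
  | C z =>
    simp [evChart]
    rfl
  | add p q hp hq =>
    simp only [map_add, hp, hq, TrivSqZeroExt.inl_add, add_smul, Finset.sum_add_distrib,
      TrivSqZeroExt.inr_add]
    abel
  | mul_X p l hp =>
    have h1 : evChart Y' (MvPolynomial.X l) = TrivSqZeroExt.inl (evChart Y (MvPolynomial.X l)) +
      TrivSqZeroExt.inr (V l) := by
      simp [evChart, hY]
    rw [map_mul, hp, h1]
    refine TrivSqZeroExt.ext ?_ ?_
    · simp
    · simp only [TrivSqZeroExt.snd_mul, TrivSqZeroExt.fst_add, TrivSqZeroExt.fst_inl,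
        TrivSqZeroExt.fst_inr, add_zero, TrivSqZeroExt.snd_add, TrivSqZeroExt.snd_inl,
        TrivSqZeroExt.snd_inr, zero_add, Derivation.leibniz, map_add, smul_eq_mul, map_mul,
        add_smul, Finset.sum_add_distrib, op_smul_eq_smul, MvPolynomial.pderiv_X]
      congr 1
      · rw [Finset.sum_eq_single l]
        · simp
        · intro b _ hb
          simp [Pi.single_eq_of_ne' hb]
        · simp
      · simp only [mul_smul, Finset.smul_sum]

section Jet

variable {a b c : Type} [Fintype b]

/-- The constant term of a matrix of jets. -/
def matFst (M : Matrix a b (Jet K C R)) : Matrix a b R := Matrix.of fun i j => (M i j).fst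

/-- A directional derivative of a matrix of jets. -/
def matSnd (l : Fin C × Fin K) (M : Matrix a b (Jet K C R)) : Matrix a b R :=
  Matrix.of fun i j => (M i j).snd l

theorem matFst_add (M N : Matrix a b (Jet K C R)) : matFst (M + N) = matFst M + matFst N := by
  ext i j; simp [matFst]

theorem matSnd_add (l) (M N : Matrix a b (Jet K C R)) :
    matSnd l (M + N) = matSnd l M + matSnd l N := by
  ext i j; simp [matSnd]

theorem matFst_mul (M : Matrix a b (Jet K C R)) (N : Matrix b c (Jet K C R)) :
    matFst (M * N) = matFst M * matFst N := by
  ext i j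
  simp [matFst, Matrix.mul_apply, TrivSqZeroExt.fst_sum]

theorem matSnd_mul (l) (M : Matrix a b (Jet K C R)) (N : Matrix b c (Jet K C R)) :
    matSnd l (M * N) = matFst M * matSnd l N + matSnd l M * matFst N := by
  ext i j
  simp [matFst, matSnd, Matrix.mul_apply, TrivSqZeroExt.snd_sum, Finset.sum_add_distrib, mul_comm]

theorem matFst_map (M : Matrix a b ℂ) :
    matFst (M.map (algebraMap ℂ (Jet K C R))) = M.map (algebraMap ℂ R) := by
  ext i j
  exact TrivSqZeroExt.fst_inl (Fin C × Fin K → R) (algebraMap ℂ R (M i j))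

theorem matSnd_map (l) (M : Matrix a b ℂ) :
    matSnd l (M.map (algebraMap ℂ (Jet K C R))) = 0 := by
  ext i j
  change (TrivSqZeroExt.inl (algebraMap ℂ R (M i j)) : Jet K C R).snd l = (0 : R)
  rw [TrivSqZeroExt.snd_inl (Fin C × Fin K → R)]
  rfl

theorem mat_ext {M N : Matrix a b (Jet K C R)} (h : matFst M = matFst N)
    (h' : ∀ l, matSnd l M = matSnd l N) : M = N := by
  exact Matrix.ext fun i j => TrivSqZeroExt.ext (congrFun (congrFun h i) j)
    (funext fun l => congrFun (congrFun (h' l) i) j)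

end Jet

theorem oneRows_apply_inl {B : Type*} [CommRing B] (Y : Matrix (Fin C) (Fin K) B) (a b : Fin K) :
    oneRows Y (Sum.inl a) b = (1 : Matrix (Fin K) (Fin K) B) a b := rfl

theorem mul_oneRows {B m : Type*} [CommRing B] (D : Matrix m (Fin K ⊕ Fin C) B)
    (Y : Matrix (Fin C) (Fin K) B) :
    D * oneRows Y = D.submatrix id Sum.inl + D.submatrix id Sum.inr * Y := by
  ext i j
  simp [Matrix.mul_apply, oneRows, Matrix.one_apply]

theorem oneRows_mul_eq_iff {B : Type*} [CommRing B] (D : Matrix (Fin K ⊕ Fin C) (Fin K ⊕ Fin C) B)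
    (Y Y' : Matrix (Fin C) (Fin K) B) (u : Matrix (Fin K) (Fin K) B) :
    D * oneRows Y = oneRows Y' * u ↔
      D.toBlocks₁₁ + D.toBlocks₁₂ * Y = u ∧ D.toBlocks₂₁ + D.toBlocks₂₂ * Y = Y' * u := by
  rw [mul_oneRows, oneRows, Matrix.fromRows_mul, Matrix.one_mul]
  constructor
  · intro h
    exact ⟨Matrix.ext fun i j => congrFun (congrFun h (Sum.inl i)) j,
      Matrix.ext fun i j => congrFun (congrFun h (Sum.inr i)) j⟩
  · rintro ⟨rfl, h2⟩
    ext i j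
    rcases i with i | i
    · rfl
    · exact congrFun (congrFun h2 i) j

/-- The matrix by which the differentials of affine coordinates transform, up to the change of
frame. -/
def transL {B : Type*} [CommRing B] (D : Matrix (Fin K ⊕ Fin C) (Fin K ⊕ Fin C) B)
    (Y' : Matrix (Fin C) (Fin K) B) : Matrix (Fin C) (Fin C) B :=
  D.toBlocks₂₂ - Y' * D.toBlocks₁₂

/-- Completing both frames to square unipotent matrices turns the change of charts into a block
triangular matrix with diagonal blocks `u` and `transL D Y'`. -/
theorem det_mul_det_transL {B : Type*} [CommRing B]
    (D : Matrix (Fin K ⊕ Fin C) (Fin K ⊕ Fin C) B)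
    {Y Y' : Matrix (Fin C) (Fin K) B} {u : Matrix (Fin K) (Fin K) B}
    (h : D * oneRows Y = oneRows Y' * u) : u.det * (transL D Y').det = D.det := by
  obtain ⟨h1, h2⟩ := (oneRows_mul_eq_iff D Y Y' u).1 h
  have h3 : D * Matrix.fromBlocks 1 0 Y 1 =
      Matrix.fromBlocks 1 0 Y' 1 * Matrix.fromBlocks u D.toBlocks₁₂ 0 (transL D Y') := by
    conv_lhs => rw [← D.fromBlocks_toBlocks]
    simp only [Matrix.fromBlocks_multiply, Matrix.mul_one, Matrix.mul_zero, Matrix.one_mul,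
      Matrix.zero_mul, add_zero, zero_add, h1, h2, transL]
    congr 1
    abel
  have h4 := congrArg Matrix.det h3
  rw [Matrix.det_mul, Matrix.det_mul, Matrix.det_fromBlocks_zero₁₂, Matrix.det_fromBlocks_zero₁₂,
    Matrix.det_fromBlocks_zero₂₁] at h4
  simpa using h4.symm

/-- The Jacobian matrix of a change of affine charts. -/
def transJac {B : Type*} [CommRing B] (D : Matrix (Fin K ⊕ Fin C) (Fin K ⊕ Fin C) B)
    (Y' : Matrix (Fin C) (Fin K) B) (v : Matrix (Fin K) (Fin K) B) :
    Matrix (Fin C × Fin K) (Fin C × Fin K) B :=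
  Matrix.kroneckerMap (· * ·) (transL D Y') vᵀ

theorem det_transJac {B : Type*} [CommRing B] (D : Matrix (Fin K ⊕ Fin C) (Fin K ⊕ Fin C) B)
    (Y' : Matrix (Fin C) (Fin K) B) (v : Matrix (Fin K) (Fin K) B) :
    (transJac D Y' v).det = (transL D Y').det ^ K * v.det ^ C := by
  rw [transJac, Matrix.det_kronecker]
  simp

/-- Differentiate the upper and lower blocks of the change of charts. Eliminating `du` leaves `dY' *
u = (δ₂₂ - Y' δ₁₂) dY`, to be multiplied by `v = u⁻¹` on the right. -/
theorem transJac_deriv {M : Type*} [AddCommGroup M] [Module R M] [Module ℂ M] [IsScalarTower ℂ R M]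
    (d : Derivation ℂ R M)
    (δ : Matrix (Fin K ⊕ Fin C) (Fin K ⊕ Fin C) ℂ) {Y Y' : Matrix (Fin C) (Fin K) R}
    {u v : Matrix (Fin K) (Fin K) R} (huv : u * v = 1)
    (h : δ.map (algebraMap ℂ R) * oneRows Y = oneRows Y' * u) (l : Fin C × Fin K) :
    d (Y' l.1 l.2) = ∑ m, transJac (δ.map (algebraMap ℂ R)) Y' v l m • d (Y m.1 m.2) := by
  obtain ⟨h1, h2⟩ := (oneRows_mul_eq_iff _ Y Y' u).1 h
  have hu (b a : Fin K) : d (u b a) =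
      ∑ c, algebraMap ℂ R (δ (Sum.inl b) (Sum.inr c)) • d (Y c a) := by
    rw [← h1]
    simp only [Matrix.add_apply, Matrix.mul_apply, map_add, map_sum, Derivation.leibniz,
      Matrix.toBlocks₁₁, Matrix.toBlocks₁₂, Matrix.of_apply, Matrix.map_apply,
      Derivation.map_algebraMap, smul_zero, add_zero, zero_add]
  have hw (c : Fin C) (a : Fin K) : d ((Y' * u) c a) =
      ∑ c', algebraMap ℂ R (δ (Sum.inr c) (Sum.inr c')) • d (Y c' a) := by
    rw [← h2]
    simp only [Matrix.add_apply, Matrix.mul_apply, map_add, map_sum, Derivation.leibniz,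
      Matrix.toBlocks₂₁, Matrix.toBlocks₂₂, Matrix.of_apply, Matrix.map_apply,
      Derivation.map_algebraMap, smul_zero, add_zero, zero_add]
  have hL (c : Fin C) (a : Fin K) : ∑ b, u b a • d (Y' c b) =
      ∑ c', transL (δ.map (algebraMap ℂ R)) Y' c c' • d (Y c' a) := by
    have h3 := hw c a
    simp only [Matrix.mul_apply, map_sum, Derivation.leibniz, hu, Finset.sum_add_distrib] at h3
    rw [add_comm, ← eq_sub_iff_add_eq] at h3
    rw [h3]
    simp only [transL, Matrix.sub_apply, Matrix.mul_apply, sub_smul, Finset.sum_sub_distrib,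
      Finset.smul_sum, Finset.sum_smul, smul_smul]
    congr 1
    exact Finset.sum_comm
  obtain ⟨c, a⟩ := l
  calc d (Y' c a) = ∑ b, (u * v) b a • d (Y' c b) := by
        rw [huv]; simp [Matrix.one_apply, ite_smul]
    _ = ∑ a', v a' a • ∑ b, u b a' • d (Y' c b) := by
        simp only [Matrix.mul_apply, Finset.sum_smul, Finset.smul_sum, smul_smul]
        rw [Finset.sum_comm]
        exact Finset.sum_congr rfl fun _ _ => Finset.sum_congr rfl fun _ _ => by rw [mul_comm]
    _ = _ := by
        simp only [hL, Finset.smul_sum, smul_smul, Fintype.sum_prod_type]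
        rw [Finset.sum_comm]
        exact Finset.sum_congr rfl fun _ _ => Finset.sum_congr rfl fun _ _ => by
          rw [mul_comm]; rfl

/-- An infinitesimal deformation of `Y` in the directions `V`. -/
def deform (Y : Matrix (Fin C) (Fin K) R)
    (V : Matrix (Fin C × Fin K) (Fin C × Fin K) R) : Matrix (Fin C) (Fin K) (Jet K C R) :=
  Matrix.of fun c a => TrivSqZeroExt.inl (Y c a) + TrivSqZeroExt.inr (V (c, a))

theorem matFst_deform (Y : Matrix (Fin C) (Fin K) R)
    (V : Matrix (Fin C × Fin K) (Fin C × Fin K) R) : matFst (deform Y V) = Y := by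
  ext i j
  simp [deform, matFst]

theorem matSnd_deform (Y : Matrix (Fin C) (Fin K) R)
    (V : Matrix (Fin C × Fin K) (Fin C × Fin K) R) (l) :
    matSnd l (deform Y V) = Matrix.of fun c a => V (c, a) l := by
  ext i j
  simp [deform, matSnd]

theorem transJac_eq (D : Matrix (Fin K ⊕ Fin C) (Fin K ⊕ Fin C) R)
    (Y' : Matrix (Fin C) (Fin K) R) (v : Matrix (Fin K) (Fin K) R) (l : Fin C × Fin K) :
    (Matrix.of fun c a => transJac D Y' v (c, a) l) = transL D Y' *
      (Matrix.of fun c a => (1 : Matrix (Fin C × Fin K) (Fin C × Fin K) R) (c, a) l) * v := by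
  obtain ⟨c', a'⟩ := l
  ext c a
  simp [transJac, Matrix.mul_apply, Matrix.one_apply, ite_and]

/-- The computation of `transJac_deriv` in integrated form: deforming `Y` in all coordinate
directions deforms `Y'` by the Jacobian matrix, with a correspondingly deformed change of frame `U`.
-/
theorem exists_deform_transition (δ : Matrix (Fin K ⊕ Fin C) (Fin K ⊕ Fin C) ℂ)
    {Y Y' : Matrix (Fin C) (Fin K) R} {u v : Matrix (Fin K) (Fin K) R} (hvu : v * u = 1)
    (h : δ.map (algebraMap ℂ R) * oneRows Y = oneRows Y' * u) :
    ∃ U : Matrix (Fin K) (Fin K) (Jet K C R),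
      matFst U = u ∧ δ.map (algebraMap ℂ (Jet K C R)) * oneRows (deform Y 1) =
        oneRows (deform Y' (transJac (δ.map (algebraMap ℂ R)) Y' v)) * U := by
  obtain ⟨h1, h2⟩ := (oneRows_mul_eq_iff _ Y Y' u).1 h
  let δ' (M : Matrix (Fin K ⊕ Fin C) (Fin K ⊕ Fin C) ℂ) := M.map (algebraMap ℂ (Jet K C R))
  let U := δ.toBlocks₁₁.map (algebraMap ℂ (Jet K C R)) +
    δ.toBlocks₁₂.map (algebraMap ℂ (Jet K C R)) * deform Y 1
  have hU1 : matFst U = u := by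
    rw [matFst_add, matFst_mul, matFst_deform, matFst_map, matFst_map]
    exact h1
  refine ⟨U, hU1, ?_⟩
  have h3 : δ.toBlocks₂₁.map (algebraMap ℂ (Jet K C R)) +
      δ.toBlocks₂₂.map (algebraMap ℂ (Jet K C R)) * deform Y 1 =
        deform Y' (transJac (δ.map (algebraMap ℂ R)) Y' v) * U := by
    refine mat_ext ?_ fun l => ?_
    · rw [matFst_add, matFst_mul, matFst_mul, hU1, matFst_deform, matFst_deform, matFst_map,
        matFst_map]
      exact h2
    · rw [matSnd_add, matSnd_mul, matSnd_mul, hU1, matFst_deform, matFst_deform, matSnd_map,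
        matSnd_map, matSnd_add, matSnd_mul, matSnd_map, matSnd_map, matFst_map, matFst_map,
        matSnd_deform, matSnd_deform, transJac_eq, Matrix.mul_assoc (_ * _) v u, hvu, transL]
      simp only [zero_add, Matrix.zero_mul, add_zero, Matrix.mul_one, Matrix.sub_mul,
        Matrix.mul_assoc]
      exact (add_sub_cancel _ _).symm
  exact (oneRows_mul_eq_iff (δ.map (algebraMap ℂ (Jet K C R))) _ _ _).2 ⟨rfl, h3⟩

theorem isUnit_det_of_matFst (U : Matrix (Fin K) (Fin K) (Jet K C R)) (h : IsUnit (matFst U).det) :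
    IsUnit U.det := by
  rw [TrivSqZeroExt.isUnit_iff_isUnit_fst]
  convert h
  exact RingHom.map_det (TrivSqZeroExt.fstHom R R (Fin C × Fin K → R)).toRingHom U

end Infinitesimal

/-! ### Transformation of equations and of their Jacobian matrices between charts. -/

section Transition

variable {n K C c : ℕ}

/-- The polynomials `F g` are equations, on the affine chart with frame `g`, of the subscheme
defined by `s`, with a prescribed behaviour under a change of chart. -/
structure ChartEquations (s : Set (MatPoly n K)) (F : Frame n K C → Fin c → ChartPoly K C) :
    Prop where
  semiInvariant : SemiInvariant s
  span_eq : ∀ g, chartIdeal g s = Ideal.span (Set.range (F g))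
  transition : ∀ g g' : Frame n K C, (g'.ginv * g.g).det = 1 →
    ∀ (B : Type) [CommRing B] [Algebra ℂ B] (Y Y' : Matrix (Fin C) (Fin K) B)
      (u : Matrix (Fin K) (Fin K) B), IsUnit u.det → g.chart Y = g'.chart Y' * u →
      ∃ T : Matrix (Fin c) (Fin c) B, T.det * u.det = u.det ^ (2 * c) ∧
        (fun r => evChart Y (F g r)) = T *ᵥ fun r => evChart Y' (F g' r)

theorem chart_eq_iff {B : Type} [CommRing B] [Algebra ℂ B] (g g' : Frame n K C)
    (Y Y' : Matrix (Fin C) (Fin K) B) (u : Matrix (Fin K) (Fin K) B) :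
    g.chart Y = g'.chart Y' * u ↔
      (g'.ginv * g.g).map (algebraMap ℂ B) * oneRows Y = oneRows Y' * u := by
  rw [Matrix.map_mul, Matrix.mul_assoc]
  have hc : g.g.map (algebraMap ℂ B) * oneRows Y = g.chart Y := rfl
  rw [hc]
  constructor
  · intro h
    rw [h, ← Matrix.mul_assoc, g'.inv_mul_chart]
  · intro h
    have h1 := congrArg (fun M => g'.g.map (algebraMap ℂ B) * M) h
    simp only [← Matrix.mul_assoc, g'.map_mul_inv, Matrix.one_mul] at h1
    exact h1

/-- The transition rule holds over every algebra, in particular over the jets; its first order part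
is the assertion. The derivative of the matrix `T` drops out because it multiplies equations that
vanish at `Y'`. -/
theorem ChartEquations.jacobian_transition {s : Set (MatPoly n K)}
    {F : Frame n K C → Fin c → ChartPoly K C} (hF : ChartEquations s F) {g g' : Frame n K C}
    (hg : (g'.ginv * g.g).det = 1) {R : Type} [CommRing R] [Algebra ℂ R]
    {Y Y' : Matrix (Fin C) (Fin K) R} {u : Matrix (Fin K) (Fin K) R} (hu : IsUnit u.det)
    (h : g.chart Y = g'.chart Y' * u) (hF' : ∀ r, evChart Y' (F g' r) = 0) :
    ∃ T : Matrix (Fin c) (Fin c) R, T.det * u.det = u.det ^ (2 * c) ∧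
      (Matrix.of fun r l => evChart Y (MvPolynomial.pderiv l (F g r))) =
        T * (Matrix.of fun r l => evChart Y' (MvPolynomial.pderiv l (F g' r))) *
          transJac ((g'.ginv * g.g).map (algebraMap ℂ R)) Y' u⁻¹ := by
  rw [chart_eq_iff] at h
  obtain ⟨U, hU, hU'⟩ := exists_deform_transition (g'.ginv * g.g) (Matrix.nonsing_inv_mul u hu) h
  set J := transJac ((g'.ginv * g.g).map (algebraMap ℂ R)) Y' u⁻¹ with hJ
  have hu' : IsUnit U.det := isUnit_det_of_matFst U (by rwa [hU])
  obtain ⟨T, hT, hT'⟩ := hF.transition g g' hg (Jet K C R) _ _ U hu' ((chart_eq_iff g g' _ _ U).2 hU')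
  have hdet {m : ℕ} (M : Matrix (Fin m) (Fin m) (Jet K C R)) : (M.det).fst = (matFst M).det :=
    RingHom.map_det (TrivSqZeroExt.fstHom R R (Fin C × Fin K → R)).toRingHom M
  refine ⟨matFst T, ?_, ?_⟩
  · have h1 := congrArg TrivSqZeroExt.fst hT
    rw [TrivSqZeroExt.fst_mul, TrivSqZeroExt.fst_pow, hdet, hdet, hU] at h1
    exact h1
  · have hY := evChart_add_inr Y (fun l => (1 : Matrix (Fin C × Fin K) (Fin C × Fin K) R) l)
      (deform Y 1) (fun c a => rfl)
    have hY' := evChart_add_inr Y' (fun l => J l) (deform Y' J) (fun c a => rfl)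
    ext r l
    have h2 := congrArg (fun x : Jet K C R => x.snd l) (congrFun hT' r)
    simp only [hY, hY', Matrix.mulVec, dotProduct, TrivSqZeroExt.snd_sum, TrivSqZeroExt.snd_mul,
      TrivSqZeroExt.snd_add, TrivSqZeroExt.snd_inl, TrivSqZeroExt.snd_inr, TrivSqZeroExt.fst_add,
      TrivSqZeroExt.fst_inl, TrivSqZeroExt.fst_inr, hF', zero_add, add_zero, Finset.sum_apply,
      Pi.smul_apply, Pi.add_apply, smul_eq_mul, MulOpposite.op_zero, zero_smul] at h2
    simp only [Matrix.one_apply, mul_ite, mul_one, mul_zero, Finset.sum_ite_eq', Finset.mem_univ,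
      if_true] at h2
    rw [Pi.zero_apply, zero_add] at h2
    rw [Matrix.of_apply, h2, Matrix.mul_assoc]
    simp only [Matrix.mul_apply, Matrix.of_apply, matFst]

end Transition

/-! ### Differentials of a quotient of a polynomial ring. -/

section CompleteIntersection

variable {σ : Type} [Fintype σ] {c : ℕ} {Q : Type} [CommRing Q] [Algebra ℂ Q]

theorem D_eq_sum (π : MvPolynomial σ ℂ →ₐ[ℂ] Q) (p : MvPolynomial σ ℂ) :
    KaehlerDifferential.D ℂ Q (π p) =
      ∑ l, π (MvPolynomial.pderiv l p) • KaehlerDifferential.D ℂ Q (π (MvPolynomial.X l)) := by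
  classical
  induction p using MvPolynomial.induction_on with
  | C z =>
    simp only [MvPolynomial.pderiv_C, map_zero, zero_smul, Finset.sum_const_zero]
    rw [← MvPolynomial.algebraMap_eq, AlgHom.commutes]
    exact (KaehlerDifferential.D ℂ Q).map_algebraMap z
  | add p q hp hq => simp only [map_add, hp, hq, add_smul, Finset.sum_add_distrib]
  | mul_X p l hp =>
    simp only [map_mul, Derivation.leibniz, hp, map_add, smul_eq_mul, MvPolynomial.pderiv_X, add_smul,
      Finset.sum_add_distrib, mul_smul, Finset.smul_sum]
    congr 1
    rw [Finset.sum_eq_single l]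
    · simp
    · intro b _ hb
      simp [Pi.single_eq_of_ne' hb]
    · simp

theorem exists_derivation_of_surjective {M : Type} [AddCommGroup M] [Module Q M]
    [Module ℂ M] [IsScalarTower ℂ Q M] (π : MvPolynomial σ ℂ →ₐ[ℂ] Q)
    (hπ : Function.Surjective π) (q : (σ → Q) →ₗ[Q] M)
    (h0 : ∀ p, π p = 0 → q (fun l => π (MvPolynomial.pderiv l p)) = 0) :
    ∃ D : Derivation ℂ Q M, ∀ p, D (π p) = q fun l => π (MvPolynomial.pderiv l p) := by
  let δ (p : MvPolynomial σ ℂ) : M := q fun l => π (MvPolynomial.pderiv l p)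
  have hadd (p p') : δ (p + p') = δ p + δ p' := by
    simp only [δ, map_add]
    exact map_add q _ _
  have hmul (p p') : δ (p * p') = π p • δ p' + π p' • δ p := by
    simp only [δ]
    rw [← map_smul, ← map_smul, ← map_add]
    congr 1
    funext l
    simp
  have hC (z : ℂ) : δ (algebraMap ℂ _ z) = 0 := by
    simp only [δ, MvPolynomial.algebraMap_eq, MvPolynomial.pderiv_C, map_zero]
    exact map_zero q
  have hwell (p p' : MvPolynomial σ ℂ) (h : π p = π p') : δ p = δ p' := by
    have h1 : δ (p - p') = 0 := h0 _ (by rw [map_sub, h, sub_self])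
    have h2 := hadd (p - p') p'
    rwa [sub_add_cancel, h1, zero_add] at h2
  let Δ (a : Q) : M := δ (Function.surjInv hπ a)
  have hΔ (p) : Δ (π p) = δ p := hwell _ _ (Function.surjInv_eq hπ _)
  have hΔmul (a b : Q) : Δ (a * b) = a • Δ b + b • Δ a := by
    obtain ⟨p, rfl⟩ := hπ a
    obtain ⟨p', rfl⟩ := hπ b
    rw [← map_mul, hΔ, hΔ, hΔ, hmul]
  refine ⟨Derivation.mk' { toFun := Δ, map_add' := fun a b => ?_, map_smul' := fun z a => ?_ } hΔmul,
    hΔ⟩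
  · obtain ⟨p, rfl⟩ := hπ a
    obtain ⟨p', rfl⟩ := hπ b
    rw [← map_add, hΔ, hΔ, hΔ, hadd]
  · rw [Algebra.smul_def, hΔmul, ← π.commutes, hΔ, hC, smul_zero, add_zero, RingHom.id_apply,
      π.commutes, algebraMap_smul]

/-- The gradient modulo the rows of the Jacobian matrix is a well defined derivation on the quotient
ring. It factors through the Kähler differentials, so a relation among the `dX_l` must lie in the
span of these rows. -/
theorem isCoord_of_surjective (F : Fin c → MvPolynomial σ ℂ) (π : MvPolynomial σ ℂ →ₐ[ℂ] Q)
    (hπ : Function.Surjective π) (hker : RingHom.ker π = Ideal.span (Set.range F))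
    (hB : ∃ B : Matrix σ (Fin c) Q,
      (Matrix.of fun r l => π (MvPolynomial.pderiv l (F r))) * B = 1) :
    IsCoord (fun l => π (MvPolynomial.X l)) fun r l => π (MvPolynomial.pderiv l (F r)) := by
  classical
  have hF (r) : π (F r) = 0 := by
    rw [← RingHom.mem_ker, hker]
    exact Ideal.subset_span ⟨r, rfl⟩
  refine ⟨?_, fun v => ⟨fun hv => ?_, fun hv => ?_⟩, hB⟩
  · rw [eq_top_iff, ← KaehlerDifferential.span_range_derivation, Submodule.span_le]
    rintro _ ⟨x, rfl⟩
    obtain ⟨p, rfl⟩ := hπ x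
    rw [D_eq_sum]
    exact Submodule.sum_mem _ fun l _ => Submodule.smul_mem _ _ (Submodule.subset_span ⟨l, rfl⟩)
  · let S : Submodule Q (σ → Q) :=
      Submodule.span Q (Set.range fun r l => π (MvPolynomial.pderiv l (F r)))
    obtain ⟨D, hD⟩ := exists_derivation_of_surjective π hπ S.mkQ (by
      intro p hp
      have hp' : p ∈ Ideal.span (Set.range F) := hker ▸ hp
      obtain ⟨a, rfl⟩ := Ideal.mem_span_range_iff_exists_fun.1 hp'
      refine (Submodule.Quotient.mk_eq_zero _).2 ?_
      have h1 : (fun l => π (MvPolynomial.pderiv l (∑ i, a i * F i))) =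
          ∑ i, π (a i) • fun l => π (MvPolynomial.pderiv l (F i)) := by
        funext l
        simp [hF, Finset.sum_apply]
      rw [h1]
      exact Submodule.sum_mem _ fun i _ => Submodule.smul_mem _ _ (Submodule.subset_span ⟨i, rfl⟩))
    have h1 := congrArg D.liftKaehlerDifferential hv
    simp only [map_sum, map_smul, Derivation.liftKaehlerDifferential_comp_D, map_zero] at h1
    have h2 (l) : D (π (MvPolynomial.X l)) = S.mkQ (Pi.single l 1) := by
      rw [hD]
      congr 1
      funext l'
      by_cases h : l = l'
      · subst h; simp
      · simp [MvPolynomial.pderiv_X, Pi.single_eq_of_ne h, Pi.single_eq_of_ne' h]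
    simp only [h2, ← map_smul, ← map_sum] at h1
    have h3 : ∑ l, v l • (Pi.single l 1 : σ → Q) = v := by
      funext l
      simp [Finset.sum_apply, Pi.single_apply]
    rw [h3] at h1
    exact (Submodule.Quotient.mk_eq_zero _).1 h1
  · induction hv using Submodule.span_induction with
    | mem x hx =>
      obtain ⟨r, rfl⟩ := hx
      rw [← D_eq_sum, hF, map_zero]
    | zero => simp
    | add x y _ _ h1 h2 => simp only [Pi.add_apply, add_smul, Finset.sum_add_distrib, h1, h2, add_zero]
    | smul a x _ h => simp only [Pi.smul_apply, smul_eq_mul, mul_smul, ← Finset.smul_sum, h, smul_zero]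

end CompleteIntersection

/-! ### Bases adapted to the coordinate charts. -/

section Frames

theorem exists_equiv_inl_eq {K C n : ℕ} (hn : K + C = n) (I : Fin K ↪o Fin n) :
    ∃ τ : Fin K ⊕ Fin C ≃ Fin n, ∀ a, τ (Sum.inl a) = I a := by
  have hcard : Fintype.card (Fin C) = Fintype.card ((Set.range I)ᶜ : Set (Fin n)) := by
    rw [Fintype.card_compl_set]
    simp [Set.card_range_of_injective I.injective]
    omega
  let e := Fintype.equivOfCardEq hcard
  refine ⟨(Equiv.sumCongr (Equiv.ofInjective I I.injective) e).trans (Equiv.Set.sumCompl _), ?_⟩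
  intro a
  simp

/-- A basis is normalized if its determinant is one. -/
def Frame.IsNormalized {n K C : ℕ} (g : Frame n K C) (e : Fin K ⊕ Fin C ≃ Fin n) : Prop :=
  (g.g.submatrix e id).det = 1

theorem Frame.IsNormalized.det_eq_one {n K C : ℕ} {g g' : Frame n K C} {e : Fin K ⊕ Fin C ≃ Fin n}
    (hg : g.IsNormalized e) (hg' : g'.IsNormalized e) : (g'.ginv * g.g).det = 1 := by
  have h (g : Frame n K C) : (g'.ginv * g.g).det =
      (g'.ginv.submatrix id e).det * (g.g.submatrix e id).det := by
    rw [← Matrix.det_mul, Matrix.submatrix_mul_equiv, Matrix.submatrix_id_id]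
  have h1 := h g'
  rw [g'.inv_mul, Matrix.det_one, hg', mul_one] at h1
  rw [h g, hg, ← h1, one_mul]

/-- Start from a permutation matrix and rescale one complementary basis vector to make the
determinant `1`; this needs `0 < C`. With all bases normalized, the cocycles are exact powers of
`det u`, with no stray constants. -/
theorem exists_frame {K C n : ℕ} (hC : 0 < C) (e : Fin K ⊕ Fin C ≃ Fin n) (I : Fin K ↪o Fin n) :
    ∃ g : Frame n K C, g.IsAt I ∧ g.IsNormalized e := by
  obtain ⟨τ, hτ⟩ := exists_equiv_inl_eq (C := C) (by simpa using Fintype.card_congr e) I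
  let g₀ : Matrix (Fin n) (Fin K ⊕ Fin C) ℂ := Matrix.of fun r x => if τ x = r then 1 else 0
  let h₀ : Matrix (Fin K ⊕ Fin C) (Fin n) ℂ := Matrix.of fun x r => if τ x = r then 1 else 0
  have h1 : g₀ * h₀ = 1 := by
    ext r s
    simp only [g₀, h₀, Matrix.mul_apply, Matrix.of_apply, Matrix.one_apply]
    rw [Finset.sum_eq_single (τ.symm r)]
    · simp
    · intro b _ hb
      rw [if_neg, zero_mul]
      rintro rfl
      simp at hb
    · simp
  have h2 : h₀ * g₀ = 1 := by
    ext x y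
    simp [g₀, h₀, Matrix.mul_apply, Matrix.one_apply, eq_comm]
  let ε := (g₀.submatrix e id).det
  have hε : ε ≠ 0 := by
    intro h0
    have h3 : (h₀.submatrix id e).det * ε = 1 := by
      rw [← Matrix.det_mul, Matrix.submatrix_mul_equiv, h2, Matrix.submatrix_id_id, Matrix.det_one]
    rw [h0, mul_zero] at h3
    exact zero_ne_one h3
  let D (z : ℂ) : Matrix (Fin K ⊕ Fin C) (Fin K ⊕ Fin C) ℂ :=
    Matrix.diagonal (Function.update 1 (Sum.inr ⟨0, hC⟩) z)
  have hD (z w : ℂ) (h : z * w = 1) : D z * D w = 1 := by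
    rw [Matrix.diagonal_mul_diagonal, ← Matrix.diagonal_one]
    congr 1
    funext x
    by_cases hx : x = Sum.inr ⟨0, hC⟩
    · subst hx; simpa using h
    · simp [Function.update_of_ne hx]
  refine ⟨⟨g₀ * D ε⁻¹, D ε * h₀, ?_, ?_⟩, ?_, ?_⟩
  · rw [Matrix.mul_assoc, ← Matrix.mul_assoc (D ε⁻¹), hD _ _ (inv_mul_cancel₀ hε), Matrix.one_mul, h1]
  · rw [Matrix.mul_assoc, ← Matrix.mul_assoc h₀, h2, Matrix.one_mul, hD _ _ (mul_inv_cancel₀ hε)]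
  · intro a r
    change (D ε * h₀) _ _ = _
    rw [Matrix.diagonal_mul, Function.update_of_ne (by simp)]
    simp [h₀, hτ, eq_comm]
  · change ((g₀ * D ε⁻¹).submatrix e id).det = 1
    have h3 : (g₀ * D ε⁻¹).submatrix e id = g₀.submatrix e id * D ε⁻¹ := rfl
    rw [h3, Matrix.det_mul, Matrix.det_diagonal, Finset.prod_update_of_mem (Finset.mem_univ _)]
    simpa using mul_inv_cancel₀ hε

end Frames

/-! ### Plücker coordinates determine the subspace. -/

section Overlap

variable {n K C : ℕ}

/-- Proportional Plücker coordinates mean equal column spans. The entries of `Y'` are determinants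
with one row replaced, so Cramer's rule identifies `Y' * u` with the lower block of the first frame
in the basis `g'`. -/
theorem chart_eq_of_det {B : Type} [CommRing B] [Algebra ℂ B] (g g' : Frame n K C)
    (Y Y' : Matrix (Fin C) (Fin K) B)
    (hu : IsUnit ((g'.ginv.submatrix Sum.inl id).map (algebraMap ℂ B) * g.chart Y).det)
    (h : ∀ h : Matrix (Fin K) (Fin n) ℂ, (h.map (algebraMap ℂ B) * g.chart Y).det =
      ((g'.ginv.submatrix Sum.inl id).map (algebraMap ℂ B) * g.chart Y).det *
        (h.map (algebraMap ℂ B) * g'.chart Y').det) :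
    g.chart Y = g'.chart Y' * ((g'.ginv.submatrix Sum.inl id).map (algebraMap ℂ B) * g.chart Y) := by
  set u := (g'.ginv.submatrix Sum.inl id).map (algebraMap ℂ B) * g.chart Y with hu'
  let w := (g'.ginv.submatrix Sum.inr id).map (algebraMap ℂ B) * g.chart Y
  have h1 (c : Fin C) (a : Fin K) : Matrix.cramer uᵀ (w c) a = u.det * Y' c a := by
    rw [Matrix.cramer_transpose_apply, ← det_updateRow_mul_chart g' Y' c a, ← h]
    congr 1
    ext i j
    by_cases hi : i = a
    · subst hi
      simp [Matrix.mul_apply, w]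
    · simp [Matrix.mul_apply, Matrix.updateRow_ne hi, hu']
  have h2 (c : Fin C) : uᵀ *ᵥ Y' c = w c := by
    have h3 := Matrix.mulVec_cramer uᵀ (w c)
    have h4 : Matrix.cramer uᵀ (w c) = u.det • Y' c := funext (h1 c)
    rw [h4, Matrix.mulVec_smul, Matrix.det_transpose] at h3
    funext i
    exact hu.mul_right_injective (congrFun h3 i)
  have h3 : g'.ginv.map (algebraMap ℂ B) * g.chart Y = oneRows Y' * u := by
    rw [oneRows, Matrix.fromRows_mul, Matrix.one_mul]
    ext i j
    rcases i with i | i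
    · rfl
    · have h4 := congrFun (h2 i) j
      rw [Matrix.mulVec_transpose] at h4
      exact h4.symm
  have h4 := congrArg (fun M => g'.g.map (algebraMap ℂ B) * M) h3
  simp only [← Matrix.mul_assoc, g'.map_mul_inv, Matrix.one_mul] at h4
  exact h4

end Overlap

/-! ### Coordinates on the standard opens of `Proj` and on their overlaps. -/

section ProjCharts

variable {n K C c : ℕ} {s : Set (MatPoly n K)} (hs : SemiInvariant s)

/-- Functions on an affine chart as functions on a standard open subset of `Proj`. -/
def chartToAway {g : Frame n K C} {I : Fin K ↪o Fin n} (hg : g.IsAt I) :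
    ChartPoly K C →ₐ[ℂ] Away (coordGrading s) (pluckerCoord s I) :=
  ((chartEquiv hg s hs).symm : ChartRing g s →ₐ[ℂ] _).comp (Ideal.Quotient.mkₐ ℂ _)

variable {g : Frame n K C} {I : Fin K ↪o Fin n} (hg : g.IsAt I)

theorem chartToAway_surjective : Function.Surjective (chartToAway hs hg) :=
  (chartEquiv hg s hs).symm.surjective.comp Ideal.Quotient.mk_surjective

theorem ker_chartToAway : RingHom.ker (chartToAway hs hg) = chartIdeal g s := by
  ext p
  rw [RingHom.mem_ker]
  change (chartEquiv hg s hs).symm _ = 0 ↔ _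
  rw [EmbeddingLike.map_eq_zero_iff]
  exact Ideal.Quotient.eq_zero_iff_mem

theorem linQuot_eq (h : Matrix (Fin K) (Fin n) ℂ) : linQuot s I h =
    chartToAway hs hg (h.map (algebraMap ℂ (ChartPoly K C)) * g.chart (genChart K C)).det := by
  refine (chartEquiv hg s hs).injective ?_
  refine (awayToChart_linQuot hg s h).trans ?_
  exact ((chartEquiv hg s hs).apply_symm_apply _).symm

theorem algHom_eq_evChart {B : Type*} [CommRing B] [Algebra ℂ B] (φ : ChartPoly K C →ₐ[ℂ] B) :
    φ = evChart ((genChart K C).map φ) :=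
  MvPolynomial.algHom_ext fun ij => by simp [evChart, genChart]

theorem algHom_det_mul_chart {B : Type*} [CommRing B] [Algebra ℂ B] (φ : ChartPoly K C →ₐ[ℂ] B)
    (h : Matrix (Fin K) (Fin n) ℂ) :
    φ (h.map (algebraMap ℂ (ChartPoly K C)) * g.chart (genChart K C)).det =
      (h.map (algebraMap ℂ B) * g.chart ((genChart K C).map φ)).det := by
  rw [AlgHom.map_det, AlgHom.mapMatrix_apply, Matrix.map_mul, g.map_chart, Matrix.map_map]
  congr 3
  ext i
  simp

theorem val_det_mul_chart {q : CoordRing s} {e : ℕ} (hq : q ∈ coordGrading s e) {x : CoordRing s}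
    (hx : x = pluckerCoord s I * q) (h : Matrix (Fin K) (Fin n) ℂ) :
    ((h.map (algebraMap ℂ (Away (coordGrading s) x)) * g.chart ((genChart K C).map
      ((awayResEq (coordGrading s) hq hx).comp (chartToAway hs hg))) :
        Matrix (Fin K) (Fin K) (Away (coordGrading s) x)).det).val *
        algebraMap _ (Localization.Away x) (pluckerCoord s I) =
      algebraMap _ _ (Ideal.Quotient.mk (pluckerIdeal s) (exists_linearForm h).choose) := by
  rw [← algHom_det_mul_chart, AlgHom.comp_apply, ← linQuot_eq, val_awayResEq]
  have h1 := val_mk_mul_pow (coordGrading s) (pluckerCoord_mem s I) 1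
    (Ideal.Quotient.mk _ (exists_linearForm h).choose)
    (mk_mem_coordGrading s (exists_linearForm h).choose_spec.1)
  have h2 := congrArg (resLoc ⟨q, hx⟩) h1
  rw [map_mul, map_pow, pow_one, resLoc_algebraMap, resLoc_algebraMap] at h2
  exact h2

/-- Both frames compute the same linear forms, one divided by `p_I` and the other by `p_{I'}`. So
their Plücker coordinates are proportional with factor `p_{I'} / p_I`, which is `det u`. -/
theorem exists_overlap {g' : Frame n K C} {I' : Fin K ↪o Fin n} (hg' : g'.IsAt I')
    {Y Y' : Matrix (Fin C) (Fin K)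
      (Away (coordGrading s) (pluckerCoord s I * pluckerCoord s I'))}
    (hY : Y = (genChart K C).map
      ((awayResEq (coordGrading s) (pluckerCoord_mem s I') rfl).comp (chartToAway hs hg)))
    (hY' : Y' = (genChart K C).map
      ((awayResEq (coordGrading s) (pluckerCoord_mem s I) (mul_comm _ _)).comp
        (chartToAway hs hg'))) :
    ∃ u : Matrix (Fin K) (Fin K) _, IsUnit u.det ∧ g.chart Y = g'.chart Y' * u ∧
      u.det.val * algebraMap _ (Localization.Away (pluckerCoord s I * pluckerCoord s I'))
        (pluckerCoord s I) = algebraMap _ _ (pluckerCoord s I') := by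
  let R := Away (coordGrading s) (pluckerCoord s I * pluckerCoord s I')
  have h1 (h : Matrix (Fin K) (Fin n) ℂ) :
      ((h.map (algebraMap ℂ R) * g.chart Y).det).val * algebraMap _ _ (pluckerCoord s I) =
        ((h.map (algebraMap ℂ R) * g'.chart Y').det).val * algebraMap _ _ (pluckerCoord s I') := by
    rw [hY, hY']
    refine (val_det_mul_chart hs hg (pluckerCoord_mem s I') rfl h).trans ?_
    exact (val_det_mul_chart hs hg' (pluckerCoord_mem s I) (mul_comm _ _) h).symm
  have htop (g : Frame n K C) (Y : Matrix (Fin C) (Fin K) R) :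
      (g.ginv.submatrix Sum.inl id).map (algebraMap ℂ R) * g.chart Y = 1 := by
    have h2 := g.inv_mul_chart Y
    exact Matrix.ext fun i j => congrFun (congrFun h2 (Sum.inl i)) j
  set u := (g'.ginv.submatrix Sum.inl id).map (algebraMap ℂ R) * g.chart Y with hu
  set u' := (g.ginv.submatrix Sum.inl id).map (algebraMap ℂ R) * g'.chart Y' with hu'
  have h2 : u.det.val * algebraMap _ _ (pluckerCoord s I) = algebraMap _ _ (pluckerCoord s I') := by
    rw [hu, h1, htop, Matrix.det_one, val_one, one_mul]
  have h3 : u'.det.val * algebraMap _ _ (pluckerCoord s I') = algebraMap _ _ (pluckerCoord s I) := by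
    rw [hu', ← h1, htop, Matrix.det_one, val_one, one_mul]
  have hpu : IsUnit (algebraMap _ (Localization.Away (pluckerCoord s I * pluckerCoord s I'))
      (pluckerCoord s I)) := (unitOfDvd ⟨pluckerCoord s I', rfl⟩).isUnit
  have h4 : u.det * u'.det = 1 := by
    refine val_injective _ (hpu.mul_left_injective ?_)
    beta_reduce
    rw [val_mul, val_one, one_mul, mul_right_comm, h2]
    exact (mul_comm _ _).trans h3
  have hunit : IsUnit u.det := IsUnit.of_mul_eq_one _ h4
  refine ⟨u, hunit, chart_eq_of_det g g' Y Y' hunit fun h => ?_, h2⟩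
  refine val_injective _ (hpu.mul_left_injective ?_)
  beta_reduce
  rw [h1, val_mul, mul_right_comm, h2]
  exact mul_comm _ _

theorem mem_span_pluckerCoord (s : Set (MatPoly n K)) {f : CoordRing s} {e : ℕ} (he : 0 < e)
    (hf : f ∈ coordGrading s e) : f ∈ Ideal.span (Set.range (pluckerCoord s)) := by
  obtain ⟨F, hF, rfl⟩ := hf
  have h1 : F ∈ Ideal.span (Set.range (MvPolynomial.X : _ → PluckerPoly n K)) := by
    rw [← Set.image_univ, MvPolynomial.mem_ideal_span_X_image]
    intro m hm
    by_contra! h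
    have h2 : m = 0 := by ext i; simpa using h i
    have h3 := hF (MvPolynomial.mem_support_iff.1 hm)
    rw [h2, map_zero] at h3
    omega
  have h4 := Ideal.mem_map_of_mem (Ideal.Quotient.mk (pluckerIdeal s)) h1
  rw [Ideal.map_span, ← Set.range_comp] at h4
  exact h4

end ProjCharts

/-! ### The canonical sheaf by adjunction. -/

section Canonical

variable {n K C c : ℕ} {s : Set (MatPoly n K)} {F : Frame n K C → Fin c → ChartPoly K C}

/-- The Jacobian criterion is satisfied on the affine chart with frame `g`. -/
def JacobianCriterion (s : Set (MatPoly n K)) (F : Frame n K C → Fin c → ChartPoly K C)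
    (g : Frame n K C) : Prop :=
  ∃ B : Matrix (Fin C × Fin K) (Fin c) (ChartRing g s),
    (Matrix.of fun r l => Ideal.Quotient.mk (chartIdeal g s) (MvPolynomial.pderiv l (F g r))) * B = 1

theorem ChartEquations.isCoord (hF : ChartEquations s F) {g : Frame n K C} {I : Fin K ↪o Fin n}
    (hg : g.IsAt I) (hJ : JacobianCriterion s F g) :
    IsCoord (fun l => chartToAway hF.semiInvariant hg (MvPolynomial.X l))
      fun r l => chartToAway hF.semiInvariant hg (MvPolynomial.pderiv l (F g r)) := by
  refine isCoord_of_surjective (F g) _ (chartToAway_surjective hF.semiInvariant hg)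
    ((ker_chartToAway hF.semiInvariant hg).trans (hF.span_eq g)) ?_
  obtain ⟨B, hB⟩ := hJ
  let ε := (chartEquiv hg s hF.semiInvariant).symm
  refine ⟨B.map ε, ?_⟩
  have h1 := congrArg (fun M => M.map
    (ε : ChartRing g s →ₐ[ℂ] Away (coordGrading s) (pluckerCoord s I))) hB
  simp only [Matrix.map_mul] at h1
  refine h1.trans ?_
  exact Matrix.map_one _ (map_zero _) (map_one _)

/-- On an overlap the transition function is `det T * det (transJac)`. It has to be `(p_{I'} / p_I)
^ (2c - n - 1)`, and `p_{I'} / p_I = det u`. -/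
theorem ChartEquations.canonicalIsoTwist (hF : ChartEquations s F) {d : ℕ} (hd : d + c = C * K)
    (hn : K + C = n) {g : (Fin K ↪o Fin n) → Frame n K C} (hg : ∀ I, (g I).IsAt I)
    (hdet : ∀ I I', ((g I').ginv * (g I).g).det = 1) (hJ : ∀ I, JacobianCriterion s F (g I)) :
    CanonicalIsoTwist (coordGrading s) d (2 * c - n - 1) := by
  have e : Fin d ⊕ Fin c ≃ Fin C × Fin K := Fintype.equivOfCardEq (by simp [hd])
  refine canonicalIsoTwist_of_charts (coordGrading s) (pluckerCoord_mem s) _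
    (fun I => hF.isCoord (hg I) (hJ I)) e
    (fun f l hl hf => Ideal.le_radical (mem_span_pluckerCoord s hl hf)) fun I I' => ?_
  let R := Away (coordGrading s) (pluckerCoord s I * pluckerCoord s I')
  let φ := (awayResEq (coordGrading s) (pluckerCoord_mem s I') rfl).comp
    (chartToAway hF.semiInvariant (hg I))
  let φ' := (awayResEq (coordGrading s) (pluckerCoord_mem s I)
    (mul_comm (pluckerCoord s I) (pluckerCoord s I'))).comp (chartToAway hF.semiInvariant (hg I'))
  obtain ⟨u, hu, hYY, hval⟩ := exists_overlap hF.semiInvariant (hg I) (hg I')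
    (Y := (genChart K C).map φ) (Y' := (genChart K C).map φ') rfl rfl
  have hev (G) : evChart ((genChart K C).map φ) G = φ G :=
    (DFunLike.congr_fun (algHom_eq_evChart φ) G).symm
  have hev' (G) : evChart ((genChart K C).map φ') G = φ' G :=
    (DFunLike.congr_fun (algHom_eq_evChart φ') G).symm
  obtain ⟨T, hT, hTJ⟩ := hF.jacobian_transition (hdet I I') hu hYY (fun r => by
    rw [hev', AlgHom.comp_apply]
    have h1 : F (g I') r ∈ RingHom.ker (chartToAway hF.semiInvariant (hg I')) := by
      rw [ker_chartToAway, hF.span_eq]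
      exact Ideal.subset_span ⟨r, rfl⟩
    rw [RingHom.mem_ker.1 h1, map_zero])
  have htr := (chart_eq_iff _ _ _ _ _).1 hYY
  simp only [hev, hev'] at hTJ
  refine ⟨T, _, hTJ, fun l => ?_, ?_⟩
  · have h1 := transJac_deriv (KaehlerDifferential.D ℂ R) ((g I').ginv * (g I).g)
      (Matrix.mul_nonsing_inv u hu) htr l
    exact h1
  · have hL := det_mul_det_transL _ htr
    have hL' : (((g I').ginv * (g I).g).map (algebraMap ℂ R)).det = 1 := by
      have := RingHom.map_det (algebraMap ℂ R) ((g I').ginv * (g I).g)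
      rw [hdet, map_one] at this
      exact this.symm
    rw [hL'] at hL
    obtain ⟨w, hw⟩ := hu
    have hLw : (transL (((g I').ginv * (g I).g).map (algebraMap ℂ R))
        ((genChart K C).map φ')).det = (w⁻¹ : Rˣ) := by
      rw [← hw] at hL
      exact (Units.inv_eq_of_mul_eq_one_right hL).symm
    have hTw : T.det = ((w ^ (2 * c) * w⁻¹ : Rˣ) : R) := by
      rw [← hw] at hT
      rw [Units.val_mul, Units.val_pow_eq_pow_val, ← hT, mul_assoc, Units.mul_inv, mul_one]
    have huw : (u⁻¹).det = (w⁻¹ : Rˣ) := by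
      rw [Matrix.det_nonsing_inv, ← hw, Ring.inverse_unit]
    -- The exponent of `det u` is `2c - 1` from the equations, `-K` from `transL` (which has
    -- determinant `det(u)⁻¹`), and `-C` from `u⁻¹` in the Kronecker product; finally `K + C = n`.
    have hprod : T.det * (transJac (((g I').ginv * (g I).g).map (algebraMap ℂ R))
        ((genChart K C).map φ') u⁻¹).det = ((w ^ (2 * (c : ℤ) - n - 1) : Rˣ) : R) := by
      have hdv : Fintype.card (Fin C) = C := Fintype.card_fin C
      rw [hTw, det_transJac, hLw, huw, ← Units.val_pow_eq_pow_val, ← Units.val_pow_eq_pow_val,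
        ← Units.val_mul, ← Units.val_mul]
      congr 1
      rw [inv_pow, inv_pow, ← zpow_natCast, ← zpow_natCast, ← zpow_natCast, ← zpow_neg_one,
        ← zpow_neg, ← zpow_neg, ← zpow_add, ← zpow_add, ← zpow_add]
      congr 1
      push_cast [← hn]
      ring
    rw [hprod]
    let U := Units.map (algebraMap R (Localization.Away
      (pluckerCoord s I * pluckerCoord s I'))).toMonoidHom w
    have hU : U * unitOfDvd ⟨pluckerCoord s I', rfl⟩ =
        unitOfDvd (Dvd.intro_left (pluckerCoord s I) rfl) := by
      refine Units.ext ?_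
      rw [Units.val_mul, val_unitOfDvd, val_unitOfDvd, ← hval, ← hw]
      rfl
    rw [← hU, mul_zpow, Units.val_mul, ← map_zpow]
    rfl

end Canonical

/-! ### The Jacobian criterion for smoothness. -/

section Smooth

variable {σ : Type*} [Fintype σ] {A : Type*} [CommRing A]

theorem aeval_add_of_sq_zero {B : Type*} [CommRing B] [Algebra A B] {I : Ideal B} (hI : I ^ 2 = ⊥)
    (y : σ → B) {ε : σ → B} (hε : ∀ l, ε l ∈ I) (p : MvPolynomial σ A) :
    MvPolynomial.aeval (y + ε) p =
      MvPolynomial.aeval y p + ∑ l, MvPolynomial.aeval y (MvPolynomial.pderiv l p) * ε l := by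
  classical
  induction p using MvPolynomial.induction_on with
  | C z => simp
  | add p q hp hq => simp only [map_add, hp, hq, add_mul, Finset.sum_add_distrib]; ring
  | mul_X p i hp =>
    have h0 : (∑ l, MvPolynomial.aeval y (MvPolynomial.pderiv l p) * ε l) * ε i = 0 := by
      rw [← Ideal.mem_bot, ← hI, pow_two]
      exact Ideal.mul_mem_mul (Ideal.sum_mem _ fun l _ => I.mul_mem_left _ (hε l)) (hε i)
    have h1 : ∑ l, MvPolynomial.aeval y (MvPolynomial.pderiv l (p * MvPolynomial.X i)) * ε l =
        (∑ l, MvPolynomial.aeval y (MvPolynomial.pderiv l p) * ε l) * y i +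
          MvPolynomial.aeval y p * ε i := by
      simp only [Derivation.leibniz, map_add, smul_eq_mul, map_mul, MvPolynomial.aeval_X, add_mul,
        Finset.sum_add_distrib, MvPolynomial.pderiv_X, Finset.sum_mul]
      rw [add_comm]
      congr 1
      · exact Finset.sum_congr rfl fun l _ => by ring
      · rw [Finset.sum_eq_single i]
        · simp
        · intro b _ hb
          simp [Pi.single_eq_of_ne' hb]
        · simp
    rw [h1, map_mul, map_mul, hp, MvPolynomial.aeval_X, MvPolynomial.aeval_X, Pi.add_apply, mul_add,
      add_mul, add_mul, h0]
    ring

variable {ι : Type*} [Fintype ι] [DecidableEq ι] {R : Type*} [CommRing R] [Algebra A R]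
  {Q : Type*} [CommRing Q] [Algebra A Q] [Algebra R Q] [IsScalarTower A R Q]

/-- Infinitesimal lifting by one Newton step. Lift the coordinates arbitrarily to `y`; the errors `f
r (y)` lie in `I`, and subtracting the lifted right inverse applied to them removes the errors, as
`I² = 0`. -/
theorem smooth_of_jacobian (f : ι → MvPolynomial σ A) (π : MvPolynomial σ A →ₐ[A] R)
    (hπ : Function.Surjective π) (hker : RingHom.ker π = Ideal.span (Set.range f)) (h : R)
    [IsLocalization.Away h Q] (b : Matrix σ ι Q)
    (hb : (Matrix.of fun r l => algebraMap R Q (π (MvPolynomial.pderiv l (f r)))) * b = 1) :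
    Algebra.Smooth A Q := by
  have hR : Algebra.FinitePresentation A R :=
    Algebra.FinitePresentation.of_surjective (f := π) hπ (by
      change (RingHom.ker π).FG
      rw [hker]
      exact Submodule.fg_span (Set.finite_range f))
  have hRQ : Algebra.FinitePresentation R Q := IsLocalization.Away.finitePresentation h
  refine ⟨Algebra.FormallySmooth.iff_comp_surjective.2 fun B _ _ I hI g => ?_,
    Algebra.FinitePresentation.trans A R Q⟩
  let α : MvPolynomial σ A →ₐ[A] Q := (IsScalarTower.toAlgHom A R Q).comp π
  have hmk : Function.Surjective (Ideal.Quotient.mkₐ A I) := Ideal.Quotient.mk_surjective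
  choose y hy using fun l => hmk (g (α (MvPolynomial.X l)))
  choose β hβ using fun l r => hmk (g (b l r))
  have hg (z : σ → B) (hz : ∀ l, Ideal.Quotient.mkₐ A I (z l) = g (α (MvPolynomial.X l))) (p) :
      Ideal.Quotient.mkₐ A I (MvPolynomial.aeval z p) = g (α p) := by
    have : (Ideal.Quotient.mkₐ A I).comp (MvPolynomial.aeval z) = g.comp α :=
      MvPolynomial.algHom_ext fun l => by simpa using hz l
    exact DFunLike.congr_fun this p
  have hπf (r) : π (f r) = 0 := by
    rw [← RingHom.mem_ker, hker]; exact Ideal.subset_span ⟨r, rfl⟩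
  have hf (r) : MvPolynomial.aeval y (f r) ∈ I := by
    rw [← Ideal.Quotient.eq_zero_iff_mem]
    refine (hg y hy _).trans ?_
    simp [α, hπf]
  let ε : σ → B := fun l => -∑ r, β l r * MvPolynomial.aeval y (f r)
  have hε (l) : ε l ∈ I := neg_mem (Ideal.sum_mem _ fun r _ => I.mul_mem_left _ (hf r))
  have hI0 {u v : B} (hu : u ∈ I) (hv : v ∈ I) : u * v = 0 := by
    rw [← Ideal.mem_bot, ← hI, pow_two]
    exact Ideal.mul_mem_mul hu hv
  have hz (l) : Ideal.Quotient.mkₐ A I ((y + ε) l) = g (α (MvPolynomial.X l)) := by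
    rw [Pi.add_apply, map_add, hy]
    have : Ideal.Quotient.mkₐ A I (ε l) = 0 := Ideal.Quotient.eq_zero_iff_mem.2 (hε l)
    rw [this, add_zero]
  have hf' (r) : MvPolynomial.aeval (y + ε) (f r) = 0 := by
    rw [aeval_add_of_sq_zero hI y hε]
    have h1 : ∑ l, MvPolynomial.aeval y (MvPolynomial.pderiv l (f r)) * ε l =
        -∑ t, (∑ l, MvPolynomial.aeval y (MvPolynomial.pderiv l (f r)) * β l t) *
          MvPolynomial.aeval y (f t) := by
      simp only [ε, mul_neg, Finset.sum_neg_distrib, Finset.mul_sum, Finset.sum_mul]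
      rw [Finset.sum_comm]
      simp only [mul_assoc]
    have h2 (t) : (∑ l, MvPolynomial.aeval y (MvPolynomial.pderiv l (f r)) * β l t) *
          MvPolynomial.aeval y (f t) = (if r = t then 1 else 0) * MvPolynomial.aeval y (f t) := by
      rw [← sub_eq_zero, ← sub_mul]
      refine hI0 ?_ (hf t)
      rw [← Ideal.Quotient.eq_zero_iff_mem]
      change Ideal.Quotient.mkₐ A I _ = 0
      rw [map_sub, map_sum]
      have h3 := congrArg g (congrFun (congrFun hb r) t)
      rw [Matrix.mul_apply, map_sum] at h3
      rw [sub_eq_zero]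
      calc _ = ∑ l, g (algebraMap R Q (π (MvPolynomial.pderiv l (f r))) * b l t) :=
            Finset.sum_congr rfl fun l _ => by rw [map_mul, map_mul, hg y hy, hβ]; rfl
        _ = _ := h3
        _ = _ := by rw [Matrix.one_apply]; split_ifs <;> simp
    rw [h1, Finset.sum_congr rfl fun t _ => h2 t]
    simp
  let φ : R →ₐ[A] B := AlgHom.liftOfSurjective π hπ (MvPolynomial.aeval (y + ε)) (by
    change RingHom.ker π ≤ _
    rw [hker, Ideal.span_le]
    rintro _ ⟨r, rfl⟩
    exact hf' r)
  have hφ (p) : φ (π p) = MvPolynomial.aeval (y + ε) p :=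
    AlgHom.liftOfSurjective_apply ..
  have hφg (x : R) : Ideal.Quotient.mkₐ A I (φ x) = g (algebraMap R Q x) := by
    obtain ⟨p, rfl⟩ := hπ x
    rw [hφ, hg _ hz]
    rfl
  -- Units lift along the nilpotent ideal `I`, so the lift extends from `R` to its localization `Q`.
  have hunit : IsUnit (φ h) := by
    have h1 : IsUnit (Ideal.Quotient.mk I (φ h)) := by
      have h2 := hφg h
      change Ideal.Quotient.mk I _ = _ at h2
      rw [h2]
      exact (IsLocalization.Away.algebraMap_isUnit h).map g
    exact (IsNilpotent.isUnit_quotient_mk_iff ⟨2, hI⟩).1 h1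
  let ψ : Q →+* B := IsLocalization.Away.lift (g := φ.toRingHom) h hunit
  have hψ (x : R) : ψ (algebraMap R Q x) = φ x := IsLocalization.Away.lift_eq h hunit x
  refine ⟨{ ψ with commutes' := fun a => ?_ }, ?_⟩
  · change ψ _ = _
    rw [IsScalarTower.algebraMap_apply A R Q, hψ, φ.commutes]
  · apply AlgHom.coe_ringHom_injective
    refine IsLocalization.ringHom_ext (Submonoid.powers h) (RingHom.ext fun x => ?_)
    change Ideal.Quotient.mkₐ A I (ψ (algebraMap R Q x)) = g (algebraMap R Q x)
    rw [hψ, hφg]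

theorem smooth_of_isLocalization_det (f : ι → MvPolynomial σ A) (π : MvPolynomial σ A →ₐ[A] R)
    (hπ : Function.Surjective π) (hker : RingHom.ker π = Ideal.span (Set.range f))
    (B : Matrix σ ι (MvPolynomial σ A))
    [IsLocalization.Away (π ((Matrix.of fun r l => MvPolynomial.pderiv l (f r)) * B).det) Q] :
    Algebra.Smooth A Q := by
  let J : Matrix ι σ (MvPolynomial σ A) := Matrix.of fun r l => MvPolynomial.pderiv l (f r)
  let α : MvPolynomial σ A →ₐ[A] Q := (IsScalarTower.toAlgHom A R Q).comp π
  have hdet : IsUnit ((J * B).map α).det := by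
    rw [← AlgHom.mapMatrix_apply, ← AlgHom.map_det]
    exact IsLocalization.Away.algebraMap_isUnit (π (J * B).det)
  refine smooth_of_jacobian f π hπ hker (π (J * B).det) (B.map α * ((J * B).map α)⁻¹) ?_
  have h1 : (Matrix.of fun r l => algebraMap R Q (π (MvPolynomial.pderiv l (f r)))) =
    J.map α := rfl
  rw [h1, ← Matrix.mul_assoc, ← Matrix.map_mul, Matrix.mul_nonsing_inv _ hdet]

end Smooth

/-! ### Obstruction to a right inverse, and extension of derivations. -/

section RightInverse

/-- If the columns do not generate the free module, their span lies in a maximal submodule. The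
simple quotient is a residue field, and the quotient map is the left kernel vector. -/
theorem exists_right_inverse_or {Q : Type*} [CommRing Q] {σ ι : Type*} [Fintype σ] [Fintype ι]
    [DecidableEq ι] (J : Matrix ι σ Q) : (∃ B : Matrix σ ι Q, J * B = 1) ∨
      ∃ (m : Ideal Q) (_ : m.IsMaximal) (v : ι → Q ⧸ m), v ≠ 0 ∧
        ∀ l, ∑ r, v r * Ideal.Quotient.mk m (J r l) = 0 := by
  classical
  by_cases htop : LinearMap.range J.mulVecLin = ⊤
  · left
    choose b hb using fun t : ι => LinearMap.range_eq_top.1 htop (Pi.single t 1)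
    refine ⟨Matrix.of fun l t => b t l, ?_⟩
    ext r t
    have := congrFun (hb t) r
    rw [Matrix.mul_apply, Matrix.one_apply]
    rw [Matrix.mulVecLin_apply, Matrix.mulVec, dotProduct, Pi.single_apply] at this
    simpa using this
  · right
    obtain ⟨N, hN, hle⟩ := (eq_top_or_exists_le_coatom (LinearMap.range J.mulVecLin)).resolve_left htop
    obtain ⟨m, hm, ⟨e⟩⟩ := isSimpleModule_iff_quot_maximal.1 (isSimpleModule_iff_isCoatom.2 hN)
    let q : (ι → Q) →ₗ[Q] Q ⧸ m := e.toLinearMap.comp N.mkQ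
    have hq (w : ι → Q) : q w = ∑ r, q (Pi.single r 1) * Ideal.Quotient.mk m (w r) := by
      conv_lhs => rw [pi_eq_sum_univ' w]
      rw [map_sum]
      refine Finset.sum_congr rfl fun r _ => ?_
      rw [map_smul, Algebra.smul_def, mul_comm]
      congr 2
    refine ⟨m, hm, fun r => q (Pi.single r 1), fun h0 => ?_, fun l => ?_⟩
    · refine hN.1 (eq_top_iff.2 fun w _ => ?_)
      have h1 := hq w
      have h2 (r) : q (Pi.single r 1) = 0 := congrFun h0 r
      simp only [h2, zero_mul, Finset.sum_const_zero] at h1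
      exact (Submodule.Quotient.mk_eq_zero N).1 (e.map_eq_zero_iff.1 h1)
    · rw [← hq fun r => J r l]
      have h1 : (fun r => J r l) ∈ N := hle ⟨Pi.single l 1, by ext r; simp⟩
      exact (congrArg e ((Submodule.Quotient.mk_eq_zero N).2 h1)).trans (map_zero e)

/-- For a formally étale extension the differentials of `L` are the base change of those of `Λ`, so
a derivation on `Λ` extends by linearity. -/
theorem exists_derivation_extend {k Λ L : Type*} [CommRing k] [CommRing Λ] [CommRing L]
    [Algebra k Λ] [Algebra k L] [Algebra Λ L] [IsScalarTower k Λ L] [Algebra.FormallyEtale Λ L]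
    (D : Derivation k Λ Λ) :
    ∃ D' : Derivation k L L, ∀ a, D' (algebraMap Λ L a) = algebraMap Λ L (D a) := by
  let l : Ω[Λ⁄k] →ₗ[Λ] L := (Algebra.linearMap Λ L).comp D.liftKaehlerDifferential
  let l' : TensorProduct Λ L (Ω[Λ⁄k]) →ₗ[L] L := (TensorProduct.AlgebraTensorModule.lift
    ((LinearMap.toSpanSingleton L (Ω[Λ⁄k] →ₗ[Λ] L) l)))
  refine ⟨(l'.comp (KaehlerDifferential.tensorKaehlerEquivOfFormallyEtale k Λ L).symm.toLinearMap).compDer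
    (KaehlerDifferential.D k L), fun a => ?_⟩
  change l' ((KaehlerDifferential.tensorKaehlerEquivOfFormallyEtale k Λ L).symm
    (KaehlerDifferential.D k L (algebraMap Λ L a))) = _
  rw [KaehlerDifferential.tensorKaehlerEquivOfFormallyEtale_symm_D_algebraMap]
  simp [l', l]

end RightInverse

/-! ### Bertini's theorem for linear systems containing the constant vectors, and existence of
zeros. -/

section Bertini

variable {σ τ : Type} [Fintype σ] [Fintype τ] {c : ℕ}

/-- The generic linear combination of the equations `f i`. -/
def genericEquation (f : τ → Fin c → MvPolynomial σ ℂ) (r : Fin c) :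
    MvPolynomial σ (MvPolynomial τ ℂ) :=
  ∑ i, MvPolynomial.C (MvPolynomial.X i) * MvPolynomial.map (algebraMap ℂ (MvPolynomial τ ℂ)) (f i r)

variable {f : τ → Fin c → MvPolynomial σ ℂ}

theorem map_genericEquation (a : τ → ℂ) (r : Fin c) :
    MvPolynomial.map (MvPolynomial.eval a) (genericEquation f r) =
      ∑ i, MvPolynomial.C (a i) * f i r := by
  simp only [genericEquation, map_sum, map_mul, MvPolynomial.map_C, MvPolynomial.eval_X,
    MvPolynomial.map_map]
  refine Finset.sum_congr rfl fun i _ => ?_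
  congr 1
  have : (MvPolynomial.eval a).comp (algebraMap ℂ (MvPolynomial τ ℂ)) = RingHom.id ℂ :=
    RingHom.ext fun z => by simp
  rw [this, MvPolynomial.map_id]

theorem derivation_aeval {Λ L : Type} [CommRing Λ] [CommRing L] [Algebra ℂ Λ] [Algebra ℂ L] [Algebra Λ L]
    [IsScalarTower ℂ Λ L] (D' : Derivation ℂ L L) (x : σ → L) (p : MvPolynomial σ ℂ) :
    D' (MvPolynomial.aeval x p) =
      ∑ l, MvPolynomial.aeval x (MvPolynomial.pderiv l p) * D' (x l) := by
  classical
  induction p using MvPolynomial.induction_on with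
  | C z => simp
  | add p q hp hq => simp only [map_add, hp, hq, add_mul, Finset.sum_add_distrib]
  | mul_X p i hp =>
    rw [map_mul, Derivation.leibniz, hp, MvPolynomial.aeval_X]
    simp only [Derivation.leibniz, map_add, smul_eq_mul, map_mul, MvPolynomial.aeval_X, add_mul,
        Finset.sum_add_distrib, MvPolynomial.pderiv_X, Finset.mul_sum]
    congr 1
    · rw [Finset.sum_eq_single i]
      · simp
      · intro b _ hb
        simp [Pi.single_eq_of_ne' hb]
      · simp
    · exact Finset.sum_congr rfl fun l _ => by ring

/-- Here `k` is the field of rational functions in the parameters and `L` the residue field of a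
closed point of the generic zero scheme. Derivatives with respect to the parameters extend to `L`
and force `v` to be orthogonal to every member of the linear system at the point, in particular to
each constant vector. -/
theorem eq_zero_of_generic_left_kernel (hf : ∀ t, ∃ a : τ → ℂ, ∀ r,
    ∑ i, MvPolynomial.C (a i) * f i r = if r = t then 1 else 0) {k L : Type} [Field k]
    [Algebra (MvPolynomial τ ℂ) k] [IsFractionRing (MvPolynomial τ ℂ) k] [Field L] [Algebra k L]
    (ev : MvPolynomial σ k →ₐ[k] L) (hev : Function.Surjective ev)
    (hF0 : ∀ r, ev (MvPolynomial.map (algebraMap (MvPolynomial τ ℂ) k) (genericEquation f r)) = 0)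
    (v : Fin c → L) (hvJ : ∀ l, ∑ r, v r * ev (MvPolynomial.map (algebraMap (MvPolynomial τ ℂ) k)
      (MvPolynomial.pderiv l (genericEquation f r))) = 0) : v = 0 := by
  classical
  let : Algebra ℂ k := ((algebraMap (MvPolynomial τ ℂ) k).comp (algebraMap ℂ (MvPolynomial τ ℂ))).toAlgebra
  have : IsScalarTower ℂ (MvPolynomial τ ℂ) k := IsScalarTower.of_algebraMap_eq fun _ => rfl
  have : Algebra.FiniteType k L := Algebra.FiniteType.of_surjective ev hev
  -- Zariski's lemma. In characteristic zero the finite extension is separable, hence étale, and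
  -- derivations of the polynomial ring in the parameters extend to `L`.
  have : Module.Finite k L := finite_of_finite_type_of_isJacobsonRing k L
  have : CharZero k := charZero_of_injective_algebraMap (algebraMap ℂ k).injective
  have : Algebra.IsSeparable k L := inferInstance
  have : Algebra.FormallyEtale k L := Algebra.FormallyEtale.of_isSeparable k L
  have : Algebra.FormallyEtale (MvPolynomial τ ℂ) k := Algebra.FormallyEtale.of_isLocalization (nonZeroDivisors (MvPolynomial τ ℂ))
  let : Algebra (MvPolynomial τ ℂ) L := ((algebraMap k L).comp (algebraMap (MvPolynomial τ ℂ) k)).toAlgebra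
  have : IsScalarTower (MvPolynomial τ ℂ) k L := IsScalarTower.of_algebraMap_eq fun _ => rfl
  have : Algebra.FormallyEtale (MvPolynomial τ ℂ) L := Algebra.FormallyEtale.comp (MvPolynomial τ ℂ) k L
  let : Algebra ℂ L := ((algebraMap (MvPolynomial τ ℂ) L).comp (algebraMap ℂ (MvPolynomial τ ℂ))).toAlgebra
  have : IsScalarTower ℂ (MvPolynomial τ ℂ) L := IsScalarTower.of_algebraMap_eq fun _ => rfl
  let x : σ → L := fun l => ev (MvPolynomial.X l)
  have hmap (p : MvPolynomial σ (MvPolynomial τ ℂ)) : ev (MvPolynomial.map (algebraMap (MvPolynomial τ ℂ) k) p) =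
      MvPolynomial.aeval x p := by
    have : ((ev : MvPolynomial σ k →+* L).comp (MvPolynomial.map (algebraMap (MvPolynomial τ ℂ) k))) =
        (MvPolynomial.aeval x : MvPolynomial σ (MvPolynomial τ ℂ) →ₐ[(MvPolynomial τ ℂ)] L) :=
      MvPolynomial.ringHom_ext (fun z => by
        change ev _ = MvPolynomial.aeval x _
        rw [MvPolynomial.map_C, MvPolynomial.aeval_C, ← MvPolynomial.algebraMap_eq, ev.commutes]
        rfl) fun l => by simp [x]
    exact DFunLike.congr_fun this p
  have hmapC (p : MvPolynomial σ ℂ) : MvPolynomial.aeval x (MvPolynomial.map (algebraMap ℂ (MvPolynomial τ ℂ)) p) =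
      MvPolynomial.aeval x p := MvPolynomial.aeval_map_algebraMap (MvPolynomial τ ℂ) x p
  have hF (r) : ∑ i, algebraMap (MvPolynomial τ ℂ) L (MvPolynomial.X i) * MvPolynomial.aeval x (f i r) = 0 := by
    have h1 := hF0 r
    rw [hmap, genericEquation, map_sum] at h1
    simpa only [map_mul, hmapC, MvPolynomial.aeval_C] using h1
  have hJ (r l) : ev (MvPolynomial.map (algebraMap (MvPolynomial τ ℂ) k) (MvPolynomial.pderiv l (genericEquation f r))) =
      ∑ i, algebraMap (MvPolynomial τ ℂ) L (MvPolynomial.X i) * MvPolynomial.aeval x (MvPolynomial.pderiv l (f i r)) := by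
    have h1 := hmap (MvPolynomial.pderiv l (genericEquation f r))
    rw [h1, genericEquation, map_sum, map_sum]
    refine Finset.sum_congr rfl fun i _ => ?_
    rw [MvPolynomial.pderiv_C_mul, MvPolynomial.pderiv_map, map_mul,
        hmapC, MvPolynomial.aeval_C]
  -- Applying the extension of `∂/∂aᵢ` to `∑ aⱼ fⱼ(x) = 0` gives `fᵢ(x) + J · D x = 0`. Pairing with
  -- `v`, which kills `J`, leaves `v · fᵢ(x) = 0`.
  have hkey (i) : ∑ r, v r * MvPolynomial.aeval x (f i r) = 0 := by
    obtain ⟨D, hD⟩ := exists_derivation_extend (L := L) (MvPolynomial.pderiv (R := ℂ) i)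
    have h1 (r) : MvPolynomial.aeval x (f i r) + ∑ l, ev (MvPolynomial.map (algebraMap (MvPolynomial τ ℂ) k) (MvPolynomial.pderiv l (genericEquation f r))) * D (x l) = 0 := by
      have h2 := congrArg D (hF r)
      simp only [map_sum, Derivation.leibniz, hD, derivation_aeval (Λ := MvPolynomial τ ℂ), map_zero,
        Finset.sum_add_distrib, smul_eq_mul] at h2
      rw [← h2, add_comm]
      congr 1
      · simp only [hJ, Finset.sum_mul, Finset.mul_sum, mul_assoc]
        exact Finset.sum_comm
      · rw [Finset.sum_eq_single i]
        · simp
        · intro b _ hb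
          simp [MvPolynomial.pderiv_X, Pi.single_eq_of_ne hb]
        · simp
    have h3 : ∑ r, v r * (MvPolynomial.aeval x (f i r) +
        ∑ l, ev (MvPolynomial.map (algebraMap (MvPolynomial τ ℂ) k) (MvPolynomial.pderiv l (genericEquation f r))) * D (x l)) = 0 :=
      Finset.sum_eq_zero fun r _ => by rw [h1, mul_zero]
    simp only [mul_add, Finset.sum_add_distrib, Finset.mul_sum, ← mul_assoc] at h3
    rw [Finset.sum_comm (f := fun r l => v r * ev (MvPolynomial.map (algebraMap (MvPolynomial τ ℂ) k) (MvPolynomial.pderiv l (genericEquation f r))) * D (x l))] at h3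
    simpa only [← Finset.sum_mul, hvJ, zero_mul, Finset.sum_const_zero, add_zero] using h3
  refine funext fun t => ?_
  obtain ⟨a, ha⟩ := hf t
  have h1 : ∑ i, algebraMap ℂ L (a i) * ∑ r, v r * MvPolynomial.aeval x (f i r) = 0 :=
    Finset.sum_eq_zero fun i _ => by rw [hkey, mul_zero]
  simp only [Finset.mul_sum] at h1
  rw [Finset.sum_comm] at h1
  have h2 (r) : ∑ i, algebraMap ℂ L (a i) * (v r * MvPolynomial.aeval x (f i r)) =
      v r * if r = t then 1 else 0 := by
    have h3 := congrArg (MvPolynomial.aeval x : MvPolynomial σ ℂ →ₐ[ℂ] L) (ha r)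
    rw [map_sum] at h3
    simp only [map_mul, MvPolynomial.aeval_C] at h3
    have h4 : (MvPolynomial.aeval x : MvPolynomial σ ℂ →ₐ[ℂ] L) (if r = t then 1 else 0) =
        if r = t then 1 else 0 := by split_ifs <;> simp
    rw [h4] at h3
    rw [← h3, Finset.mul_sum]
    exact Finset.sum_congr rfl fun i _ => by ring
  rw [Finset.sum_congr rfl fun r _ => h2 r] at h1
  simpa using h1

/-- The generic member of a linear system which generates all the constant vectors satisfies the
Jacobian criterion. -/
theorem exists_generic_right_inverse (hf : ∀ t, ∃ a : τ → ℂ, ∀ r,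
    ∑ i, MvPolynomial.C (a i) * f i r = if r = t then 1 else 0) {k : Type} [Field k]
    [Algebra (MvPolynomial τ ℂ) k] [IsFractionRing (MvPolynomial τ ℂ) k] :
    ∃ B : Matrix σ (Fin c) (MvPolynomial σ k), ∀ r t,
      ∑ l, MvPolynomial.map (algebraMap (MvPolynomial τ ℂ) k)
        (MvPolynomial.pderiv l (genericEquation f r)) * B l t - (if r = t then 1 else 0) ∈
      Ideal.span (Set.range fun r => MvPolynomial.map (algebraMap (MvPolynomial τ ℂ) k)
        (genericEquation f r)) := by
  classical
  set I := Ideal.span (Set.range fun r => MvPolynomial.map (algebraMap (MvPolynomial τ ℂ) k) (genericEquation f r))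
  let Q := MvPolynomial σ k ⧸ I
  let J : Matrix (Fin c) σ Q := Matrix.of fun r l => Ideal.Quotient.mk I
    (MvPolynomial.map (algebraMap (MvPolynomial τ ℂ) k) (MvPolynomial.pderiv l (genericEquation f r)))
  rcases exists_right_inverse_or J with ⟨B, hB⟩ | ⟨m, hm, v, hv, hvJ⟩
  · choose B' hB' using fun l t => Ideal.Quotient.mk_surjective (B l t)
    refine ⟨Matrix.of B', fun r t => ?_⟩
    rw [← Ideal.Quotient.eq_zero_iff_mem, map_sub, sub_eq_zero, map_sum]
    have h1 := congrFun (congrFun hB r) t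
    rw [Matrix.mul_apply] at h1
    simp only [map_mul, Matrix.of_apply, hB']
    refine h1.trans ?_
    rw [Matrix.one_apply]
    split_ifs <;> simp
  · let : Field (Q ⧸ m) := Ideal.Quotient.field m
    refine absurd (eq_zero_of_generic_left_kernel hf
      ((Ideal.Quotient.mkₐ k m).comp (Ideal.Quotient.mkₐ k I))
      (Ideal.Quotient.mk_surjective.comp Ideal.Quotient.mk_surjective) (fun r => ?_) v hvJ) hv
    change Ideal.Quotient.mk m (Ideal.Quotient.mk I _) = 0
    have h1 : MvPolynomial.map (algebraMap (MvPolynomial τ ℂ) k) (genericEquation f r) ∈ I :=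
      Ideal.subset_span ⟨r, rfl⟩
    rw [Ideal.Quotient.eq_zero_iff_mem.2 h1, map_zero]

/-- Finitely many coefficients in the fraction field have a common denominator `p` in the
parameters. Its nonvanishing is the open condition under which the right inverse specializes. -/
theorem exists_cleared_right_inverse (hf : ∀ t, ∃ a : τ → ℂ, ∀ r,
    ∑ i, MvPolynomial.C (a i) * f i r = if r = t then 1 else 0) :
    ∃ p : MvPolynomial τ ℂ, p ≠ 0 ∧ ∃ (B : σ → Fin c → MvPolynomial σ (MvPolynomial τ ℂ))
      (A : Fin c → Fin c → Fin c → MvPolynomial σ (MvPolynomial τ ℂ)), ∀ r t,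
      ∑ l, MvPolynomial.pderiv l (genericEquation f r) * B l t -
        (if r = t then MvPolynomial.C p else 0) = ∑ q, A r t q * genericEquation f q := by
  classical
  let k := FractionRing (MvPolynomial τ ℂ)
  obtain ⟨B, hB⟩ := exists_generic_right_inverse hf (k := k)
  have hB' (r t) := Ideal.mem_span_range_iff_exists_fun.1 (hB r t)
  choose A hA using hB'
  let μ : MvPolynomial σ (MvPolynomial τ ℂ) →+* MvPolynomial σ k :=
    MvPolynomial.map (algebraMap (MvPolynomial τ ℂ) k)
  have hμ : Function.Injective μ := MvPolynomial.map_injective _ (IsFractionRing.injective _ _)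
  let : Algebra (MvPolynomial σ (MvPolynomial τ ℂ)) (MvPolynomial σ k) := μ.toAlgebra
  have hloc : IsLocalization ((nonZeroDivisors (MvPolynomial τ ℂ)).map
      (MvPolynomial.C (σ := σ))) (MvPolynomial σ k) :=
    MvPolynomial.isLocalization (nonZeroDivisors (MvPolynomial τ ℂ)) k
  obtain ⟨⟨_, p, hp, rfl⟩, hb⟩ := IsLocalization.exist_integer_multiples_of_finite
    ((nonZeroDivisors (MvPolynomial τ ℂ)).map (MvPolynomial.C (σ := σ)))
    (Sum.elim (fun x : σ × Fin c => B x.1 x.2) fun x : Fin c × Fin c × Fin c => A x.1 x.2.1 x.2.2)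
  choose z hz using hb
  have hz1 (l t) : μ (z (Sum.inl (l, t))) = μ (MvPolynomial.C p) * B l t :=
    (hz (Sum.inl (l, t))).trans (Algebra.smul_def _ _)
  have hz2 (r t q) : μ (z (Sum.inr (r, t, q))) = μ (MvPolynomial.C p) * A r t q :=
    (hz (Sum.inr (r, t, q))).trans (Algebra.smul_def _ _)
  refine ⟨p, nonZeroDivisors.ne_zero hp, fun l t => z (Sum.inl (l, t)),
    fun r t q => z (Sum.inr (r, t, q)), fun r t => ?_⟩
  · apply hμ
    have h1 := congrArg (μ (MvPolynomial.C p) * ·) (hA r t)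
    simp only [Finset.mul_sum, mul_sub] at h1
    simp only [map_sub, map_sum, map_mul, hz1, hz2]
    refine Eq.trans ?_ (Eq.trans h1.symm (Finset.sum_congr rfl fun q _ => (mul_assoc _ _ _).symm))
    refine congrArg₂ _ (Finset.sum_congr rfl fun l _ => mul_left_comm _ _ _) ?_
    by_cases hrt : r = t
    · rw [if_pos hrt, if_pos hrt, mul_one]
    · rw [if_neg hrt, if_neg hrt, mul_zero, map_zero]

/-- The general member of a linear system which generates all the constant vectors satisfies the
Jacobian criterion. -/
theorem exists_jacobian_criterion (hf : ∀ t, ∃ a : τ → ℂ, ∀ r,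
    ∑ i, MvPolynomial.C (a i) * f i r = if r = t then 1 else 0) :
    ∃ p : MvPolynomial τ ℂ, p ≠ 0 ∧ ∀ a, MvPolynomial.eval a p ≠ 0 →
      ∃ B : Matrix σ (Fin c) (MvPolynomial σ ℂ), ∀ r t,
        ∑ l, MvPolynomial.pderiv l (∑ i, MvPolynomial.C (a i) * f i r) * B l t -
          (if r = t then 1 else 0) ∈
        Ideal.span (Set.range fun r => ∑ i, MvPolynomial.C (a i) * f i r) := by
  obtain ⟨p, hp, B, A, hkey⟩ := exists_cleared_right_inverse hf
  refine ⟨p, hp, fun a ha => ?_⟩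
  let ν : MvPolynomial σ (MvPolynomial τ ℂ) →+* MvPolynomial σ ℂ :=
    MvPolynomial.map (MvPolynomial.eval a)
  refine ⟨Matrix.of fun l t => MvPolynomial.C (MvPolynomial.eval a p)⁻¹ * ν (B l t),
    fun r t => ?_⟩
  have h1 := congrArg (MvPolynomial.C (MvPolynomial.eval a p)⁻¹ * ν ·) (hkey r t)
  beta_reduce at h1
  have h2 : ∑ l, MvPolynomial.pderiv l (∑ i, MvPolynomial.C (a i) * f i r) *
      (Matrix.of fun l t => MvPolynomial.C (MvPolynomial.eval a p)⁻¹ * ν (B l t)) l t -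
        (if r = t then 1 else 0) = MvPolynomial.C (MvPolynomial.eval a p)⁻¹ *
          ν (∑ l, MvPolynomial.pderiv l (genericEquation f r) * B l t -
            (if r = t then MvPolynomial.C p else 0)) := by
    rw [map_sub, map_sum, mul_sub, Finset.mul_sum]
    congr 1
    · refine Finset.sum_congr rfl fun l _ => ?_
      rw [map_mul, ← map_genericEquation, MvPolynomial.pderiv_map, Matrix.of_apply]
      exact mul_left_comm _ _ _
    · by_cases hrt : r = t
      · rw [if_pos hrt, if_pos hrt]
        change _ = _ * MvPolynomial.map _ _
        rw [MvPolynomial.map_C, ← map_mul, inv_mul_cancel₀ ha, map_one]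
      · rw [if_neg hrt, if_neg hrt, map_zero, mul_zero]
  rw [h2, h1, map_sum, Finset.mul_sum]
  refine Ideal.sum_mem _ fun q _ => ?_
  rw [map_mul, ← mul_assoc]
  refine Ideal.mul_mem_left _ _ ?_
  change MvPolynomial.map _ _ ∈ _
  rw [map_genericEquation]
  exact Ideal.subset_span ⟨q, rfl⟩

theorem exists_surjective_ker_eq {A P : Type} [CommRing A] [CommRing P] [Algebra A P] (I : Ideal P) :
    ∃ (R : Type) (_ : CommRing R) (_ : Algebra A R) (π : P →ₐ[A] R), Function.Surjective π ∧
      RingHom.ker π = I :=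
  ⟨P ⧸ I, inferInstance, inferInstance, Ideal.Quotient.mkₐ A I, Ideal.Quotient.mk_surjective,
    Ideal.Quotient.mkₐ_ker A I⟩

/-- `R` is the incidence ring of parameters and zeros, and `Q` its localization where the
determinant of `J B₀` is invertible. `Q` is smooth over the parameters, so its image in the
parameter space is open, and it contains `a₀`. -/
theorem exists_span_ne_top_of_isLocalization {R Q : Type} [CommRing R] [CommRing Q]
    [Algebra (MvPolynomial τ ℂ) R] [Algebra (MvPolynomial τ ℂ) Q] [Algebra R Q]
    [IsScalarTower (MvPolynomial τ ℂ) R Q]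
    (π : MvPolynomial σ (MvPolynomial τ ℂ) →ₐ[MvPolynomial τ ℂ] R) (hπ : Function.Surjective π)
    (hker : RingHom.ker π = Ideal.span (Set.range (genericEquation f))) (B₀ : Matrix σ (Fin c) ℂ)
    [IsLocalization.Away (π ((Matrix.of fun r l => MvPolynomial.pderiv l (genericEquation f r)) *
      (B₀.map (algebraMap ℂ (MvPolynomial σ (MvPolynomial τ ℂ))))).det) Q] (a₀ : τ → ℂ) (y₀ : σ → ℂ)
    (h0 : ∀ r, MvPolynomial.eval y₀ (∑ i, MvPolynomial.C (a₀ i) * f i r) = 0)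
    (hB₀ : ∀ r t, ∑ l, MvPolynomial.eval y₀
      (MvPolynomial.pderiv l (∑ i, MvPolynomial.C (a₀ i) * f i r)) * B₀ l t = if r = t then 1 else 0) :
    ∃ p : MvPolynomial τ ℂ, p ≠ 0 ∧ ∀ a, MvPolynomial.eval a p ≠ 0 →
      Ideal.span (Set.range fun r => ∑ i, MvPolynomial.C (a i) * f i r) ≠ ⊤ := by
  classical
  let P := MvPolynomial σ (MvPolynomial τ ℂ)
  let J : Matrix (Fin c) σ P := Matrix.of fun r l => MvPolynomial.pderiv l (genericEquation f r)
  let B₁ : Matrix σ (Fin c) P := B₀.map (algebraMap ℂ P)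
  let h : R := π (J * B₁).det
  let α : P →ₐ[MvPolynomial τ ℂ] Q := (IsScalarTower.toAlgHom (MvPolynomial τ ℂ) R Q).comp π
  have hsm : Algebra.Smooth (MvPolynomial τ ℂ) Q :=
    smooth_of_isLocalization_det (genericEquation f) π hπ hker B₁
  have hopen : IsOpenMap (PrimeSpectrum.comap (algebraMap (MvPolynomial τ ℂ) Q)) :=
    PrimeSpectrum.isOpenMap_comap_of_hasGoingDown_of_finitePresentation
  let ev₀ : P →+* ℂ := (MvPolynomial.eval y₀).comp (MvPolynomial.map (MvPolynomial.eval a₀))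
  have hev₀ (r) : ev₀ (genericEquation f r) = 0 := by
    change MvPolynomial.eval y₀ (MvPolynomial.map _ _) = 0
    rw [map_genericEquation, h0]
  obtain ⟨ev₁, hev₁'⟩ : ∃ ev₁ : R →+* ℂ, ∀ x, ev₁ (π x) = ev₀ x := by
    have hle : RingHom.ker (π : P →+* R) ≤ RingHom.ker ev₀ := by
      refine hker.le.trans ?_
      rw [Ideal.span_le]
      rintro _ ⟨r, rfl⟩
      exact hev₀ r
    exact ⟨RingHom.liftOfSurjective (π : P →+* R) hπ ⟨ev₀, hle⟩,
      fun x => RingHom.liftOfRightInverse_comp_apply _ _ _ ⟨ev₀, hle⟩ x⟩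
  -- At `(a₀, y₀)` the matrix `J B₀` is the identity, so this point survives in the localization.
  have hev₁ : ev₁ h = 1 := by
    rw [hev₁', RingHom.map_det, RingHom.mapMatrix_apply]
    have h1 : (J * B₁).map ev₀ = 1 := by
      refine Matrix.ext fun r t => ?_
      rw [Matrix.map_apply, Matrix.mul_apply, map_sum, Matrix.one_apply, ← hB₀ r t]
      refine Finset.sum_congr rfl fun l _ => ?_
      rw [map_mul, ← map_genericEquation, MvPolynomial.pderiv_map]
      congr 1
      change MvPolynomial.eval y₀ (MvPolynomial.map (MvPolynomial.eval a₀)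
        (MvPolynomial.C (MvPolynomial.C (B₀ l t)))) = _
      simp
    rw [h1, Matrix.det_one]
  let ev₂ : Q →+* ℂ := IsLocalization.Away.lift (g := ev₁) h (by rw [hev₁]; exact isUnit_one)
  have hev₂ : ev₂.comp (algebraMap (MvPolynomial τ ℂ) Q) = MvPolynomial.eval a₀ := by
    refine RingHom.ext fun q => ?_
    have h1 : ev₂ (algebraMap R Q (algebraMap (MvPolynomial τ ℂ) R q)) =
      ev₁ (algebraMap (MvPolynomial τ ℂ) R q) := IsLocalization.Away.lift_eq h _ _
    rw [← IsScalarTower.algebraMap_apply, ← π.commutes, hev₁'] at h1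
    refine h1.trans ?_
    change MvPolynomial.eval y₀ (MvPolynomial.map (MvPolynomial.eval a₀) (MvPolynomial.C q)) = _
    simp
  let pt (a : τ → ℂ) : PrimeSpectrum (MvPolynomial τ ℂ) :=
    ⟨RingHom.ker (MvPolynomial.eval a), RingHom.ker_isPrime _⟩
  have hpt : pt a₀ ∈ Set.range (PrimeSpectrum.comap (algebraMap (MvPolynomial τ ℂ) Q)) := by
    refine ⟨⟨RingHom.ker ev₂, RingHom.ker_isPrime _⟩, PrimeSpectrum.ext ?_⟩
    change Ideal.comap _ (RingHom.ker ev₂) = RingHom.ker _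
    rw [RingHom.comap_ker, hev₂]
  obtain ⟨_, ⟨p, rfl⟩, hp, hsub⟩ := PrimeSpectrum.isTopologicalBasis_basic_opens.exists_subset_of_mem_open
    hpt hopen.isOpen_range
  refine ⟨p, fun hp0 => ?_, fun a ha htop => ?_⟩
  · rw [hp0] at hp
    simp at hp
  -- A prime `q` of `Q` lies over the parameter `a`. An identity `1 = ∑ H r * F r` in the fibre
  -- lifts modulo the ideal of `a`, which goes into `q`; the equations are zero in `Q`, so `1` would
  -- lie in `q`.
  · obtain ⟨q, hq⟩ := hsub (show pt a ∈ PrimeSpectrum.basicOpen p from ha)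
    have hq' (x) (hx : MvPolynomial.eval a x = 0) : algebraMap (MvPolynomial τ ℂ) Q x ∈ q.asIdeal := by
      have h1 : x ∈ (pt a).asIdeal := hx
      rw [← hq] at h1
      exact h1
    obtain ⟨H, hH⟩ := Ideal.mem_span_range_iff_exists_fun.1 ((Ideal.eq_top_iff_one _).1 htop)
    let ν : P →+* MvPolynomial σ ℂ := MvPolynomial.map (MvPolynomial.eval a)
    have hν : Function.Surjective ν := MvPolynomial.map_surjective _ fun z =>
      ⟨MvPolynomial.C z, MvPolynomial.eval_C z⟩
    choose H' hH' using fun r => hν (H r)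
    have h1 : 1 - ∑ r, H' r * genericEquation f r ∈ RingHom.ker ν := by
      rw [RingHom.mem_ker, map_sub, map_one, map_sum, ← hH, sub_eq_zero]
      refine Finset.sum_congr rfl fun r _ => ?_
      rw [map_mul, hH']
      congr 1
      exact (map_genericEquation a r).symm
    rw [MvPolynomial.ker_map] at h1
    have h2 : (RingHom.ker (MvPolynomial.eval a)).map (MvPolynomial.C (σ := σ)) ≤
        q.asIdeal.comap α := by
      rw [Ideal.map_le_iff_le_comap]
      intro x hx
      change α (algebraMap _ P x) ∈ q.asIdeal
      rw [α.commutes]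
      exact hq' x hx
    have h3 : α (1 - ∑ r, H' r * genericEquation f r) ∈ q.asIdeal := h2 h1
    have h4 (r) : α (genericEquation f r) = 0 := by
      change algebraMap R Q (π _) = 0
      have h5 : genericEquation f r ∈ RingHom.ker π := hker ▸ Ideal.subset_span ⟨r, rfl⟩
      rw [RingHom.mem_ker.1 h5, map_zero]
    simp only [map_sub, map_one, map_sum, map_mul, h4, mul_zero, Finset.sum_const_zero, sub_zero] at h3
    exact q.2.one_notMem h3

/-- If some member of a linear system has a zero at which its Jacobian matrix has maximal rank, then
the general member has a zero. -/
theorem exists_span_ne_top (a₀ : τ → ℂ) (y₀ : σ → ℂ)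
    (h0 : ∀ r, MvPolynomial.eval y₀ (∑ i, MvPolynomial.C (a₀ i) * f i r) = 0)
    (B₀ : Matrix σ (Fin c) ℂ) (hB₀ : ∀ r t, ∑ l, MvPolynomial.eval y₀
      (MvPolynomial.pderiv l (∑ i, MvPolynomial.C (a₀ i) * f i r)) * B₀ l t = if r = t then 1 else 0) :
    ∃ p : MvPolynomial τ ℂ, p ≠ 0 ∧ ∀ a, MvPolynomial.eval a p ≠ 0 →
      Ideal.span (Set.range fun r => ∑ i, MvPolynomial.C (a i) * f i r) ≠ ⊤ := by
  obtain ⟨R, _, _, π, hπ, hker⟩ := exists_surjective_ker_eq (A := MvPolynomial τ ℂ)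
    (Ideal.span (Set.range (genericEquation f)))
  obtain ⟨h, hh⟩ : ∃ h : R, h = π ((Matrix.of fun r l => MvPolynomial.pderiv l
      (genericEquation f r)) * (B₀.map (algebraMap ℂ (MvPolynomial σ (MvPolynomial τ ℂ))))).det :=
    ⟨_, rfl⟩
  obtain ⟨Q, _, _, hQ⟩ : ∃ (Q : Type) (_ : CommRing Q) (_ : Algebra R Q), IsLocalization.Away h Q :=
    ⟨Localization.Away h, inferInstance, inferInstance, inferInstance⟩
  let : Algebra (MvPolynomial τ ℂ) Q :=
    ((algebraMap R Q).comp (algebraMap (MvPolynomial τ ℂ) R)).toAlgebra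
  have : IsScalarTower (MvPolynomial τ ℂ) R Q := IsScalarTower.of_algebraMap_eq fun _ => rfl
  rw [hh] at hQ
  exact exists_span_ne_top_of_isLocalization (Q := Q) π hπ hker B₀ a₀ y₀ h0 hB₀

end Bertini

/-! ### Krull dimension of a complete intersection satisfying the Jacobian criterion. -/

section Dimension

variable {σ : Type} [Fintype σ] {c : ℕ}

/-- The maximal ideal of a point of affine space. -/
def pointIdeal (y : σ → ℂ) : Ideal (MvPolynomial σ ℂ) := RingHom.ker (MvPolynomial.eval y)

instance (y : σ → ℂ) : (pointIdeal y).IsMaximal :=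
  RingHom.ker_isMaximal_of_surjective _ fun z => ⟨MvPolynomial.C z, MvPolynomial.eval_C z⟩

theorem exists_eq_pointIdeal (m : Ideal (MvPolynomial σ ℂ)) (hm : m.IsMaximal) :
    ∃ y, m = pointIdeal y := by
  obtain ⟨y, rfl⟩ := MvPolynomial.isMaximal_iff_eq_vanishingIdeal_singleton.1 hm
  refine ⟨y, Ideal.ext fun p => ?_⟩
  rw [MvPolynomial.mem_vanishingIdeal_singleton_iff, pointIdeal, RingHom.mem_ker,
    MvPolynomial.aeval_eq_eval]

theorem height_pointIdeal_eq (y y' : σ → ℂ) : (pointIdeal y).height = (pointIdeal y').height := by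
  let t (z : σ → ℂ) : MvPolynomial σ ℂ →ₐ[ℂ] MvPolynomial σ ℂ :=
    MvPolynomial.aeval fun l => MvPolynomial.X l + MvPolynomial.C (z l)
  have ht (z z' : σ → ℂ) (h : z + z' = 0) : (t z).comp (t z') = AlgHom.id ℂ _ :=
    MvPolynomial.algHom_ext fun l => by
      have h1 : z l + z' l = 0 := congrFun h l
      simp only [t, AlgHom.comp_apply, MvPolynomial.aeval_X, map_add, MvPolynomial.aeval_C,
        AlgHom.id_apply, MvPolynomial.algebraMap_eq]
      rw [add_assoc, ← map_add, h1, map_zero, add_zero]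
  let e : MvPolynomial σ ℂ ≃ₐ[ℂ] MvPolynomial σ ℂ :=
    AlgEquiv.ofAlgHom (t (y' - y)) (t (y - y')) (ht _ _ (by simp)) (ht _ _ (by simp))
  rw [← RingEquiv.height_comap e.toRingEquiv (pointIdeal y)]
  congr 1
  have h1 : (MvPolynomial.aeval y : MvPolynomial σ ℂ →ₐ[ℂ] ℂ).comp (t (y' - y)) =
      MvPolynomial.aeval y' := MvPolynomial.algHom_ext fun l => by simp [t]
  ext p
  have h2 := DFunLike.congr_fun h1 p
  rw [AlgHom.comp_apply, MvPolynomial.aeval_eq_eval, MvPolynomial.aeval_eq_eval] at h2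
  change MvPolynomial.eval y (t (y' - y) p) = 0 ↔ MvPolynomial.eval y' p = 0
  exact iff_of_eq (congrArg (· = 0) h2)

/-- Translations permute the points, so all maximal ideals have the same height, and the supremum of
these heights is the dimension of the polynomial ring. -/
theorem height_pointIdeal (y : σ → ℂ) : (pointIdeal y).height = Fintype.card σ := by
  have h1 := Ideal.sup_isMaximal_height_eq_ringKrullDim (R := MvPolynomial σ ℂ)
  rw [MvPolynomial.ringKrullDim_of_isNoetherianRing, ringKrullDim_eq_zero_of_field, zero_add,
    Nat.card_eq_fintype_card] at h1
  have h2 : (⨆ (I : Ideal (MvPolynomial σ ℂ)) (_ : I.IsMaximal), I.height) =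
      (pointIdeal y).height := by
    refine le_antisymm (iSup₂_le fun I hI => ?_) (le_iSup₂_of_le (pointIdeal y) inferInstance le_rfl)
    obtain ⟨y', rfl⟩ := exists_eq_pointIdeal I hI
    exact (height_pointIdeal_eq _ _).le
  rw [h2] at h1
  exact_mod_cast h1

theorem eval_taylor (y : σ → ℂ) (p : MvPolynomial σ ℂ) :
    p - MvPolynomial.C (MvPolynomial.eval y p) - ∑ l, MvPolynomial.C (MvPolynomial.eval y
      (MvPolynomial.pderiv l p)) * (MvPolynomial.X l - MvPolynomial.C (y l)) ∈ pointIdeal y ^ 2 := by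
  rw [← Ideal.Quotient.eq_zero_iff_mem]
  let Q := MvPolynomial σ ℂ ⧸ pointIdeal y ^ 2
  let π : MvPolynomial σ ℂ →ₐ[ℂ] Q := Ideal.Quotient.mkₐ ℂ _
  let I := (pointIdeal y).map π
  have hI : I ^ 2 = ⊥ := by
    rw [← Ideal.map_pow]
    exact Ideal.map_quotient_self _
  have h1 := aeval_add_of_sq_zero (A := ℂ) hI (fun l => algebraMap ℂ Q (y l))
    (ε := fun l => π (MvPolynomial.X l - MvPolynomial.C (y l)))
    (fun l => Ideal.mem_map_of_mem _ (by simp [pointIdeal])) p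
  have h2 : (MvPolynomial.aeval ((fun l => algebraMap ℂ Q (y l)) +
      fun l => π (MvPolynomial.X l - MvPolynomial.C (y l)))) = π :=
    MvPolynomial.algHom_ext fun l => by
      rw [MvPolynomial.aeval_X, Pi.add_apply, map_sub, ← MvPolynomial.algebraMap_eq, π.commutes]
      exact add_sub_cancel _ _
  have h3 (q : MvPolynomial σ ℂ) : MvPolynomial.aeval (fun l => algebraMap ℂ Q (y l)) q =
      π (MvPolynomial.C (MvPolynomial.eval y q)) := by
    rw [← MvPolynomial.algebraMap_eq, π.commutes]
    refine (MvPolynomial.aeval_algebraMap_apply Q y q).trans ?_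
    rw [MvPolynomial.aeval_eq_eval]
  rw [h2] at h1
  simp only [h3, ← map_mul, ← map_sum, ← map_add] at h1
  change π _ = 0
  rw [sub_sub, map_sub, sub_eq_zero, h1]

variable {Q : Type} [CommRing Q] [Algebra ℂ Q]

/-- `1 - B J` projects onto the kernel of `J`, which has dimension `d`; factor it through a basis of
that kernel. -/
theorem exists_factorization [DecidableEq σ] {J : Matrix (Fin c) σ ℂ} {B : Matrix σ (Fin c) ℂ} (h : J * B = 1)
    {d : ℕ} (hd : d + c = Fintype.card σ) :
    ∃ (U : Matrix σ (Fin d) ℂ) (V : Matrix (Fin d) σ ℂ), U * V + B * J = (1 : Matrix σ σ ℂ) := by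
  have hsurj : LinearMap.range J.mulVecLin = ⊤ := by
    rw [LinearMap.range_eq_top]
    intro v
    exact ⟨B *ᵥ v, by simp [h]⟩
  have hk : Module.finrank ℂ (LinearMap.ker J.mulVecLin) = d := by
    have := LinearMap.finrank_range_add_finrank_ker J.mulVecLin
    rw [hsurj, finrank_top] at this
    simp at this
    omega
  let b := Module.finBasisOfFinrankEq ℂ (LinearMap.ker J.mulVecLin) hk
  let E : Matrix σ σ ℂ := 1 - B * J
  have hE (l) : (fun i => E i l) ∈ LinearMap.ker J.mulVecLin := by
    rw [LinearMap.mem_ker]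
    have h1 : J * E = 0 := by
      rw [Matrix.mul_sub, Matrix.mul_one, ← Matrix.mul_assoc, h, Matrix.one_mul, sub_self]
    funext r
    exact congrFun (congrFun h1 r) l
  refine ⟨Matrix.of fun i j => (b j : σ → ℂ) i, Matrix.of fun j l => b.repr ⟨_, hE l⟩ j, ?_⟩
  rw [← eq_sub_iff_add_eq]
  ext i l
  have h1 := congrArg (fun v : LinearMap.ker J.mulVecLin => (v : σ → ℂ) i) (b.sum_repr ⟨_, hE l⟩)
  simp only [Submodule.coe_sum, Submodule.coe_smul, Finset.sum_apply, Pi.smul_apply, smul_eq_mul] at h1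
  rw [Matrix.mul_apply]
  refine Eq.trans ?_ h1
  exact Finset.sum_congr rfl fun j _ => mul_comm _ _

/-- Nakayama in the domain `Q / q`: the image of `m` equals its square, so it is killed by some
element congruent to `1` modulo it, which is nonzero because `m` is proper. -/
theorem le_of_le_sup_mul_self {m q : Ideal Q} [q.IsPrime] (hm : m ≠ ⊤) (hfg : m.FG) (hqm : q ≤ m)
    (h : m ≤ q ⊔ m * m) : m ≤ q := by
  let n := m.map (Ideal.Quotient.mk q)
  have hn : n ≤ n • n := by
    have h1 := Ideal.map_mono (f := Ideal.Quotient.mk q) h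
    rwa [Ideal.map_sup, Ideal.map_quotient_self, bot_sup_eq, Ideal.map_mul] at h1
  obtain ⟨r, hr, hr'⟩ := Submodule.exists_sub_one_mem_and_smul_eq_zero_of_fg_of_le_smul n n
    (hfg.map _) hn
  intro a ha
  rw [← Ideal.Quotient.eq_zero_iff_mem]
  have h1 := hr' _ (Ideal.mem_map_of_mem (Ideal.Quotient.mk q) ha)
  refine (mul_eq_zero.1 h1).resolve_left fun hr0 => hm ?_
  rw [hr0, zero_sub, neg_mem_iff] at hr
  rw [Ideal.eq_top_iff_one]
  have h2 : (1 : Q) ∈ n.comap (Ideal.Quotient.mk q) := by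
    rw [Ideal.mem_comap, map_one]
    exact hr
  rwa [Ideal.comap_map_of_surjective' _ Ideal.Quotient.mk_surjective, Ideal.mk_ker,
    sup_eq_left.2 hqm] at h2

/-- Upper bound: modulo `m²` a maximal ideal `m` is generated by `d` elements, so it is a minimal
prime over them and Krull's height theorem applies. Lower bound: a point of affine space has height
`d + c`, and `c` equations lower the dimension by at most `c`. -/
theorem ringKrullDim_eq_of_jacobian [Nontrivial Q] (f : Fin c → MvPolynomial σ ℂ)
    (π : MvPolynomial σ ℂ →ₐ[ℂ] Q) (hπ : Function.Surjective π)
    (hker : RingHom.ker π = Ideal.span (Set.range f)) (hB : ∃ B : Matrix σ (Fin c) Q,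
      (Matrix.of fun r l => π (MvPolynomial.pderiv l (f r))) * B = 1)
    {d : ℕ} (hd : d + c = Fintype.card σ) : ringKrullDim Q = d := by
  classical
  have : IsNoetherianRing Q := isNoetherianRing_of_surjective _ _ (π : MvPolynomial σ ℂ →+* Q) hπ
  have hmax (m : Ideal Q) (hm : m.IsMaximal) :
      ∃ y, m.comap π = pointIdeal y ∧ ∀ r, MvPolynomial.eval y (f r) = 0 := by
    obtain ⟨y, hy⟩ := exists_eq_pointIdeal _ (Ideal.comap_isMaximal_of_surjective π hπ (K := m))
    refine ⟨y, hy, fun r => ?_⟩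
    have h1 : f r ∈ m.comap π := by
      have h2 : f r ∈ RingHom.ker π := hker ▸ Ideal.subset_span ⟨r, rfl⟩
      rw [Ideal.mem_comap, RingHom.mem_ker.1 h2]
      exact m.zero_mem
    rw [hy] at h1
    exact h1
  refine le_antisymm ((ringKrullDim_le_iff_isMaximal_height_le _).2 fun m hm => ?_) ?_
  · obtain ⟨y, hy, hfy⟩ := hmax m hm
    obtain ⟨B, hB⟩ := hB
    choose B' hB' using fun l t => hπ (B l t)
    let J₀ : Matrix (Fin c) σ ℂ := Matrix.of fun r l => MvPolynomial.eval y (MvPolynomial.pderiv l (f r))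
    let B₀ : Matrix σ (Fin c) ℂ := Matrix.of fun l t => MvPolynomial.eval y (B' l t)
    have hJB : J₀ * B₀ = 1 := by
      ext r t
      have h1 := congrFun (congrFun hB r) t
      rw [Matrix.mul_apply] at h1
      simp only [← hB', Matrix.of_apply, ← map_mul, ← map_sum] at h1
      have h2 : (∑ l, MvPolynomial.pderiv l (f r) * B' l t) -
          MvPolynomial.C ((1 : Matrix (Fin c) (Fin c) ℂ) r t) ∈ pointIdeal y := by
        rw [← hy, Ideal.mem_comap, map_sub, h1]
        convert m.zero_mem
        rw [sub_eq_zero, Matrix.one_apply, Matrix.one_apply]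
        split_ifs <;> simp
      rw [pointIdeal, RingHom.mem_ker, map_sub, map_sum, MvPolynomial.eval_C, sub_eq_zero] at h2
      rw [← h2, Matrix.mul_apply]
      exact Finset.sum_congr rfl fun l _ => by rw [map_mul]; rfl
    obtain ⟨U, V, hUV⟩ := exists_factorization hJB hd
    let x (l : σ) : Q := π (MvPolynomial.X l - MvPolynomial.C (y l))
    let z (j : Fin d) : Q := ∑ l, algebraMap ℂ Q (V j l) * x l
    have hmap : (pointIdeal y).map π = m := by
      rw [← hy]
      exact Ideal.map_comap_of_surjective π hπ m
    -- The linear part of the equation `f r` at the point vanishes modulo `m²`, because `f r` itself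
    -- is zero in `Q`.
    have hJx (r) : ∑ l, algebraMap ℂ Q (J₀ r l) * x l ∈ m ^ 2 := by
      have h1 := Ideal.mem_map_of_mem π (eval_taylor y (f r))
      rw [Ideal.map_pow, hmap, hfy, map_zero, sub_zero, map_sub] at h1
      have h2 : f r ∈ RingHom.ker π := hker ▸ Ideal.subset_span ⟨r, rfl⟩
      rw [RingHom.mem_ker.1 h2, zero_sub, neg_mem_iff, map_sum] at h1
      convert h1 using 2 with l
      rw [map_mul, ← MvPolynomial.algebraMap_eq, π.commutes]
      rfl
    have hx (l) : x l ∈ Ideal.span (Set.range z) ⊔ m ^ 2 := by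
      have h1 : x l = ∑ j, algebraMap ℂ Q (U l j) * z j +
          ∑ r, algebraMap ℂ Q (B₀ l r) * ∑ l', algebraMap ℂ Q (J₀ r l') * x l' := by
        have h2 (l') : algebraMap ℂ Q ((1 : Matrix σ σ ℂ) l l') * x l' =
            ∑ j, algebraMap ℂ Q (U l j) * (algebraMap ℂ Q (V j l') * x l') +
              ∑ r, algebraMap ℂ Q (B₀ l r) * (algebraMap ℂ Q (J₀ r l') * x l') := by
          rw [← hUV, Matrix.add_apply, Matrix.mul_apply, Matrix.mul_apply, map_add, map_sum, map_sum,
            add_mul, Finset.sum_mul, Finset.sum_mul]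
          simp only [map_mul, mul_assoc]
        have h3 := Finset.sum_congr (s₁ := Finset.univ) rfl fun l' _ => h2 l'
        rw [Finset.sum_add_distrib, Finset.sum_comm, add_comm, Finset.sum_comm, add_comm] at h3
        simp only [z, Finset.mul_sum]
        rw [← h3, Finset.sum_eq_single l]
        · simp
        · intro b _ hb
          simp [Matrix.one_apply_ne hb.symm]
        · simp
      rw [h1]
      refine add_mem (Ideal.mem_sup_left (Ideal.sum_mem _ fun j _ => Ideal.mul_mem_left _ _
        (Ideal.subset_span ⟨j, rfl⟩))) (Ideal.mem_sup_right (Ideal.sum_mem _ fun r _ =>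
          Ideal.mul_mem_left _ _ (hJx r)))
    have hmz : m ≤ Ideal.span (Set.range z) ⊔ m ^ 2 := by
      intro a ha
      obtain ⟨p, rfl⟩ := hπ a
      have hp : p ∈ pointIdeal y := hy ▸ ha
      have h1 := Ideal.mem_map_of_mem π (eval_taylor y p)
      rw [Ideal.map_pow, hmap, RingHom.mem_ker.1 hp, map_zero, sub_zero, map_sub] at h1
      rw [← sub_add_cancel (π p)]
      refine add_mem (Ideal.mem_sup_right h1) ?_
      rw [map_sum]
      refine Ideal.sum_mem _ fun l _ => ?_
      rw [map_mul]
      exact Ideal.mul_mem_left _ _ (hx l)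
    have hzm : Ideal.span (Set.range z) ≤ m := by
      rw [Ideal.span_le]
      rintro _ ⟨j, rfl⟩
      refine Ideal.sum_mem _ fun l _ => Ideal.mul_mem_left _ _ ?_
      rw [← hmap]
      exact Ideal.mem_map_of_mem _ (by simp [pointIdeal])
    have hmin : m ∈ (Ideal.span (Set.range z)).minimalPrimes := by
      refine ⟨⟨hm.isPrime, hzm⟩, fun q hq hqm => ?_⟩
      have : q.IsPrime := hq.1
      have h1 : m ≤ q ⊔ m * m := by
        rw [← pow_two]
        exact hmz.trans (sup_le_sup_right hq.2 _)
      exact le_of_le_sup_mul_self hm.ne_top (IsNoetherian.noetherian m) hqm h1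
    have hh := Ideal.height_le_card_of_mem_minimalPrimes_span (Set.finite_range z) hmin
    have hcard : (Set.range z).ncard ≤ d := by
      rw [← Set.image_univ]
      refine (Set.ncard_image_le (Set.finite_univ)).trans ?_
      simp
    exact_mod_cast hh.trans (by exact_mod_cast hcard)
  · obtain ⟨m, hm⟩ := Ideal.exists_maximal Q
    obtain ⟨y, hy, hfy⟩ := hmax m hm
    have h1 := Ideal.height_le_ringKrullDim_quotient_add_encard (p := pointIdeal y) (Set.range f)
      (by rintro _ ⟨r, rfl⟩; exact hfy r)
    rw [height_pointIdeal, ← hker] at h1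
    have h2 : ringKrullDim (MvPolynomial σ ℂ ⧸ RingHom.ker π) = ringKrullDim Q :=
      ringKrullDim_eq_of_ringEquiv (RingHom.quotientKerEquivOfSurjective (f := (π : MvPolynomial σ ℂ →+* Q)) hπ)
    rw [h2, ← hd] at h1
    have h3 : (Set.range f).encard ≤ c := by
      rw [← Set.image_univ]
      refine (Set.encard_image_le _ _).trans ?_
      simp
    have h4 : ((d + c : ℕ) : WithBot ℕ∞) ≤ ringKrullDim Q + c :=
      h1.trans (add_le_add_right (by exact_mod_cast h3) _)
    obtain ⟨e, he⟩ := WithBot.ne_bot_iff_exists.1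
      (ne_bot_of_le_ne_bot WithBot.coe_ne_bot (ringKrullDim_nonneg_of_nontrivial (R := Q)))
    rw [← he] at h4 ⊢
    have h5 : ((d : ℕ∞) + c) ≤ e + c := by exact_mod_cast h4
    exact_mod_cast (ENat.add_le_add_iff_right (ENat.natCast_ne_top c)).1 h5

end Dimension

/-! ### Rank of the differentials and relative dimension. -/

section RelativeDimension

variable {R : Type} [CommRing R] [Algebra ℂ R] {σ : Type} [Fintype σ] {c d : ℕ} {y : σ → R}
  {J : Fin c → σ → R}

/-- The right inverse splits the presentation, giving `R^σ ≅ Ω ⊕ R^c`; the ranks are compared by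
cancellation. -/
theorem IsCoord.rank_kaehlerDifferential [Nontrivial R] [Module.Free R (Ω[R⁄ℂ])]
    (h : IsCoord y J) (hd : d + c = Fintype.card σ) : Module.rank R (Ω[R⁄ℂ]) = d := by
  obtain ⟨B, hB⟩ := h.right_inv
  let φ : (σ → R) →ₗ[R] Ω[R⁄ℂ] := Fintype.linearCombination R fun l => KaehlerDifferential.D ℂ R (y l)
  let ρ : (σ → R) →ₗ[R] (Fin c → R) := B.vecMulLinear
  have hφ (v) : φ v = 0 ↔ v ∈ Submodule.span R (Set.range J) := h.rel v
  have hρ (w : Fin c → R) : ρ (w ᵥ* Matrix.of J) = w := by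
    change (w ᵥ* Matrix.of J) ᵥ* B = w
    rw [Matrix.vecMul_vecMul, hB, Matrix.vecMul_one]
  have hspan (v) : v ∈ Submodule.span R (Set.range J) ↔ ∃ w : Fin c → R, w ᵥ* Matrix.of J = v := by
    rw [Submodule.mem_span_range_iff_exists_fun]
    refine exists_congr fun w => ?_
    rw [Matrix.vecMul_eq_sum]
    rfl
  have hbij : Function.Bijective (φ.prod ρ) := by
    constructor
    · rw [injective_iff_map_eq_zero]
      intro v hv
      obtain ⟨h1, h2⟩ := Prod.mk_eq_zero.1 hv
      obtain ⟨w, rfl⟩ := (hspan v).1 ((hφ v).1 h1)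
      rw [hρ] at h2
      rw [h2, Matrix.zero_vecMul]
    · rintro ⟨ω, w⟩
      obtain ⟨v, rfl⟩ := h.exists_sum ω
      refine ⟨v + (w - ρ v) ᵥ* Matrix.of J, Prod.ext ?_ ?_⟩
      · change φ (v + _) = _
        rw [map_add, (hφ _).2 ((hspan _).2 ⟨_, rfl⟩), add_zero]
        rfl
      · change ρ (v + _) = w
        rw [map_add, hρ, add_sub_cancel]
  have h1 := (LinearEquiv.ofBijective _ hbij).rank_eq
  rw [rank_prod', rank_fun', rank_fun', ← hd, Fintype.card_fin, Nat.cast_add] at h1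
  exact (Cardinal.add_nat_inj c).1 h1.symm

/-- A smooth algebra is standard smooth near every prime; the relative dimension there is the rank
of the differentials, and the coordinates localize. -/
theorem locally_isStandardSmoothOfRelativeDimension [Algebra.Smooth ℂ R] (h : IsCoord y J)
    (hd : d + c = Fintype.card σ) :
    RingHom.Locally (RingHom.IsStandardSmoothOfRelativeDimension d) (algebraMap ℂ R) := by
  choose f hf₁ hf₂ using fun p : PrimeSpectrum R =>
    Algebra.IsSmoothAt.exists_notMem_isStandardSmooth ℂ p.asIdeal
  refine ⟨Set.range f, ?_, ?_⟩
  · by_contra htop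
    obtain ⟨m, hm, hle⟩ := Ideal.exists_le_maximal _ htop
    exact hf₁ ⟨m, hm.isPrime⟩ (hle (Ideal.subset_span ⟨_, rfl⟩))
  · rintro _ ⟨p, rfl⟩
    have := hf₂ p
    have hnt : Nontrivial (Localization.Away (f p)) := by
      rw [← not_subsingleton_iff_nontrivial, IsLocalization.subsingleton_iff (M := Submonoid.powers (f p))]
      rintro ⟨k, hk⟩
      have hk' : f p ^ k = 0 := hk
      exact hf₁ p (p.2.mem_of_pow_mem k (by rw [hk']; exact p.asIdeal.zero_mem))
    let u : R →ₐ[ℂ] Localization.Away (f p) := IsScalarTower.toAlgHom ℂ R _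
    have h1 := h.map u (f p) (by
      have h2 : u.toRingHom.toAlgebra = (inferInstance : Algebra R (Localization.Away (f p))) :=
        Algebra.algebra_ext _ _ fun _ => rfl
      rw [h2]
      infer_instance)
    have h3 : Algebra.IsStandardSmoothOfRelativeDimension d ℂ (Localization.Away (f p)) :=
      (Algebra.IsStandardSmoothOfRelativeDimension.iff_of_isStandardSmooth d).2
        (h1.rank_kaehlerDifferential hd)
    have h4 : (algebraMap R (Localization.Away (f p))).comp (algebraMap ℂ R) =
        algebraMap ℂ (Localization.Away (f p)) := (IsScalarTower.algebraMap_eq _ _ _).symm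
    rw [h4]
    exact (RingHom.isStandardSmoothOfRelativeDimension_algebraMap d).2 h3

end RelativeDimension

/-! ### From affine charts to the global scheme. -/

section Subscheme

variable {n K C c d : ℕ} {s : Set (MatPoly n K)} {F : Frame n K C → Fin c → ChartPoly K C}

/-- The standard affine cover of a closed subscheme of a Grassmannian. -/
def subschemeCover (s : Set (MatPoly n K)) : (Proj (coordGrading s)).AffineOpenCover :=
  Proj.affineOpenCoverOfIrrelevantLESpan (coordGrading s) (pluckerCoord s) (pluckerCoord_mem s)
    (fun _ => Nat.one_pos) (by
      classical
      intro z hz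
      rw [← DirectSum.sum_support_decompose (coordGrading s) z]
      refine Ideal.sum_mem _ fun i _ => ?_
      rcases Nat.eq_zero_or_pos i with rfl | hi
      · have h0 : (DirectSum.decompose (coordGrading s) z 0 : CoordRing s) = 0 := hz
        rw [h0]
        exact Ideal.zero_mem _
      · exact mem_span_pluckerCoord s hi (SetLike.coe_mem _))

theorem subschemeCover_comp (s : Set (MatPoly n K)) (I : Fin K ↪o Fin n) :
    (subschemeCover s).f I ≫ subschemeToSpec s = Spec.map (CommRingCat.ofHom
      (algebraMap ℂ (Away (coordGrading s) (pluckerCoord s I)))) := by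
  change Proj.awayι _ _ _ _ ≫ Proj.toSpecZero _ ≫ _ = _
  rw [Proj.awayι_toSpecZero_assoc, ← Spec.map_comp]
  rfl

theorem smoothOfRelativeDimension_subscheme (s : Set (MatPoly n K)) (h : ∀ I, RingHom.Locally
    (RingHom.IsStandardSmoothOfRelativeDimension d)
      (algebraMap ℂ (Away (coordGrading s) (pluckerCoord s I)))) :
    SmoothOfRelativeDimension d (subschemeToSpec s) := by
  have : IsZariskiLocalAtSource (@SmoothOfRelativeDimension.{0} d) :=
    HasRingHomProperty.instIsZariskiLocalAtSource
      (Q := RingHom.Locally (RingHom.IsStandardSmoothOfRelativeDimension d))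
  refine (IsZariskiLocalAtSource.iff_of_openCover (P := @SmoothOfRelativeDimension.{0} d)
    (subschemeCover s).openCover).2 fun I => ?_
  have h1 := (HasRingHomProperty.Spec_iff (P := @SmoothOfRelativeDimension.{0} d)
    (Q := RingHom.Locally (RingHom.IsStandardSmoothOfRelativeDimension d))
    (φ := CommRingCat.ofHom (algebraMap ℂ (Away (coordGrading s) (pluckerCoord s I))))).2 (h I)
  exact (congrArg (fun f => SmoothOfRelativeDimension d f) (subschemeCover_comp s I)).mpr h1

/-- The dimension is the supremum of the coheights of points. These count generizations, so they can
be computed in any chart containing the point. The lower bound comes from one nonempty chart. -/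
theorem topologicalKrullDim_subscheme (s : Set (MatPoly n K))
    (h : ∀ I, Nontrivial (Away (coordGrading s) (pluckerCoord s I)) →
      ringKrullDim (Away (coordGrading s) (pluckerCoord s I)) = d)
    (hne : ∃ I, Nontrivial (Away (coordGrading s) (pluckerCoord s I))) :
    topologicalKrullDim (subscheme s) = d := by
  refine le_antisymm ?_ ?_
  · rw [topologicalKrullDim, Order.krullDim_eq_of_orderIso
      (irreducibleSetEquivPoints (α := subscheme s)), Order.krullDim_eq_iSup_coheight]
    refine iSup_le fun x => ?_
    obtain ⟨y, hy⟩ := (subschemeCover s).covers x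
    rw [← hy]
    generalize (subschemeCover s).idx x = I at y
    have hI : Nontrivial (Away (coordGrading s) (pluckerCoord s I)) :=
      PrimeSpectrum.nonempty_iff_nontrivial.1 ⟨y⟩
    rw [← h I hI, ← PrimeSpectrum.topologicalKrullDim_eq_ringKrullDim]
    refine (le_of_eq (congrArg _ (coheight_eq_of_isOpenImmersion ((subschemeCover s).f I)))).trans ?_
    refine (Order.coheight_le_krullDim y).trans_eq ?_
    exact (Order.krullDim_eq_of_orderIso
      (irreducibleSetEquivPoints (α := Spec ((subschemeCover s).X I)))).symm
  · obtain ⟨I, hI⟩ := hne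
    rw [← h I hI, ← PrimeSpectrum.topologicalKrullDim_eq_ringKrullDim]
    have : IsOpenImmersion ((subschemeCover s).f I) :=
      inferInstanceAs (IsOpenImmersion (Proj.awayι _ _ _ _))
    exact ((subschemeCover s).f I).isOpenEmbedding.isInducing.topologicalKrullDim_le

end Subscheme

/-! ### Smoothness, dimension and canonical sheaf together. -/

section Combine

variable {n K C c d : ℕ} {s : Set (MatPoly n K)} {F : Frame n K C → Fin c → ChartPoly K C}

theorem ChartEquations.smoothWithDimAndCanonical (hF : ChartEquations s F) (hd : d + c = C * K)
    (hn : K + C = n) {g : (Fin K ↪o Fin n) → Frame n K C} (hg : ∀ I, (g I).IsAt I)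
    (hdet : ∀ I I', ((g I').ginv * (g I).g).det = 1) (hJ : ∀ I, JacobianCriterion s F (g I))
    (hne : ∃ I, chartIdeal (g I) s ≠ ⊤) : SmoothWithDimAndCanonical s d (2 * c - n - 1) := by
  have hcard : d + c = Fintype.card (Fin C × Fin K) := by simp [hd]
  have hB (I) := (hF.isCoord (hg I) (hJ I)).right_inv
  have hker (I) := (ker_chartToAway hF.semiInvariant (hg I)).trans (hF.span_eq (g I))
  have hsurj (I) := chartToAway_surjective hF.semiInvariant (hg I)
  refine ⟨smoothOfRelativeDimension_subscheme s fun I => ?_,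
    topologicalKrullDim_subscheme s (fun I hI => ?_) ?_, hF.canonicalIsoTwist hd hn hg hdet hJ⟩
  · obtain ⟨B, hB⟩ := hB I
    have : Algebra.Smooth ℂ (Away (coordGrading s) (pluckerCoord s I)) :=
      have h1 : IsLocalization.Away
          (1 : Away (coordGrading s) (pluckerCoord s I)) (Away (coordGrading s) (pluckerCoord s I)) :=
        IsLocalization.away_of_isUnit_of_bijective _ isUnit_one Function.bijective_id
      smooth_of_jacobian (F (g I)) _ (hsurj I) (hker I) 1 B hB
    exact locally_isStandardSmoothOfRelativeDimension (hF.isCoord (hg I) (hJ I)) hcard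
  · exact ringKrullDim_eq_of_jacobian (F (g I)) _ (hsurj I) (hker I) (hB I) hcard
  · obtain ⟨I, hI⟩ := hne
    have : Nontrivial (ChartRing (g I) s) := Ideal.Quotient.nontrivial_iff.2 hI
    exact ⟨I, (chartEquiv (hg I) s hF.semiInvariant).symm.injective.nontrivial⟩

end Combine

/-! ### General members of a linear system of equations. -/

section General

variable {W : Type*} [AddCommGroup W] [Module ℂ W] {τ : Type}

/-- `P` holds outside the zero set of a nonzero polynomial in the coordinates with respect to a
basis. -/
def GeneralWith (b : Module.Basis τ ℂ W) (P : W → Prop) : Prop :=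
  ∃ p : MvPolynomial τ ℂ, p ≠ 0 ∧ ∀ w, MvPolynomial.eval (b.repr w) p ≠ 0 → P w

variable {b : Module.Basis τ ℂ W} {P Q : W → Prop}

theorem GeneralWith.mono (h : GeneralWith b P) (hPQ : ∀ w, P w → Q w) : GeneralWith b Q := by
  obtain ⟨p, hp, h⟩ := h
  exact ⟨p, hp, fun w hw => hPQ w (h w hw)⟩

theorem GeneralWith.forall {ι : Type*} [Fintype ι] {P : ι → W → Prop}
    (h : ∀ i, GeneralWith b (P i)) : GeneralWith b fun w => ∀ i, P i w := by
  choose p hp h using h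
  refine ⟨∏ i, p i, Finset.prod_ne_zero_iff.2 fun i _ => hp i, fun w hw i => h i w ?_⟩
  rw [map_prod] at hw
  exact Finset.prod_ne_zero_iff.1 hw i (Finset.mem_univ i)

theorem GeneralWith.and (hP : GeneralWith b P) (hQ : GeneralWith b Q) :
    GeneralWith b fun w => P w ∧ Q w := by
  obtain ⟨p, hp, hP⟩ := hP
  obtain ⟨q, hq, hQ⟩ := hQ
  refine ⟨p * q, mul_ne_zero hp hq, fun w hw => ?_⟩
  rw [map_mul] at hw
  exact ⟨hP w (left_ne_zero_of_mul hw), hQ w (right_ne_zero_of_mul hw)⟩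

/-- A polynomial in coordinates is a polynomial function in the linear functionals, and a nonzero
one is a nonzero function because `ℂ` is infinite. -/
theorem GeneralWith.forGeneral [Fintype τ] (h : GeneralWith b P) : ForGeneral P := by
  obtain ⟨p, hp, h⟩ := h
  refine ⟨fun w => MvPolynomial.eval (b.repr w) p, ?_, fun h0 => hp ?_, h⟩
  · have h1 : (fun w => MvPolynomial.eval (b.repr w) p) =
        MvPolynomial.aeval (fun i (w : W) => b.coord i w) p := by
      funext w
      have h2 := MvPolynomial.map_aeval (fun i (w : W) => b.coord i w)
        (Pi.evalRingHom (fun _ : W => ℂ) w) p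
      exact h2.symm
    rw [h1]
    refine Algebra.adjoin_mono ?_ ((MvPolynomial.aeval_range (R := ℂ) fun i (w : W) => b.coord i w) ▸
      AlgHom.mem_range_self _ p)
    rintro _ ⟨i, rfl⟩
    exact ⟨b.coord i, rfl⟩
  · refine MvPolynomial.funext fun a => ?_
    have h1 := congrFun h0 (b.equivFun.symm a)
    have h2 : ⇑(b.repr (b.equivFun.symm a)) = a := b.equivFun.apply_symm_apply a
    simp only [h2] at h1
    rw [h1]
    simp

variable {n K C c d : ℕ}

/-- The hypothesis `hspan` feeds the Bertini theorem on each chart, and `hpt` provides the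
transversal zero needed for nonemptiness. There are finitely many charts, so the open conditions can
be intersected. -/
theorem generalWith_smoothWithDimAndCanonical [Fintype τ] (b : Module.Basis τ ℂ W) (s : W → Set (MatPoly n K))
    (F : Frame n K C → W →ₗ[ℂ] (Fin c → ChartPoly K C))
    (hF : ∀ S, ChartEquations (s S) fun g => F g S) (hC : 0 < C) (hd : d + c = C * K)
    (hn : K + C = n) (hspan : ∀ g t, ∃ S, F g S = Pi.single t 1)
    (hpt : ∀ g, ∃ S, ∃ (y : Fin C × Fin K → ℂ) (B : Matrix (Fin C × Fin K) (Fin c) ℂ),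
      (∀ r, MvPolynomial.eval y (F g S r) = 0) ∧
      ∀ r t, ∑ l, MvPolynomial.eval y (MvPolynomial.pderiv l (F g S r)) * B l t =
        if r = t then 1 else 0) :
    GeneralWith b fun S => SmoothWithDimAndCanonical (s S) d (2 * c - n - 1) := by
  have e : Fin K ⊕ Fin C ≃ Fin n := Fintype.equivOfCardEq (by simp [hn])
  choose g hg hgn using fun I : Fin K ↪o Fin n => exists_frame hC e I
  have hsum (g : Frame n K C) (S : W) (r : Fin c) :
      F g S r = ∑ i, MvPolynomial.C (b.repr S i) * F g (b i) r := by
    conv_lhs => rw [← b.sum_repr S, map_sum]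
    simp [MvPolynomial.smul_eq_C_mul]
  have hJ (I) : GeneralWith b fun S => JacobianCriterion (s S) (fun g => F g S) (g I) := by
    obtain ⟨p, hp, h⟩ := exists_jacobian_criterion (f := fun i r => F (g I) (b i) r) fun t => by
      obtain ⟨S, hS⟩ := hspan (g I) t
      refine ⟨b.repr S, fun r => ?_⟩
      rw [← hsum, hS, Pi.single_apply]
    refine ⟨p, hp, fun S hS => ?_⟩
    obtain ⟨B, hB⟩ := h _ hS
    simp only [← hsum] at hB
    refine ⟨B.map (Ideal.Quotient.mk _), Matrix.ext fun r t => ?_⟩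
    have h1 := hB r t
    have h2 : (Set.range fun r => F (g I) S r) = Set.range (F (g I) S) := rfl
    rw [h2, ← (hF S).span_eq (g I), ← Ideal.Quotient.eq_zero_iff_mem, map_sub, sub_eq_zero,
      map_sum] at h1
    simp only [map_mul] at h1
    rw [Matrix.mul_apply, Matrix.one_apply]
    refine h1.trans ?_
    split_ifs <;> simp
  have hne : GeneralWith b fun S => ∃ I, chartIdeal (g I) (s S) ≠ ⊤ := by
    let I : Fin K ↪o Fin n := Fin.castLEOrderEmb (by omega)
    obtain ⟨S, y, B, hy, hB⟩ := hpt (g I)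
    obtain ⟨p, hp, h⟩ := exists_span_ne_top (f := fun i r => F (g I) (b i) r) (b.repr S) y
      (fun r => by rw [← hsum]; exact hy r) B (fun r t => by
        simp only [← hsum]
        exact hB r t)
    refine ⟨p, hp, fun S hS => ⟨I, ?_⟩⟩
    rw [(hF S).span_eq (g I)]
    have h1 := h _ hS
    simp only [← hsum] at h1
    exact h1
  refine ((GeneralWith.forall hJ).and hne).mono fun S hS => ?_
  exact (hF S).smoothWithDimAndCanonical hd hn hg
    (fun I I' => (hgn I).det_eq_one (hgn I')) hS.1 hS.2

end General

/-! ### Sections of `𝒪(1,1)` over arbitrary algebras, and their finite dimensionality. -/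

section FlagSections

theorem eq_of_eval_eq {σ : Type*} {p q h : MvPolynomial σ ℂ} (hh : h ≠ 0)
    (H : ∀ a, MvPolynomial.eval a h ≠ 0 → MvPolynomial.eval a p = MvPolynomial.eval a q) :
    p = q := by
  refine mul_right_cancel₀ hh (MvPolynomial.funext fun a => ?_)
  rw [map_mul, map_mul]
  rcases eq_or_ne (MvPolynomial.eval a h) 0 with h0 | h0
  · rw [h0, mul_zero, mul_zero]
  · rw [H a h0]

variable {n k : ℕ} {B : Type} [CommRing B] [Algebra ℂ B]

theorem evalAt_eq_evMat {K : ℕ} (X : Matrix (Fin n) (Fin K) ℂ) (f : MatPoly n K) :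
    evalAt X f = evMat X f := by
  rw [evalAt, evMat, MvPolynomial.aeval_eq_eval]

/-- The generic element of the parabolic subgroup. -/
def genParabolic (n k : ℕ) : Matrix (Fin (k + 1)) (Fin (k + 1))
    (MvPolynomial ((Fin n × Fin (k + 1)) ⊕ (Fin (k + 1) × Fin (k + 1))) ℂ) :=
  Matrix.of fun i j => if i = Fin.last k ∧ j ≠ Fin.last k then 0 else MvPolynomial.X (Sum.inr (i, j))

/-- The definition concerns complex invertible matrices only. The two sides are polynomials in the
entries of generic matrices that agree where the determinant is nonzero, hence identically; then
specialize. -/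
theorem evMat_mul_flagSection {S : MatPoly n (k + 1)} (hS : S ∈ flagSections n k)
    (X : Matrix (Fin n) (Fin (k + 1)) B) (b : Matrix (Fin (k + 1)) (Fin (k + 1)) B)
    (hb : ∀ j : Fin k, b (Fin.last k) j.castSucc = 0) :
    evMat (X * b) S = (b.submatrix Fin.castSucc Fin.castSucc).det * b.det * evMat X S := by
  let σ := (Fin n × Fin (k + 1)) ⊕ (Fin (k + 1) × Fin (k + 1))
  let Xg : Matrix (Fin n) (Fin (k + 1)) (MvPolynomial σ ℂ) :=
    Matrix.of fun i j => MvPolynomial.X (Sum.inl (i, j))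
  have hmap {B' : Type} [CommRing B'] [Algebra ℂ B'] (f : MvPolynomial σ ℂ →ₐ[ℂ] B') :
      f (evMat (Xg * genParabolic n k) S) = evMat (Xg.map f * (genParabolic n k).map f) S ∧
      f (((genParabolic n k).submatrix Fin.castSucc Fin.castSucc).det * (genParabolic n k).det *
        evMat Xg S) = (((genParabolic n k).map f).submatrix Fin.castSucc Fin.castSucc).det *
          ((genParabolic n k).map f).det * evMat (Xg.map f) S := by
    refine ⟨?_, ?_⟩
    · rw [algHom_evMat, Matrix.map_mul]
    · rw [map_mul, map_mul, algHom_evMat, AlgHom.map_det, AlgHom.map_det, AlgHom.mapMatrix_apply,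
        AlgHom.mapMatrix_apply, Matrix.submatrix_map]
  have key : evMat (Xg * genParabolic n k) S =
      ((genParabolic n k).submatrix Fin.castSucc Fin.castSucc).det * (genParabolic n k).det *
        evMat Xg S := by
    refine eq_of_eval_eq (h := (genParabolic n k).det) (fun h0 => ?_) fun a ha => ?_
    · have h1 := congrArg (MvPolynomial.aeval (Sum.elim (fun _ => 0)
        fun ij : Fin (k + 1) × Fin (k + 1) => (1 : Matrix _ _ ℂ) ij.1 ij.2)) h0
      rw [AlgHom.map_det, map_zero] at h1
      refine one_ne_zero (α := ℂ) (Eq.trans ?_ h1)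
      rw [← Matrix.det_one (n := Fin (k + 1))]
      congr 1
      ext i j
      simp only [AlgHom.mapMatrix_apply, Matrix.map_apply, genParabolic, Matrix.of_apply]
      split_ifs with hij
      · rw [map_zero, Matrix.one_apply_ne]
        rintro rfl
        exact hij.2 hij.1
      · simp
    · rw [← MvPolynomial.aeval_eq_eval] at ha ⊢
      change MvPolynomial.aeval a _ ≠ 0 at ha
      rw [AlgHom.map_det, AlgHom.mapMatrix_apply] at ha
      rw [(hmap _).1, (hmap _).2, ← evalAt_eq_evMat, ← evalAt_eq_evMat]
      refine hS _ (isUnit_iff_ne_zero.2 ha) (fun j => ?_) _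
      simp [genParabolic, Fin.castSucc_ne_last]
  let f : MvPolynomial σ ℂ →ₐ[ℂ] B :=
    MvPolynomial.aeval (Sum.elim (fun ij => X ij.1 ij.2) fun ij => b ij.1 ij.2)
  have hX : Xg.map f = X := by
    ext i j
    simp [Xg, f]
  have hbf : (genParabolic n k).map f = b := by
    ext i j
    simp only [Matrix.map_apply, genParabolic, Matrix.of_apply]
    split_ifs with hij
    · obtain ⟨rfl, hj⟩ := hij
      obtain ⟨j, rfl⟩ := Fin.exists_castSucc_eq.2 hj
      rw [map_zero, hb]
    · simp [f]
  have h1 := congrArg f key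
  rwa [(hmap f).1, (hmap f).2, hX, hbf] at h1

theorem isHomogeneous_of_aeval_eq {σ : Type} [Fintype σ] {S : MvPolynomial σ ℂ} {d : ℕ}
    (h : MvPolynomial.aeval (fun i => Polynomial.X * Polynomial.C (MvPolynomial.X i)) S =
      Polynomial.X ^ d * Polynomial.C S) : S.IsHomogeneous d := by
  have hC (p : MvPolynomial σ ℂ) :
      MvPolynomial.aeval (fun i => Polynomial.C (MvPolynomial.X i : MvPolynomial σ ℂ)) p =
        Polynomial.C p := by
    have h2 : MvPolynomial.aeval (fun i => Polynomial.C (MvPolynomial.X i : MvPolynomial σ ℂ)) =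
        IsScalarTower.toAlgHom ℂ (MvPolynomial σ ℂ) (Polynomial (MvPolynomial σ ℂ)) :=
      MvPolynomial.algHom_ext fun i => by simp
    exact DFunLike.congr_fun h2 p
  have h1 := congrArg (fun p => Polynomial.coeff p d) h
  simp only [Polynomial.coeff_X_pow_mul', le_refl, if_true, Nat.sub_self, Polynomial.coeff_C_zero] at h1
  conv_lhs at h1 => rw [← MvPolynomial.sum_homogeneousComponent S]
  rw [map_sum, Polynomial.finsetSum_coeff] at h1
  rw [← h1]
  refine MvPolynomial.IsHomogeneous.sum _ _ _ fun i _ => ?_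
  rw [aeval_mul_of_isHomogeneous (MvPolynomial.homogeneousComponent_isHomogeneous i S), hC,
    Polynomial.coeff_X_pow_mul', Polynomial.coeff_C]
  split_ifs with h3 h4
  · obtain rfl : d = i := by omega
    exact MvPolynomial.homogeneousComponent_isHomogeneous d S
  · exact MvPolynomial.isHomogeneous_zero _ _ _
  · exact MvPolynomial.isHomogeneous_zero _ _ _

/-- A scalar matrix `t` acts by `t ^ k * t ^ (k + 1)`. Homogeneity is what bounds the degree and
makes the space of sections finite dimensional. -/
theorem isHomogeneous_flagSection {S : MatPoly n (k + 1)} (hS : S ∈ flagSections n k) :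
    S.IsHomogeneous (2 * k + 1) := by
  refine isHomogeneous_of_aeval_eq ?_
  let Xg := (genMat n (k + 1)).map (Polynomial.C (R := MatPoly n (k + 1)))
  have h2 := evMat_mul_flagSection hS Xg (Matrix.scalar _ Polynomial.X) fun j => by
    simp [(Fin.castSucc_ne_last j).symm]
  have h3 : (Matrix.scalar (Fin (k + 1)) (Polynomial.X (R := MatPoly n (k + 1)))).submatrix
      Fin.castSucc Fin.castSucc = Matrix.scalar (Fin k) Polynomial.X := by
    ext i j
    simp [Matrix.diagonal_apply]
  have h4 : evMat Xg S = Polynomial.C S := by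
    have h5 := algHom_evMat (IsScalarTower.toAlgHom ℂ (MatPoly n (k + 1))
      (Polynomial (MatPoly n (k + 1)))) (genMat n (k + 1)) S
    rw [evMat_genMat] at h5
    exact h5.symm
  rw [h3, h4] at h2
  simp only [Matrix.scalar_apply, Matrix.det_diagonal, Finset.prod_const, Finset.card_univ,
    Fintype.card_fin] at h2
  rw [← pow_add, show k + (k + 1) = 2 * k + 1 by ring] at h2
  rw [← h2, evMat]
  congr 2
  funext ij
  rw [Matrix.mul_diagonal, mul_comm]
  rfl

instance : Module.Finite ℂ (flagSections n k) := by
  have h := MvPolynomial.homogeneousSubmodule_fg (σ := Fin n × Fin (k + 1)) (R := ℂ) (2 * k + 1)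
  have : Module.Finite ℂ (MvPolynomial.homogeneousSubmodule (Fin n × Fin (k + 1)) ℂ (2 * k + 1)) :=
    Module.Finite.iff_fg.2 h
  exact Submodule.finiteDimensional_of_le
    (S₂ := MvPolynomial.homogeneousSubmodule (Fin n × Fin (k + 1)) ℂ (2 * k + 1))
    fun S hS => isHomogeneous_flagSection hS

end FlagSections

/-! ### Dependence of a section of `𝒪(1,1)` on the last column. -/

section LastColumn

variable {n k : ℕ} {B : Type} [CommRing B] [Algebra ℂ B]

theorem det_eq_of_row {B : Type*} [CommRing B] (M : Matrix (Fin (k + 1)) (Fin (k + 1)) B) (i j : Fin (k + 1))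
    (h : ∀ l ≠ j, M i l = 0) :
    M.det = (-1) ^ (i + j : ℕ) * M i j * (M.submatrix i.succAbove j.succAbove).det := by
  rw [Matrix.det_succ_row M i]
  exact Finset.sum_eq_single j (fun l _ hl => by rw [h l hl]; ring) (by simp)

/-- The matrix `X` with the column `v` appended. -/
def snocCol {B : Type*} (X : Matrix (Fin n) (Fin k) B) (v : Fin n → B) : Matrix (Fin n) (Fin (k + 1)) B :=
  Matrix.of fun i => Fin.snoc (α := fun _ => B) (X i) (v i)

theorem snocCol_map {B B' : Type*} (f : B → B') (X : Matrix (Fin n) (Fin k) B) (v : Fin n → B) :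
    (snocCol X v).map f = snocCol (X.map f) (f ∘ v) := by
  ext i j
  refine Fin.lastCases ?_ (fun j => ?_) j <;> simp [snocCol]

/-- Apply the parabolic matrix with blocks `u`, `w` and `t`: its determinant is `t * det u`, and its
upper left block contributes another `det u`. -/
theorem evMat_snocCol_mul {S : MatPoly n (k + 1)} (hS : S ∈ flagSections n k)
    (X : Matrix (Fin n) (Fin k) B) (v : Fin n → B) (u : Matrix (Fin k) (Fin k) B) (w : Fin k → B)
    (t : B) : evMat (snocCol (X * u) (X *ᵥ w + t • v)) S =
      t * u.det ^ 2 * evMat (snocCol X v) S := by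
  let b : Matrix (Fin (k + 1)) (Fin (k + 1)) B :=
    Matrix.of (Fin.snoc (fun i => Fin.snoc (u i) (w i)) (Fin.snoc 0 t))
  have hb : ∀ j : Fin k, b (Fin.last k) j.castSucc = 0 := fun j => by simp [b]
  have h1 : b.submatrix Fin.castSucc Fin.castSucc = u := by
    ext i j
    simp [b]
  have h2 : b.det = t * u.det := by
    rw [det_eq_of_row b (Fin.last k) (Fin.last k) fun l hl => by
      obtain ⟨j, rfl⟩ := Fin.exists_castSucc_eq.2 hl
      exact hb j]
    have h3 : b.submatrix (Fin.last k).succAbove (Fin.last k).succAbove = u := by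
      rw [← h1]
      ext i j
      simp
    rw [h3]
    simp [b, ← two_mul]
  have h3 := evMat_mul_flagSection hS (snocCol X v) b hb
  rw [h1, h2] at h3
  have h4 : snocCol (X * u) (X *ᵥ w + t • v) = snocCol X v * b := by
    ext i j
    refine Fin.lastCases ?_ (fun j => ?_) j
    · simp [snocCol, Matrix.mul_apply, Fin.sum_univ_castSucc, b, Matrix.mulVec, dotProduct, mul_comm]
    · simp [snocCol, Matrix.mul_apply, Fin.sum_univ_castSucc, b]
  rw [h4, h3]
  ring

/-- Homogeneity of degree one in the last column, used over dual numbers: scaling `v` by `ε`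
multiplies the value by `ε`, while Taylor expansion at the zero column gives `ε` times a linear form
in `v`. -/
theorem evMat_snocCol_eq_sum {S : MatPoly n (k + 1)} (hS : S ∈ flagSections n k)
    (X : Matrix (Fin n) (Fin k) B) (v : Fin n → B) :
    evMat (snocCol X v) S =
      ∑ r, v r * evMat (snocCol X 0) (MvPolynomial.pderiv (r, Fin.last k) S) := by
  let ι : B →ₐ[ℂ] TrivSqZeroExt B B := TrivSqZeroExt.inlAlgHom ℂ B B
  have hι₁ (b : B) : (ι b).fst = b := rfl
  have hι₂ (b : B) : (ι b).snd = 0 := rfl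
  have h1 := evMat_snocCol_mul hS (X.map ι) (ι ∘ v) 1 0 (TrivSqZeroExt.inr 1)
  have h2 : evMat (snocCol (X.map ι) (ι ∘ v)) S = ι (evMat (snocCol X v) S) := by
    rw [algHom_evMat, snocCol_map]
  rw [h2, Matrix.mul_one, Matrix.mulVec_zero, zero_add, Matrix.det_one, one_pow, mul_one] at h1
  let y : Fin n × Fin (k + 1) → TrivSqZeroExt B B := fun ij => snocCol (X.map ι) 0 ij.1 ij.2
  let ε : Fin n × Fin (k + 1) → TrivSqZeroExt B B := fun ij =>
    snocCol (0 : Matrix (Fin n) (Fin k) (TrivSqZeroExt B B))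
      ((TrivSqZeroExt.inr 1 : TrivSqZeroExt B B) • (ι ∘ v)) ij.1 ij.2
  have h3 := aeval_add_of_sq_zero (A := ℂ) (B := TrivSqZeroExt B B)
    (I := RingHom.ker (TrivSqZeroExt.fstHom ℂ B B))
    (by
      rw [pow_two, eq_bot_iff, Ideal.mul_le]
      intro a ha b hb
      have ha' : a.fst = 0 := ha
      have hb' : b.fst = 0 := hb
      refine TrivSqZeroExt.ext ?_ ?_ <;> simp [ha', hb']) y (ε := ε) (fun ij => by
      obtain ⟨i, j⟩ := ij
      refine Fin.lastCases ?_ (fun j => ?_) j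
      · rw [RingHom.mem_ker]
        change TrivSqZeroExt.fst (ε (i, Fin.last k)) = 0
        simp [ε, snocCol]
      · simp [ε, snocCol]) S
  have h4 : MvPolynomial.aeval (y + ε) S =
      evMat (snocCol (X.map ι) ((TrivSqZeroExt.inr 1 : TrivSqZeroExt B B) • (ι ∘ v))) S := by
    rw [evMat]
    congr 2
    funext ⟨i, j⟩
    refine Fin.lastCases ?_ (fun j => ?_) j <;> simp [y, ε, snocCol]
  have h5 (p : MatPoly n (k + 1)) : MvPolynomial.aeval y p = ι (evMat (snocCol X 0) p) := by
    rw [algHom_evMat, snocCol_map, evMat]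
    congr 2
  rw [h4, h1] at h3
  have h6 := congrArg TrivSqZeroExt.snd h3
  simp only [h5] at h6
  have h7 : (TrivSqZeroExt.inr 1 * ι (evMat (snocCol X v) S) : TrivSqZeroExt B B).snd = evMat (snocCol X v) S := by
    simp [hι₁, hι₂]
  rw [h7, TrivSqZeroExt.snd_add, Fintype.sum_prod_type] at h6
  simp only [Fin.sum_univ_castSucc] at h6
  rw [h6, hι₂, zero_add, TrivSqZeroExt.snd_sum]
  refine Finset.sum_congr rfl fun r _ => ?_
  simp [ε, snocCol, hι₁, hι₂, mul_comm]

theorem evMat_snocCol_sum {S : MatPoly n (k + 1)} (hS : S ∈ flagSections n k)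
    (X : Matrix (Fin n) (Fin k) B) {ι : Type*} [Fintype ι] (a : ι → B) (v : ι → Fin n → B) :
    evMat (snocCol X fun r => ∑ i, v i r * a i) S = ∑ i, evMat (snocCol X (v i)) S * a i := by
  simp only [evMat_snocCol_eq_sum hS X, Finset.sum_mul]
  rw [Finset.sum_comm]
  exact Finset.sum_congr rfl fun r _ => Finset.sum_congr rfl fun i _ => by ring

/-- The linear form vanishes on the subspace itself, so it is a point of the fibre of `𝒬^∨`. -/
theorem evMat_snocCol_mulVec {S : MatPoly n (k + 1)} (hS : S ∈ flagSections n k)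
    (X : Matrix (Fin n) (Fin k) B) (w : Fin k → B) : evMat (snocCol X (X *ᵥ w)) S = 0 := by
  have h := evMat_snocCol_mul hS X 0 1 w 0
  simpa using h

theorem evMat_pushforward₁ (S : MatPoly n (k + 1)) (r : Fin n) (X : Matrix (Fin n) (Fin k) B) :
    evMat X (pushforward₁ S r) = evMat (snocCol X (Pi.single r 1)) S := by
  rw [pushforward₁]
  have h : (evMat X).comp (MvPolynomial.aeval (fun ij : Fin n × Fin (k + 1) =>
      (Fin.snoc (α := fun _ => MatPoly n k) (fun j => MvPolynomial.X (ij.1, j))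
        (if ij.1 = r then 1 else 0) ij.2 : MatPoly n k))) =
      evMat (snocCol X (Pi.single r 1)) := by
    refine MvPolynomial.algHom_ext fun ij => ?_
    obtain ⟨i, j⟩ := ij
    rw [AlgHom.comp_apply, MvPolynomial.aeval_X, evMat_X]
    refine Fin.lastCases ?_ (fun j => ?_) j
    · simp [snocCol, Pi.single_apply, apply_ite (evMat X)]
    · simp [snocCol]
  exact DFunLike.congr_fun h S

end LastColumn

/-! ### Equations of `Y₁` on the charts. -/

section QuotientEquations

variable {n k C : ℕ} {B : Type} [CommRing B] [Algebra ℂ B]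

/-- A vector of a basis. -/
def Frame.col (g : Frame n k C) (B : Type) [CommRing B] [Algebra ℂ B] (x : Fin k ⊕ Fin C) : Fin n → B :=
  fun r => algebraMap ℂ B (g.g r x)

/-- The section `h_{1*} S` in the coordinates of an affine chart. -/
def quotientEquations (g : Frame n k C) :
    MatPoly n (k + 1) →ₗ[ℂ] (Fin C → ChartPoly k C) :=
  LinearMap.pi fun j => (evMat (snocCol (g.chart (genChart k C)) (g.col _ (Sum.inr j)))).toLinearMap

theorem evChart_quotientEquations (g : Frame n k C) (S : MatPoly n (k + 1)) (j : Fin C)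
    (Y : Matrix (Fin C) (Fin k) B) : evChart Y (quotientEquations g S j) =
      evMat (snocCol (g.chart Y) (g.col B (Sum.inr j))) S := by
  change evChart Y (evMat _ S) = _
  rw [algHom_evMat, snocCol_map, g.map_chart, evChart_genChart]
  have h : evChart Y ∘ g.col (ChartPoly k C) (Sum.inr j) = g.col B (Sum.inr j) :=
    funext fun r => (evChart Y).commutes _
  rw [h]

/-- Modulo the column span of the chart, the basis vector `a` of the first block is `-∑ Y c a` times
those of the second block. Hence the values on the second block suffice as equations. -/
theorem evMat_col_inl {S : MatPoly n (k + 1)} (hS : S ∈ flagSections n k) (g : Frame n k C)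
    (Y : Matrix (Fin C) (Fin k) B) (a : Fin k) :
    evMat (snocCol (g.chart Y) (g.col B (Sum.inl a))) S =
      -∑ c, Y c a * evMat (snocCol (g.chart Y) (g.col B (Sum.inr c))) S := by
  have h := evMat_snocCol_mulVec hS (g.chart Y) (Pi.single a 1)
  have h1 : g.chart Y *ᵥ Pi.single a 1 = fun r => ∑ x, g.col B x r * oneRows Y x a := by
    funext r
    rw [Matrix.mulVec_single_one]
    rfl
  rw [h1, evMat_snocCol_sum hS, Fintype.sum_sum_type] at h
  simp only [oneRows_apply_inl, Matrix.one_apply, mul_ite, mul_one, mul_zero, Finset.sum_ite_eq',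
    Finset.mem_univ, if_true] at h
  rw [eq_neg_iff_add_eq_zero, ← h]
  congr 1
  exact Finset.sum_congr rfl fun c _ => mul_comm _ _

theorem chartEquations_quotientEquations (S : flagSections n k) :
    ChartEquations (eqs₁ S) fun g : Frame n k C => quotientEquations g S where
  semiInvariant := by
    rintro _ ⟨r, rfl⟩ B _ _ X u
    have h := evMat_snocCol_mul S.2 X (Pi.single r 1) u 0 1
    rw [Matrix.mulVec_zero, zero_add, one_smul, one_mul] at h
    rw [evMat_pushforward₁, evMat_pushforward₁, h]
  span_eq g := by
    rw [chartIdeal, Ideal.map_span, eqs₁, ← Set.range_comp]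
    have hr (r) : (evMat (g.chart (genChart k C)) ∘ pushforward₁ (S : MatPoly n (k + 1))) r =
      evMat (snocCol (g.chart (genChart k C)) (Pi.single r 1)) S := evMat_pushforward₁ _ _ _
    refine le_antisymm (Ideal.span_le.2 ?_) (Ideal.span_le.2 ?_)
    · rintro _ ⟨r, rfl⟩
      have h1 : (Pi.single r 1 : Fin n → ChartPoly k C) =
          fun r' => ∑ x, g.col _ x r' * algebraMap ℂ _ (g.ginv x r) := by
        funext r'
        have h2 := congrFun (congrFun (g.map_mul_inv (B := ChartPoly k C)) r') r
        rw [Matrix.mul_apply, Matrix.one_apply] at h2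
        rw [Pi.single_apply]
        exact h2.symm
      rw [hr, h1, evMat_snocCol_sum S.2]
      have hinr (c : Fin C) : evMat (snocCol (g.chart (genChart k C)) (g.col _ (Sum.inr c)))
          (S : MatPoly n (k + 1)) ∈ Ideal.span (Set.range (quotientEquations g S)) :=
        Ideal.subset_span ⟨c, rfl⟩
      refine Ideal.sum_mem _ fun x _ => Ideal.mul_mem_right _ _ ?_
      rcases x with a | c
      · rw [evMat_col_inl S.2]
        exact neg_mem (Ideal.sum_mem _ fun c _ => Ideal.mul_mem_left _ _ (hinr c))
      · exact hinr c
    · rintro _ ⟨j, rfl⟩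
      have h1 : g.col (ChartPoly k C) (Sum.inr j) =
          fun r' => ∑ r, (Pi.single r 1 : Fin n → ChartPoly k C) r' * g.col _ (Sum.inr j) r := by
        funext r'
        simp [Pi.single_apply]
      change evMat (snocCol _ (g.col (ChartPoly k C) (Sum.inr j))) _ ∈ _
      rw [h1, evMat_snocCol_sum S.2]
      exact Ideal.sum_mem _ fun r _ => Ideal.mul_mem_right _ _
        (Ideal.subset_span ⟨r, hr r⟩)
  transition g g' hdet B _ _ Y Y' u _ huY := by
    let D := (g'.ginv * g.g).map (algebraMap ℂ B)
    have hL := det_mul_det_transL D ((chart_eq_iff _ _ _ _ _).1 huY)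
    have hD : D.det = 1 := by
      have := RingHom.map_det (algebraMap ℂ B) (g'.ginv * g.g)
      rw [hdet, map_one] at this
      exact this.symm
    -- The factor `det(u)²` belongs to the twist `𝒪(2)`, and the transpose of `transL` expresses the
    -- new complementary vectors modulo the subspace. As `det u * det (transL) = 1`, the determinant
    -- is `det(u)^(2C-1)`.
    refine ⟨u.det ^ 2 • (transL D Y')ᵀ, ?_, ?_⟩
    · rw [Matrix.det_smul, Matrix.det_transpose, Fintype.card_fin, mul_assoc, mul_comm _ u.det, hL, hD,
        mul_one, ← pow_mul]
    · funext j
      have h1 : g.col B (Sum.inr j) = fun r => ∑ x, g'.col B x r * D x (Sum.inr j) := by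
        funext r
        have h2 : g'.g.map (algebraMap ℂ B) * D = g.g.map (algebraMap ℂ B) := by
          rw [← Matrix.map_mul, ← Matrix.mul_assoc, g'.mul_inv, Matrix.one_mul]
        exact (congrFun (congrFun h2 r) (Sum.inr j)).symm
      have h2 := evMat_snocCol_mul S.2 (g'.chart Y') (g.col B (Sum.inr j)) u 0 1
      rw [Matrix.mulVec_zero, zero_add, one_smul, one_mul] at h2
      rw [evChart_quotientEquations, huY, h2, h1, evMat_snocCol_sum S.2, Fintype.sum_sum_type]
      simp only [evMat_col_inl S.2, Matrix.mulVec, dotProduct, evChart_quotientEquations,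
        Matrix.smul_apply, Matrix.transpose_apply, transL, Matrix.sub_apply, Matrix.mul_apply,
        Matrix.toBlocks₂₂, Matrix.toBlocks₁₂, Matrix.of_apply, smul_eq_mul, sub_mul, mul_sub,
        Finset.sum_sub_distrib, Finset.mul_sum, Finset.sum_mul, neg_mul, mul_neg, mul_add,
        Finset.sum_neg_distrib]
      rw [Finset.sum_comm, add_comm, sub_eq_add_neg]
      congr 1
      · exact Finset.sum_congr rfl fun c _ => by ring
      · congr 1
        exact Finset.sum_congr rfl fun c _ => Finset.sum_congr rfl fun a _ => by ring

end QuotientEquations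

/-! ### Explicit sections with prescribed equations on a chart. -/

section TestSections

variable {n k C : ℕ} {B : Type} [CommRing B] [Algebra ℂ B]

/-- The product of a linear form in the `k × k` minors of the first `k` columns and a linear form in
the maximal minors. -/
def minorSection (α : Matrix (Fin k) (Fin n) ℂ) (β : Matrix (Fin (k + 1)) (Fin n) ℂ) :
    MatPoly n (k + 1) :=
  (α.map (algebraMap ℂ (MatPoly n (k + 1))) * (genMat n (k + 1)).submatrix id Fin.castSucc).det *
    (β.map (algebraMap ℂ (MatPoly n (k + 1))) * genMat n (k + 1)).det

theorem evMat_minorSection (α : Matrix (Fin k) (Fin n) ℂ) (β : Matrix (Fin (k + 1)) (Fin n) ℂ)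
    (X : Matrix (Fin n) (Fin (k + 1)) B) : evMat X (minorSection α β) =
      (α.map (algebraMap ℂ B) * X.submatrix id Fin.castSucc).det *
        (β.map (algebraMap ℂ B) * X).det := by
  have hX : (genMat n (k + 1)).map (evMat X) = X := by
    ext i j
    simp [genMat]
  have hm {m : ℕ} (α : Matrix (Fin m) (Fin n) ℂ) :
      (α.map (algebraMap ℂ (MatPoly n (k + 1)))).map (evMat X) = α.map (algebraMap ℂ B) := by
    ext i j
    exact (evMat X).commutes _
  rw [minorSection, map_mul, AlgHom.map_det, AlgHom.map_det, AlgHom.mapMatrix_apply,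
    AlgHom.mapMatrix_apply, Matrix.map_mul, Matrix.map_mul, hm, hm, ← Matrix.submatrix_map, hX]

theorem minorSection_mem (α : Matrix (Fin k) (Fin n) ℂ) (β : Matrix (Fin (k + 1)) (Fin n) ℂ) :
    minorSection α β ∈ flagSections n k := by
  intro b _ hb X
  rw [evalAt_eq_evMat, evalAt_eq_evMat, evMat_minorSection, evMat_minorSection]
  have h : (X * b).submatrix id Fin.castSucc =
      X.submatrix id Fin.castSucc * b.submatrix Fin.castSucc Fin.castSucc := by
    ext i j
    simp [Matrix.mul_apply, Fin.sum_univ_castSucc, hb]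
  rw [h, ← Matrix.mul_assoc, ← Matrix.mul_assoc, Matrix.det_mul, Matrix.det_mul]
  ring

/-- The section `minorSection α β` of `𝒪(1,1)`. -/
def minorFlagSection (α : Matrix (Fin k) (Fin n) ℂ) (β : Matrix (Fin (k + 1)) (Fin n) ℂ) :
    flagSections n k :=
  ⟨minorSection α β, minorSection_mem α β⟩

theorem snocCol_submatrix {B : Type*} (X : Matrix (Fin n) (Fin k) B) (v : Fin n → B) :
    (snocCol X v).submatrix id Fin.castSucc = X := by
  ext i j
  simp [snocCol]

/-- The linear forms of an affine chart, together with one of the remaining coordinates. -/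
def Frame.snocRow (g : Frame n k C) (t : Fin C) : Matrix (Fin (k + 1)) (Fin n) ℂ :=
  Matrix.of fun i => Fin.snoc (α := fun _ => Fin n → ℂ) (fun a => g.ginv (Sum.inl a))
    (g.ginv (Sum.inr t)) i

@[simp]
theorem Frame.snocRow_castSucc (g : Frame n k C) (t : Fin C) (a : Fin k) (r : Fin n) :
    g.snocRow t a.castSucc r = g.ginv (Sum.inl a) r := by simp [Frame.snocRow]

@[simp]
theorem Frame.snocRow_last (g : Frame n k C) (t : Fin C) (r : Fin n) :
    g.snocRow t (Fin.last k) r = g.ginv (Sum.inr t) r := by simp [Frame.snocRow]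

/-- In the basis `g`, the matrix of the second factor has top rows `(1, 0)`; its determinant is
therefore the last entry, the coordinate `t` of the basis vector `j`. -/
theorem quotientEquations_minorSection (g : Frame n k C) (α : Matrix (Fin k) (Fin n) ℂ) (t j : Fin C) :
    quotientEquations g (minorSection α (g.snocRow t)) j =
      if j = t then (α.map (algebraMap ℂ (ChartPoly k C)) * g.chart (genChart k C)).det else 0 := by
  change evMat _ _ = _
  rw [evMat_minorSection, snocCol_submatrix]
  have hcol (x y) : ∑ r, algebraMap ℂ (ChartPoly k C) (g.ginv x r) * g.col _ y r = if x = y then 1 else 0 := by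
    have h2 := congrFun (congrFun (g.map_inv_mul (B := ChartPoly k C)) x) y
    rw [Matrix.mul_apply, Matrix.one_apply] at h2
    exact h2
  have hdet : ((g.snocRow t).map (algebraMap ℂ (ChartPoly k C)) *
      snocCol (g.chart (genChart k C)) (g.col _ (Sum.inr j))).det = if j = t then 1 else 0 := by
    rw [← Matrix.det_transpose, det_eq_of_row _ (Fin.last k) (Fin.last k)]
    · have h1 : (((g.snocRow t).map (algebraMap ℂ (ChartPoly k C)) *
          snocCol (g.chart (genChart k C)) (g.col _ (Sum.inr j)))ᵀ.submatrix
            (Fin.last k).succAbove (Fin.last k).succAbove) = 1 := by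
        refine Eq.trans ?_ Matrix.transpose_one
        ext1 a b
        have h2 := congrFun (congrFun (g.inv_mul_chart (genChart k C)) (Sum.inl b)) a
        rw [oneRows_apply_inl] at h2
        rw [Matrix.transpose_apply, ← h2]
        simp [Matrix.mul_apply, snocCol, mul_comm]
      rw [h1, Matrix.det_one, mul_one, ← two_mul, pow_mul]
      have h3 := hcol (Sum.inr t) (Sum.inr j)
      simp only [Sum.inr.injEq, eq_comm (a := t)] at h3
      rw [← h3]
      simp [Matrix.mul_apply, snocCol, mul_comm]
    · intro l hl
      obtain ⟨a, rfl⟩ := Fin.exists_castSucc_eq.2 hl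
      have h3 := hcol (Sum.inl a) (Sum.inr j)
      rw [if_neg (by simp)] at h3
      rw [← h3]
      simp [Matrix.mul_apply, snocCol, mul_comm]
  rw [hdet, mul_ite, mul_one, mul_zero]

theorem exists_quotientEquations_eq_single (g : Frame n k C) (t : Fin C) :
    ∃ S : flagSections n k, quotientEquations g S = Pi.single t 1 := by
  refine ⟨minorFlagSection (g.ginv.submatrix Sum.inl id) (g.snocRow t), funext fun j =>
    (quotientEquations_minorSection g _ t j).trans ?_⟩
  have h : (g.ginv.submatrix Sum.inl id).map (algebraMap ℂ (ChartPoly k C)) * g.chart (genChart k C) = 1 :=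
    Matrix.ext fun a b => congrFun (congrFun (g.inv_mul_chart (genChart k C)) (Sum.inl a)) b
  rw [h, Matrix.det_one, Pi.single_apply]

/-- For each `t`, choose the first factor to be the affine coordinate `(t, a)` and let the second
one select equation `t`; then add up. -/
theorem exists_quotientEquations_eq_X (g : Frame n k C) (a : Fin k) :
    ∃ S : flagSections n k, quotientEquations g S = fun j => MvPolynomial.X (j, a) := by
  refine ⟨∑ t, minorFlagSection ((g.ginv.submatrix Sum.inl id).updateRow a (g.ginv (Sum.inr t)))
    (g.snocRow t),
    funext fun j => ?_⟩
  rw [Submodule.coe_sum, map_sum, Finset.sum_apply]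
  refine (Finset.sum_congr rfl fun t _ => quotientEquations_minorSection g _ t j).trans ?_
  simp only [det_updateRow_mul_chart, Finset.sum_ite_eq, Finset.mem_univ, if_true]
  rfl

end TestSections

/-! ### Transformation of the coefficient vector of `h_{2*} S` under a change of frame. -/

section CofactorVector

variable {n k : ℕ} {B : Type} [CommRing B] [Algebra ℂ B]

/-- The permutation listing `j` last. -/
def moveLast (j : Fin (k + 1)) : Equiv.Perm (Fin (k + 1)) :=
  Equiv.ofBijective (Fin.snoc (α := fun _ => Fin (k + 1)) j.succAbove j)
    (Finite.injective_iff_bijective.1 (by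
      intro a b
      refine Fin.lastCases ?_ (fun a => ?_) a <;> refine Fin.lastCases ?_ (fun b => ?_) b
      · simp
      · simp [(Fin.succAbove_ne j b).symm]
      · simp [Fin.succAbove_ne j a]
      · simp))

@[simp]
theorem moveLast_last (j : Fin (k + 1)) : moveLast j (Fin.last k) = j := by simp [moveLast]

@[simp]
theorem moveLast_castSucc (j : Fin (k + 1)) (i : Fin k) : moveLast j i.castSucc = j.succAbove i := by
  simp [moveLast]

/-- The coefficients of `h_{2*} S` with respect to the columns of a frame. -/
def colCoeff (S : MatPoly n (k + 1)) (X : Matrix (Fin n) (Fin (k + 1)) B) (j : Fin (k + 1)) : B :=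
  evMat (X.submatrix id (moveLast j)) S

theorem evMat_pushforward₂ (S : MatPoly n (k + 1)) (r : Fin n) (X : Matrix (Fin n) (Fin (k + 1)) B) :
    evMat X (pushforward₂ S r) = (X *ᵥ colCoeff S X) r := by
  rw [pushforward₂, map_sum]
  refine Finset.sum_congr rfl fun j _ => ?_
  rw [map_mul, evMat_X]
  congr 1
  rw [evMat, MvPolynomial.aeval_rename]
  rfl

theorem algHom_colCoeff {B' : Type} [CommRing B'] [Algebra ℂ B'] (f : B →ₐ[ℂ] B')
    (S : MatPoly n (k + 1)) (X : Matrix (Fin n) (Fin (k + 1)) B) (j : Fin (k + 1)) :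
    f (colCoeff S X j) = colCoeff S (X.map f) j := by
  rw [colCoeff, algHom_evMat, ← Matrix.submatrix_map]
  rfl

/-- Listing row `j` and column `j'` last puts `h` into the parabolic subgroup, up to invertibility.
The signs of the two permutations disappear because the determinant enters squared. -/
theorem mul_colCoeff_of_row {S : MatPoly n (k + 1)} (hS : S ∈ flagSections n k)
    (X : Matrix (Fin n) (Fin (k + 1)) B) (h : Matrix (Fin (k + 1)) (Fin (k + 1)) B)
    {j j' : Fin (k + 1)} (hj : ∀ l ≠ j', h j l = 0) :
    h j j' * colCoeff S (X * h) j' = h.det ^ 2 * colCoeff S X j := by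
  let b := h.submatrix (moveLast j) (moveLast j')
  have hb (i : Fin k) : b (Fin.last k) i.castSucc = 0 := by
    simp only [b, Matrix.submatrix_apply, moveLast_last, moveLast_castSucc]
    exact hj _ (Fin.succAbove_ne j' i)
  have h1 := evMat_mul_flagSection hS (X.submatrix id (moveLast j)) b hb
  rw [Matrix.submatrix_mul_equiv] at h1
  have h2 : b.submatrix Fin.castSucc Fin.castSucc = h.submatrix j.succAbove j'.succAbove := by
    ext i l
    simp [b]
  have h3 := det_eq_of_row b (Fin.last k) (Fin.last k) fun l hl => by
    obtain ⟨i, rfl⟩ := Fin.exists_castSucc_eq.2 hl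
    exact hb i
  have h4 : b.submatrix (Fin.last k).succAbove (Fin.last k).succAbove =
      h.submatrix j.succAbove j'.succAbove := by
    rw [← h2]
    ext i l
    simp
  have h5 : b (Fin.last k) (Fin.last k) = h j j' := by simp [b]
  rw [h4, h5, ← two_mul, pow_mul, neg_one_sq, one_pow, one_mul] at h3
  rw [h2, h3] at h1
  rw [colCoeff, h1, det_eq_of_row h j j' hj, mul_pow, mul_pow, ← pow_mul, mul_comm _ 2, pow_mul, neg_one_sq,
    one_pow, one_mul]
  change _ = _ * evMat _ S
  ring

/-- Sections of `𝒪(1)` on the projective line are linear: `a` and `b` are the two affine expressions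
of one. Multiplying by a power of `t` turns the relation into a polynomial identity with the
reversal of `b`, and comparing coefficients bounds the degree of `a` by one. -/
theorem eval_eq_of_reciprocal {a b : Polynomial ℂ}
    (h : ∀ t, t ≠ 0 → t⁻¹ * Polynomial.eval t a = -Polynomial.eval t⁻¹ b) (t : ℂ) :
    Polynomial.eval t a = Polynomial.eval 0 a - t * Polynomial.eval 0 b := by
  let N := b.natDegree
  have h1 : Polynomial.X ^ N * a = -(Polynomial.X * Polynomial.reflect N b) := by
    refine Polynomial.eq_of_infinite_eval_eq _ _ ((Set.Infinite.mono (s := {0}ᶜ) fun t ht => ?_)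
      (Set.finite_singleton 0).infinite_compl)
    have ht : t ≠ 0 := ht
    have h2 : Invertible t⁻¹ := invertibleOfNonzero (inv_ne_zero ht)
    have h3 := Polynomial.eval₂_reflect_mul_pow (RingHom.id ℂ) t⁻¹ N b le_rfl
    have h4 : ⅟t⁻¹ = t := by rw [invOf_eq_inv, inv_inv]
    rw [h4] at h3
    change Polynomial.eval t _ * _ = Polynomial.eval t⁻¹ b at h3
    have h5 := h t ht
    rw [← h3] at h5
    have h6 : t ^ N * t⁻¹ ^ N = 1 := by rw [← mul_pow, mul_inv_cancel₀ ht, one_pow]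
    have h7 : t * t⁻¹ = 1 := mul_inv_cancel₀ ht
    simp only [Set.mem_ofPred_eq, Polynomial.eval_mul, Polynomial.eval_pow, Polynomial.eval_X,
      Polynomial.eval_neg]
    linear_combination t ^ N * t * h5 - t ^ N * Polynomial.eval t a * h7 -
      t * Polynomial.eval t (Polynomial.reflect N b) * h6
  have hcoeff (i : ℕ) : a.coeff (i + 1) = -(Polynomial.reflect N b).coeff (i + N) := by
    have h2 := congrArg (fun p => Polynomial.coeff p (i + N + 1)) h1
    simp only [Polynomial.coeff_neg, Polynomial.coeff_X_mul] at h2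
    rw [show i + N + 1 = i + 1 + N by ring, Polynomial.coeff_X_pow_mul] at h2
    exact h2
  have h2 : a = Polynomial.C (a.coeff 0) - Polynomial.X * Polynomial.C (b.coeff 0) := by
    ext i
    rcases i with _ | _ | i
    · simp
    · rw [hcoeff, Polynomial.coeff_reflect]
      simp [Polynomial.revAt_le]
    · rw [hcoeff, Polynomial.coeff_reflect, Polynomial.revAt_eq_self_of_lt (by omega),
        Polynomial.coeff_eq_zero_of_natDegree_lt (by omega)]
      simp
  rw [← Polynomial.coeff_zero_eq_eval_zero, ← Polynomial.coeff_zero_eq_eval_zero]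
  conv_lhs => rw [h2]
  simp only [Polynomial.eval_sub, Polynomial.eval_mul, Polynomial.eval_C, Polynomial.eval_X]

/-- The columns `i` and `j` span a pencil. The hypothesis on reciprocal polynomials is the change
between its two affine charts, realized by a product of transvections. -/
theorem colCoeff_mul_transvection {S : MatPoly n (k + 1)} (hS : S ∈ flagSections n k)
    (X : Matrix (Fin n) (Fin (k + 1)) ℂ) {i j : Fin (k + 1)} (hij : i ≠ j) (t : ℂ) :
    colCoeff S (X * Matrix.transvection i j t) i = colCoeff S X i - t * colCoeff S X j := by
  let p (i j : Fin (k + 1)) : Polynomial ℂ :=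
    colCoeff S (X.map (algebraMap ℂ (Polynomial ℂ)) *
      (Matrix.transvection i j Polynomial.X : Matrix (Fin (k + 1)) (Fin (k + 1)) (Polynomial ℂ))) i
  have hp (i j : Fin (k + 1)) (t : ℂ) :
      Polynomial.eval t (p i j) = colCoeff S (X * Matrix.transvection i j t) i := by
    have h1 := algHom_colCoeff (Polynomial.aeval t) S
      (X.map (algebraMap ℂ (Polynomial ℂ)) *
      (Matrix.transvection i j Polynomial.X : Matrix (Fin (k + 1)) (Fin (k + 1)) (Polynomial ℂ))) i
    refine h1.trans ?_
    congr 1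
    rw [Matrix.map_mul]
    congr 1
    · ext a b
      simp
    · ext a b
      simp only [Matrix.map_apply, Matrix.transvection, Matrix.add_apply, Matrix.one_apply,
        Matrix.single_apply, map_add]
      split_ifs <;> simp
  have h0 (i j : Fin (k + 1)) : Polynomial.eval 0 (p i j) = colCoeff S X i := by
    rw [hp, Matrix.transvection_zero, Matrix.mul_one]
  rw [← hp, eval_eq_of_reciprocal (b := p j i) (fun t ht => ?_) t, h0, h0]
  rw [hp, hp]
  -- The `j`-th row of `h` is `-t⁻¹` in column `i` and zero elsewhere, so `mul_colCoeff_of_row`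
  -- applies to it.
  let h := Matrix.transvection j i (-t⁻¹) * Matrix.transvection i j t
  have h1 : X * Matrix.transvection i j t = X * Matrix.transvection j i t⁻¹ * h := by
    rw [← Matrix.mul_assoc (X * _), Matrix.mul_assoc X, Matrix.transvection_mul_transvection_same _ _ hij.symm]
    simp
  have h2 (l) (hl : l ≠ i) : h j l = 0 := by
    simp only [h, Matrix.transvection, Matrix.add_mul, Matrix.mul_add, Matrix.one_mul, Matrix.mul_one,
      Matrix.single_mul_single_same, Matrix.add_apply, Matrix.one_apply, Matrix.single_apply]
    by_cases hlj : j = l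
    · simp [ht, hlj, hl.symm]
    · simp [hij, hlj, hl.symm]
  have h3 : h j i = -t⁻¹ := by
    simp [h, Matrix.transvection, Matrix.add_mul, Matrix.mul_add, hij, hij.symm]
  have h4 : h.det = 1 := by
    rw [Matrix.det_mul, Matrix.det_transvection_of_ne _ _ hij.symm, Matrix.det_transvection_of_ne _ _ hij,
      one_mul]
  have h5 := mul_colCoeff_of_row hS (X * Matrix.transvection j i t⁻¹) h h2
  rw [h3, h4, ← h1, one_pow, one_mul] at h5
  rw [← h5]
  ring

/-- Invertible matrices are products of diagonal matrices and transvections, and the rule is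
multiplicative in `h`. A diagonal matrix, and every row of a transvection but one, is handled by
`mul_colCoeff_of_row`; the remaining row is `colCoeff_mul_transvection`. -/
theorem mulVec_colCoeff_of_det_ne_zero {S : MatPoly n (k + 1)} (hS : S ∈ flagSections n k)
    (h : Matrix (Fin (k + 1)) (Fin (k + 1)) ℂ) (hdet : h.det ≠ 0) :
    ∀ X : Matrix (Fin n) (Fin (k + 1)) ℂ,
      h *ᵥ colCoeff S (X * h) = h.det ^ 2 • colCoeff S X := by
  refine Matrix.diagonal_transvection_induction_of_det_ne_zero
    (fun h => ∀ X : Matrix (Fin n) (Fin (k + 1)) ℂ,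
      h *ᵥ colCoeff S (X * h) = h.det ^ 2 • colCoeff S X) h hdet ?_ ?_ ?_
  · intro D _ X
    funext j
    rw [Matrix.mulVec_diagonal]
    have h1 := mul_colCoeff_of_row hS X (Matrix.diagonal D) (j := j) (j' := j) fun l hl =>
      Matrix.diagonal_apply_ne _ hl.symm
    rwa [Matrix.diagonal_apply_eq] at h1
  · rintro ⟨i, j, hij, c⟩ X
    change Matrix.transvection i j c *ᵥ colCoeff S (X * Matrix.transvection i j c) =
      (Matrix.transvection i j c).det ^ 2 • _
    rw [Matrix.det_transvection_of_ne _ _ hij, one_pow, one_smul]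
    have h1 (l) (hl : l ≠ i) : colCoeff S (X * Matrix.transvection i j c) l = colCoeff S X l := by
      have h2 := mul_colCoeff_of_row hS X (Matrix.transvection i j c) (j := l) (j' := l) fun m hm => by
        simp [Matrix.transvection, hm.symm, hl.symm]
      rw [Matrix.det_transvection_of_ne _ _ hij, one_pow, one_mul] at h2
      rw [← h2]
      simp [Matrix.transvection, hl.symm]
    funext l
    rw [Matrix.transvection, Matrix.add_mulVec, Matrix.one_mulVec, Pi.add_apply, Matrix.single_mulVec]
    by_cases hl : l = i
    · subst hl
      have h2 := colCoeff_mul_transvection hS X hij c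
      have h3 := h1 j hij.symm
      rw [Matrix.transvection] at h2 h3
      simp [h2, h3]
    · have h3 := h1 l hl
      rw [Matrix.transvection] at h3
      simp [h3, hl]
  · intro A B _ _ hA hB X
    rw [← Matrix.mul_assoc, ← Matrix.mulVec_mulVec, hB, Matrix.mulVec_smul, hA, Matrix.det_mul, smul_smul]
    congr 1
    ring

/-- A polynomial identity in generic `X` and `h`, valid where `det h ≠ 0`, hence everywhere and over
every algebra. -/
theorem mulVec_colCoeff {S : MatPoly n (k + 1)} (hS : S ∈ flagSections n k)
    (X : Matrix (Fin n) (Fin (k + 1)) B) (h : Matrix (Fin (k + 1)) (Fin (k + 1)) B) :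
    h *ᵥ colCoeff S (X * h) = h.det ^ 2 • colCoeff S X := by
  let σ := (Fin n × Fin (k + 1)) ⊕ (Fin (k + 1) × Fin (k + 1))
  let Xg : Matrix (Fin n) (Fin (k + 1)) (MvPolynomial σ ℂ) :=
    Matrix.of fun i j => MvPolynomial.X (Sum.inl (i, j))
  let hg : Matrix (Fin (k + 1)) (Fin (k + 1)) (MvPolynomial σ ℂ) :=
    Matrix.of fun i j => MvPolynomial.X (Sum.inr (i, j))
  funext i
  have hmap {B' : Type} [CommRing B'] [Algebra ℂ B'] (f : MvPolynomial σ ℂ →ₐ[ℂ] B') :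
      f ((hg *ᵥ colCoeff S (Xg * hg)) i) = (hg.map f *ᵥ colCoeff S (Xg.map f * hg.map f)) i ∧
      f ((hg.det ^ 2 • colCoeff S Xg) i) = ((hg.map f).det ^ 2 • colCoeff S (Xg.map f)) i := by
    refine ⟨?_, ?_⟩
    · simp only [Matrix.mulVec, dotProduct, map_sum, map_mul, algHom_colCoeff, Matrix.map_mul,
        Matrix.map_apply]
    · rw [Pi.smul_apply, Pi.smul_apply, smul_eq_mul, smul_eq_mul, map_mul, map_pow, algHom_colCoeff,
        AlgHom.map_det, AlgHom.mapMatrix_apply]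
  have key : (hg *ᵥ colCoeff S (Xg * hg)) i = (hg.det ^ 2 • colCoeff S Xg) i := by
    refine eq_of_eval_eq (h := hg.det) (fun h0 => ?_) fun a ha => ?_
    · have h1 := congrArg (MvPolynomial.aeval (Sum.elim (fun _ => 0)
        fun ij : Fin (k + 1) × Fin (k + 1) => (1 : Matrix _ _ ℂ) ij.1 ij.2)) h0
      rw [AlgHom.map_det, map_zero] at h1
      refine one_ne_zero (α := ℂ) (Eq.trans ?_ h1)
      rw [← Matrix.det_one (n := Fin (k + 1))]
      congr 1
      ext i j
      simp [hg]
    · rw [← MvPolynomial.aeval_eq_eval] at ha ⊢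
      change MvPolynomial.aeval a _ ≠ 0 at ha
      rw [AlgHom.map_det, AlgHom.mapMatrix_apply] at ha
      rw [(hmap _).1, (hmap _).2, mulVec_colCoeff_of_det_ne_zero hS _ ha]
  let f : MvPolynomial σ ℂ →ₐ[ℂ] B :=
    MvPolynomial.aeval (Sum.elim (fun ij => X ij.1 ij.2) fun ij => h ij.1 ij.2)
  have hX : Xg.map f = X := by
    ext i j
    simp [Xg, f]
  have hh : hg.map f = h := by
    ext i j
    simp [hg, f]
  have h1 := congrArg f key
  rwa [(hmap f).1, (hmap f).2, hX, hh] at h1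

end CofactorVector

/-! ### Equations of `Y₂` on the charts, and test sections for them. -/

section SubEquations

variable {n k C : ℕ} {B : Type} [CommRing B] [Algebra ℂ B]

/-- The section `h_{2*} S` in the coordinates of an affine chart. -/
def subEquations (g : Frame n (k + 1) C) :
    MatPoly n (k + 1) →ₗ[ℂ] (Fin (k + 1) → ChartPoly (k + 1) C) :=
  LinearMap.pi fun j =>
    (evMat ((g.chart (genChart (k + 1) C)).submatrix id (moveLast j))).toLinearMap

theorem subEquations_eq (g : Frame n (k + 1) C) (S : MatPoly n (k + 1)) :
    subEquations g S = colCoeff S (g.chart (genChart (k + 1) C)) := rfl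

theorem evChart_subEquations (g : Frame n (k + 1) C) (S : MatPoly n (k + 1)) (j : Fin (k + 1))
    (Y : Matrix (Fin C) (Fin (k + 1)) B) :
    evChart Y (subEquations g S j) = colCoeff S (g.chart Y) j := by
  rw [subEquations_eq, algHom_colCoeff, g.map_chart, evChart_genChart]

theorem mulVec_mem {R m l : Type*} [CommRing R] [Fintype l] (I : Ideal R) (M : Matrix m l R)
    {v : l → R} (h : ∀ j, v j ∈ I) (i : m) : (M *ᵥ v) i ∈ I := by
  rw [Matrix.mulVec, dotProduct]
  exact Ideal.sum_mem _ fun j _ => Ideal.mul_mem_left _ _ (h j)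

theorem chartEquations_subEquations (S : flagSections n k) :
    ChartEquations (eqs₂ S) fun g : Frame n (k + 1) C => subEquations g S where
  semiInvariant := by
    rintro _ ⟨r, rfl⟩ B _ _ X u
    rw [evMat_pushforward₂, evMat_pushforward₂, ← Matrix.mulVec_mulVec, mulVec_colCoeff S.2,
      Matrix.mulVec_smul]
    rfl
  span_eq g := by
    rw [chartIdeal, Ideal.map_span, eqs₂, ← Set.range_comp]
    let X := g.chart (genChart (k + 1) C)
    have hr (r) : (evMat X ∘ pushforward₂ (S : MatPoly n (k + 1))) r =
      (X *ᵥ subEquations g S) r := evMat_pushforward₂ _ _ _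
    refine le_antisymm (Ideal.span_le.2 ?_) (Ideal.span_le.2 ?_)
    · rintro _ ⟨r, rfl⟩
      rw [hr]
      have hj (j) : subEquations g (S : MatPoly n (k + 1)) j ∈
          Ideal.span (Set.range (subEquations g (S : MatPoly n (k + 1)))) :=
        Ideal.subset_span ⟨j, rfl⟩
      exact mulVec_mem _ _ hj r
    · rintro _ ⟨j, rfl⟩
      -- The top block of a chart frame in the basis `g` is the identity, so the coefficients are
      -- recovered linearly from the vector `h_{2*} S`.
      have h1 : subEquations g S j = (g.ginv.map (algebraMap ℂ _) *ᵥ (X *ᵥ subEquations g S))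
          (Sum.inl j) := by
        rw [Matrix.mulVec_mulVec, g.inv_mul_chart]
        have h2 := congrFun (Matrix.one_mulVec (subEquations g (S : MatPoly n (k + 1)))) j
        exact h2.symm
      have hX (r) : (X *ᵥ subEquations g S) r ∈
          Ideal.span (Set.range (evMat X ∘ pushforward₂ (S : MatPoly n (k + 1)))) :=
        Ideal.subset_span ⟨r, hr r⟩
      have h2 : (g.ginv.map (algebraMap ℂ _) *ᵥ (X *ᵥ subEquations g S)) (Sum.inl j) ∈
          Ideal.span (Set.range (evMat X ∘ pushforward₂ (S : MatPoly n (k + 1)))) :=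
        mulVec_mem _ _ hX _
      exact h1 ▸ h2
  transition g g' _ B _ _ Y Y' u hu huY := by
    -- This is `det(u)² u⁻¹`, the transition matrix of `𝒰(2)`, written without inverses; its
    -- determinant is `det(u)^(2(k+1)-1)`.
    refine ⟨u.det • u.adjugate, ?_, ?_⟩
    · rw [Matrix.det_smul, Matrix.det_adjugate, Fintype.card_fin, Nat.add_sub_cancel, ← pow_add, ← pow_succ]
      congr 1
      ring
    · have h1 := congrArg (fun v => u.adjugate *ᵥ v)
        (mulVec_colCoeff S.2 (g'.chart Y') u)
      simp only [Matrix.mulVec_mulVec, Matrix.adjugate_mul, Matrix.mulVec_smul] at h1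
      rw [Matrix.smul_mulVec, Matrix.one_mulVec, ← huY] at h1
      funext j
      simp only [evChart_subEquations]
      refine hu.mul_left_cancel ((congrFun h1 j).trans ?_)
      change _ = _ * ((u.det • u.adjugate) *ᵥ colCoeff _ _) j
      rw [Matrix.smul_mulVec, Pi.smul_apply, Pi.smul_apply, smul_eq_mul, smul_eq_mul, ← mul_assoc, ← pow_two]

theorem det_one_submatrix_succAbove {R : Type*} [CommRing R] (t j : Fin (k + 1)) :
    ((1 : Matrix (Fin (k + 1)) (Fin (k + 1)) R).submatrix t.succAbove j.succAbove).det =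
      if j = t then 1 else 0 := by
  split_ifs with h
  · subst h
    rw [Matrix.submatrix_one _ Fin.succAbove_right_injective, Matrix.det_one]
  · obtain ⟨i, hi⟩ := Fin.exists_succAbove_eq h
    refine Matrix.det_eq_zero_of_row_eq_zero i fun l => ?_
    rw [Matrix.submatrix_apply, hi, Matrix.one_apply_ne (Fin.succAbove_ne j l).symm]

/-- The sign of the permutation `moveLast j`. -/
def moveLastSign (j : Fin (k + 1)) : ℂ := ((Equiv.Perm.sign (moveLast j) : ℤ) : ℂ)

theorem moveLastSign_mul_self (j : Fin (k + 1)) : moveLastSign j * moveLastSign j = 1 := by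
  rw [moveLastSign, ← Int.cast_mul, ← Units.val_mul, Int.units_mul_self, Units.val_one, Int.cast_one]

/-- The first factor is the minor of an identity matrix with row `t` and column `j` deleted, which
vanishes unless `j = t`. Moving column `j` last changes the second factor by a sign only. -/
theorem subEquations_minorSection (g : Frame n (k + 1) C) (β : Matrix (Fin (k + 1)) (Fin n) ℂ)
    (t j : Fin (k + 1)) :
    subEquations g (minorSection (Matrix.of fun i => g.ginv (Sum.inl (t.succAbove i))) β) j =
      if j = t then MvPolynomial.C (moveLastSign t) *
        (β.map (algebraMap ℂ (ChartPoly (k + 1) C)) * g.chart (genChart (k + 1) C)).det else 0 := by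
  change evMat _ _ = _
  rw [evMat_minorSection]
  have h1 : ((Matrix.of fun i => g.ginv (Sum.inl (t.succAbove i))).map
      (algebraMap ℂ (ChartPoly (k + 1) C)) *
      ((g.chart (genChart (k + 1) C)).submatrix id (moveLast j)).submatrix id Fin.castSucc) =
      (1 : Matrix (Fin (k + 1)) (Fin (k + 1)) (ChartPoly (k + 1) C)).submatrix t.succAbove j.succAbove := by
    ext1 a b
    have h2 := congrFun (congrFun (g.inv_mul_chart (genChart (k + 1) C))
      (Sum.inl (t.succAbove a))) (j.succAbove b)
    rw [oneRows_apply_inl] at h2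
    rw [Matrix.submatrix_apply, ← h2]
    simp [Matrix.mul_apply]
  have h2 : (β.map (algebraMap ℂ (ChartPoly (k + 1) C)) *
      (g.chart (genChart (k + 1) C)).submatrix id (moveLast j)).det =
      MvPolynomial.C (moveLastSign j) *
        (β.map (algebraMap ℂ (ChartPoly (k + 1) C)) * g.chart (genChart (k + 1) C)).det := by
    rw [moveLastSign, map_intCast, ← Matrix.det_permute']
    congr 1
  rw [h1, h2, det_one_submatrix_succAbove]
  split_ifs with h
  · rw [h, one_mul]
  · rw [zero_mul]

theorem subEquations_smul_minorSection (g : Frame n (k + 1) C) (β : Matrix (Fin (k + 1)) (Fin n) ℂ)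
    (t j : Fin (k + 1)) :
    subEquations g (moveLastSign t •
      minorSection (Matrix.of fun i => g.ginv (Sum.inl (t.succAbove i))) β) j = if j = t then
        (β.map (algebraMap ℂ (ChartPoly (k + 1) C)) * g.chart (genChart (k + 1) C)).det else 0 := by
  rw [map_smul, Pi.smul_apply, subEquations_minorSection, MvPolynomial.smul_eq_C_mul]
  split_ifs with h
  · rw [← mul_assoc, ← map_mul, moveLastSign_mul_self, map_one, one_mul]
  · rw [mul_zero]

theorem exists_subEquations_eq_single (g : Frame n (k + 1) C) (t : Fin (k + 1)) :
    ∃ S : flagSections n k, subEquations g S = Pi.single t 1 := by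
  refine ⟨moveLastSign t • minorFlagSection (Matrix.of fun i => g.ginv (Sum.inl (t.succAbove i)))
    (g.ginv.submatrix Sum.inl id), funext fun j =>
      (subEquations_smul_minorSection g _ t j).trans ?_⟩
  have h : (g.ginv.submatrix Sum.inl id).map (algebraMap ℂ (ChartPoly (k + 1) C)) *
      g.chart (genChart (k + 1) C) = 1 :=
    Matrix.ext fun a b => congrFun (congrFun (g.inv_mul_chart (genChart (k + 1) C)) (Sum.inl a)) b
  rw [h, Matrix.det_one, Pi.single_apply]

theorem exists_subEquations_eq_X (g : Frame n (k + 1) C) (c : Fin C) :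
    ∃ S : flagSections n k, subEquations g S = fun j => MvPolynomial.X (c, j) := by
  refine ⟨∑ t, moveLastSign t •
    minorFlagSection (Matrix.of fun i => g.ginv (Sum.inl (t.succAbove i)))
      ((g.ginv.submatrix Sum.inl id).updateRow t (g.ginv (Sum.inr c))), funext fun j => ?_⟩
  rw [Submodule.coe_sum, map_sum, Finset.sum_apply]
  refine (Finset.sum_congr rfl fun t _ => subEquations_smul_minorSection g _ t j).trans ?_
  simp only [det_updateRow_mul_chart, Finset.sum_ite_eq, Finset.mem_univ, if_true]
  rfl

end SubEquations

/-! ### The two linear systems. -/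

section Main

/-- Distinct coordinate functions vanish at the origin, and their Jacobian matrix is inverted on the
right by the matrix selecting these coordinates. -/
theorem exists_jacobian_right_inverse {σ : Type*} [Fintype σ] {c : ℕ} {F : Fin c → MvPolynomial σ ℂ}
    {l : Fin c → σ} (hl : Function.Injective l) (hF : F = fun r => MvPolynomial.X (l r)) :
    ∃ (y : σ → ℂ) (B : Matrix σ (Fin c) ℂ), (∀ r, MvPolynomial.eval y (F r) = 0) ∧
      ∀ r t, ∑ i, MvPolynomial.eval y (MvPolynomial.pderiv i (F r)) * B i t =
        if r = t then 1 else 0 := by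
  classical
  subst hF
  refine ⟨0, Matrix.of fun i t => if i = l t then 1 else 0, fun r => by simp, fun r t => ?_⟩
  rw [Finset.sum_eq_single (l t) (fun i _ hi => by simp [hi]) (by simp)]
  rcases eq_or_ne r t with rfl | h
  · simp
  · simp [h, MvPolynomial.pderiv_X_of_ne (hl.ne h)]

variable {k n : ℕ}

theorem generalWith_eqs₁ {τ : Type} [Fintype τ] (b : Module.Basis τ ℂ (flagSections n k))
    {C d : ℕ} (hk : 1 ≤ k) (hC : 0 < C) (hn : k + C = n) (hd : d + C = C * k) :
    GeneralWith b fun S => SmoothWithDimAndCanonical (eqs₁ S) d (2 * C - n - 1) := by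
  refine generalWith_smoothWithDimAndCanonical b eqs₁
    (fun g : Frame n k C => (quotientEquations g).comp (flagSections n k).subtype)
    chartEquations_quotientEquations hC hd hn exists_quotientEquations_eq_single fun g => ?_
  -- One column of `Y` serves as the `C` transversal equations; it exists because `k ≥ 1`.
  obtain ⟨S, hS⟩ := exists_quotientEquations_eq_X g ⟨0, hk⟩
  exact ⟨S, exists_jacobian_right_inverse (l := fun j => (j, ⟨0, hk⟩))
    (fun _ _ h => congrArg Prod.fst h) hS⟩

theorem generalWith_eqs₂ {τ : Type} [Fintype τ] (b : Module.Basis τ ℂ (flagSections n k))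
    {C d : ℕ} (hC : 0 < C) (hn : k + 1 + C = n) (hd : d + (k + 1) = C * (k + 1)) :
    GeneralWith b fun S =>
      SmoothWithDimAndCanonical (eqs₂ S) d (2 * (k + 1 : ℕ) - n - 1) := by
  refine generalWith_smoothWithDimAndCanonical b eqs₂
    (fun g : Frame n (k + 1) C => (subEquations g).comp (flagSections n k).subtype)
    chartEquations_subEquations hC hd hn exists_subEquations_eq_single fun g => ?_
  -- One row of `Y` serves as the `k + 1` transversal equations; it exists because `C > 0`, that is,
  -- `n ≥ k + 2`.
  obtain ⟨S, hS⟩ := exists_subEquations_eq_X g ⟨0, hC⟩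
  exact ⟨S, exists_jacobian_right_inverse (l := fun j => (⟨0, hC⟩, j))
    (fun _ _ h => congrArg Prod.snd h) hS⟩

end Main

end GrassmannPair

end

theorem mainTheorem10 (k n : ℕ) (hk : 1 ≤ k) (hn : k + 2 ≤ n) :
    GrassmannPair.ForGeneral fun S : GrassmannPair.flagSections n k =>
      (∃ d₁ : ℕ, (d₁ : ℤ) = k * n - k ^ 2 - n + k ∧
        GrassmannPair.SmoothWithDimAndCanonical (GrassmannPair.eqs₁ S) d₁
          ((n : ℤ) - 2 * k - 1)) ∧
      (∃ d₂ : ℕ, (d₂ : ℤ) = k * n + n - k ^ 2 - 3 * k - 2 ∧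
        GrassmannPair.SmoothWithDimAndCanonical (GrassmannPair.eqs₂ S) d₂
          (-(n : ℤ) + 2 * k + 1)) := by
  -- With `n = k + 2 + m` and `k = 1 + j` no subtraction of natural numbers remains: `d₁ = C k - C`
  -- with `C = m + 2`, and `d₂ = C (k + 1) - (k + 1)` with `C = m + 1`.
  obtain ⟨m, rfl⟩ := Nat.exists_eq_add_of_le hn
  obtain ⟨j, rfl⟩ := Nat.exists_eq_add_of_le hk
  have b := Module.finBasis ℂ (GrassmannPair.flagSections (1 + j + 2 + m) (1 + j))
  have h₁ := GrassmannPair.generalWith_eqs₁ b (C := m + 2) (d := (m + 2) * j) hk (by omega) (by omega)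
    (by ring)
  have h₂ := GrassmannPair.generalWith_eqs₂ b (C := m + 1) (d := m * (1 + j + 1)) (by omega) (by omega)
    (by ring)
  refine ((h₁.and h₂).mono fun S hS =>
    ⟨⟨(m + 2) * j, ?_, ?_⟩, ⟨m * (1 + j + 1), ?_, ?_⟩⟩).forGeneral
  · push_cast
    ring
  · convert hS.1 using 1
    push_cast
    ring
  · push_cast
    ring
  · convert hS.2 using 1
    push_cast
    ring
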